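/- **Conventions.** Logarithms are to base 2. A real number $r$ is *computable* if there is a computable $f:\mathbb N\to\mathbb Q$ with $|f(n)-r|<2^{-n}$ for all $n$. Fix a computable presentation of the complex algebraic numbers, so that finite arrays of them (vectors, matrices, finite sets of vectors) are indexed by natural numbers. A *state* $\rho=(\rho_n)_{n\in\mathbb N}$ is a sequence of density matrices $\rho_n\in\mathbb C^{2^n\times 2^n}$ (positive semidefinite of trace 1) such that, for all $n$, the partial trace of $\rho_{n+1}$ over the last qubit equals $\rho_n$. Let $\tau$ be the state with $\tau_n=2^{-n}I$. A *special projection* is a Hermitian projection matrix $S\in\mathbb C^{2^n\times 2^n}$, for some $n$, with complex algebraic entries; for a state $\rho$ put $\rho(S)=\operatorname{Tr}(\rho_nS)$. A *quantum Schnorr test* is a computable sequence $(S^m)_{m\in\mathbb N}$ of special projections such that $\sum_m\tau(S^m)$ is finite and is a computable real number. A state $\rho$ *fails* the test at $\delta>0$ if $\rho(S^m)>\delta$ for infinitely many $m$; $\rho$ is *quantum Schnorr random* if there are no quantum Schnorr test and no $\delta>0$ such that $\rho$ fails the test at $\delta$. A *computable measure machine* is a partial computable function $C$ from finite bit strings to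 $\mathbb N$ whose domain is prefix-free and such that the Lebesgue (fair coin) measure of the set of infinite bit sequences extending some string in the domain is a computable real number. For such a $C$, a real $\epsilon>0$ and a density matrix $\tau$ on $\mathbb C^{2^n}$, $$QK_C^{\epsilon}(\tau)=\inf\Big\{|\sigma|+\log|F| \;:\; C(\sigma)\text{ halts and outputs an index of } F,\ \text{a finite orthonormal set in } \mathbb C^{2^n}\text{ of vectors with algebraic entries, and } \sum_{v\in F}\langle v|\tau|v\rangle>\epsilon\Big\},$$ where the infimum of the empty set is $\infty$. **Theorem.** A state $\rho$ is quantum Schnorr random if and only if, for every computable measure machine $C$, every real $\epsilon>0$ and every real $d$, the inequality $QK_C^{\epsilon}(\rho_n)>n+d$ holds for all but finitely many $n$. -/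

import Mathlib

open Filter MeasureTheory
open scoped Topology ComplexOrder

namespace QRand

/-! ### Computable real numbers -/

/-- A real `r` is computable if there is a computable sequence of rationals `p n / (q n + 1)`
with `|p n / (q n + 1) - r| < 2⁻ⁿ` for all `n`. -/
def IsComputableReal (r : ℝ) : Prop :=
  ∃ (p : ℕ → ℤ) (q : ℕ → ℕ), Computable p ∧ Computable q ∧
    ∀ n, |(p n : ℝ) / ((q n : ℝ) + 1) - r| < (2 : ℝ)⁻¹ ^ n

/-! ### A computable presentation of the complex algebraic numbers

A real algebraic number is given by an integer polynomial `f` and a dyadic interval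
`[a / 2 ^ k, (a + 1) / 2 ^ k]`: it is the point singled out by bisection of the interval
according to the sign of `f` at the midpoints. If `f` is negative at the left end and nonnegative
at the right end, this is a root of `f` in the interval. Every code denotes a real algebraic number
(`isAlgebraic_realVal`) and every real algebraic number has a code (`exists_realVal_eq`). A complex
algebraic number is given by codes of its real and imaginary parts. -/

/-- Codes `(f, a, k)` of real algebraic numbers; `f` lists the coefficients of a polynomial,
the constant coefficient first. -/
abbrev RealCode : Type := List ℤ × ℤ × ℕ

/-- The value at `x` of the polynomial with coefficient list `f`, constant coefficient first. -/
def evalCoeffs {R : Type} [CommRing R] (f : List ℤ) (x : R) : R :=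
  f.foldr (fun (a : ℤ) (y : R) => (a : R) + x * y) 0

/-- After `n` bisection steps the interval is
`[bisect c n / 2 ^ (k + n), (bisect c n + 1) / 2 ^ (k + n)]`, where `c = (f, a, k)`. -/
def bisect (c : RealCode) : ℕ → ℤ
  | 0 => c.2.1
  | n + 1 =>
    if evalCoeffs c.1 (((2 * bisect c n + 1 : ℤ) : ℚ) / 2 ^ (c.2.2 + n + 1)) < 0
    then 2 * bisect c n + 1 else 2 * bisect c n

/-- The left end of the `n`-th bisection interval. -/
noncomputable def leftEnd (c : RealCode) (n : ℕ) : ℝ := (bisect c n : ℝ) / 2 ^ (c.2.2 + n)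

/-- The real number with code `c`: the common point of the bisection intervals. -/
noncomputable def realVal (c : RealCode) : ℝ := ⨆ n, leftEnd c n

theorem evalCoeffs_ratCast (f : List ℤ) (x : ℚ) :
    evalCoeffs f (x : ℝ) = ((evalCoeffs f x : ℚ) : ℝ) := by
  unfold evalCoeffs
  induction f with
  | nil => simp
  | cons a f ih => simp [ih]

/-- One bisection step: the midpoint becomes the left end if `f` is negative there, and the right
end otherwise. -/
theorem bisect_step (c : RealCode) (n : ℕ) :
    (leftEnd c (n + 1) = leftEnd c n + 1 / 2 ^ (c.2.2 + n + 1) ∧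
      evalCoeffs c.1 (leftEnd c n + 1 / 2 ^ (c.2.2 + n + 1)) < 0) ∨
    (leftEnd c (n + 1) = leftEnd c n ∧
      0 ≤ evalCoeffs c.1 (leftEnd c n + 1 / 2 ^ (c.2.2 + n + 1))) := by
  have hm : leftEnd c n + 1 / 2 ^ (c.2.2 + n + 1) =
      (((((2 * bisect c n + 1 : ℤ) : ℚ) / 2 ^ (c.2.2 + n + 1)) : ℚ) : ℝ) := by
    simp only [leftEnd]
    rw [pow_succ]; push_cast; field_simp; ring
  rw [hm, evalCoeffs_ratCast, ← hm]
  by_cases h : evalCoeffs c.1 (((2 * bisect c n + 1 : ℤ) : ℚ) / 2 ^ (c.2.2 + n + 1)) < 0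
  · left
    refine ⟨?_, by exact_mod_cast h⟩
    simp only [leftEnd, bisect, if_pos h, ← add_assoc]
    rw [pow_succ]; push_cast; field_simp
  · right
    refine ⟨?_, by exact_mod_cast not_lt.mp h⟩
    simp only [leftEnd, bisect, if_neg h, ← add_assoc]
    rw [pow_succ]; push_cast; field_simp

theorem leftEnd_succ_cases (c : RealCode) (n : ℕ) :
    leftEnd c (n + 1) = leftEnd c n ∨
      leftEnd c (n + 1) = leftEnd c n + 1 / 2 ^ (c.2.2 + n + 1) :=
  (bisect_step c n).symm.imp And.left And.left

theorem leftEnd_mono (c : RealCode) : Monotone (leftEnd c) := by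
  refine monotone_nat_of_le_succ fun n => ?_
  rcases leftEnd_succ_cases c n with h | h
  · exact h.ge
  · rw [h]; have : (0 : ℝ) < 1 / 2 ^ (c.2.2 + n + 1) := by positivity
    linarith

theorem rightEnd_antitone (c : RealCode) :
    Antitone fun n => leftEnd c n + 1 / 2 ^ (c.2.2 + n) := by
  refine antitone_nat_of_succ_le fun n => ?_
  have h1 : (1 : ℝ) / 2 ^ (c.2.2 + n) = 2 * (1 / 2 ^ (c.2.2 + n + 1)) := by
    rw [pow_succ]; field_simp
  have : (0 : ℝ) < 1 / 2 ^ (c.2.2 + n + 1) := by positivity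
  simp only [← add_assoc]
  rcases leftEnd_succ_cases c n with h | h <;> rw [h] <;> linarith

theorem bddAbove_leftEnd (c : RealCode) : BddAbove (Set.range (leftEnd c)) := by
  refine ⟨leftEnd c 0 + 1 / 2 ^ (c.2.2 + 0), ?_⟩
  rintro _ ⟨n, rfl⟩
  have h := rightEnd_antitone c (Nat.zero_le n)
  have : (0 : ℝ) < 1 / 2 ^ (c.2.2 + n) := by positivity
  simp only at h
  linarith

theorem tendsto_leftEnd (c : RealCode) : Tendsto (leftEnd c) atTop (𝓝 (realVal c)) :=
  tendsto_atTop_ciSup (leftEnd_mono c) (bddAbove_leftEnd c)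

theorem tendsto_rightEnd (c : RealCode) :
    Tendsto (fun n => leftEnd c n + 1 / 2 ^ (c.2.2 + n)) atTop (𝓝 (realVal c)) := by
  have h : Tendsto (fun n : ℕ => (1 : ℝ) / 2 ^ (c.2.2 + n)) atTop (𝓝 0) := by
    have := (tendsto_pow_atTop_nhds_zero_of_lt_one (r := (1 / 2 : ℝ))
      (by norm_num) (by norm_num)).comp (tendsto_add_atTop_nat c.2.2)
    refine this.congr fun n => ?_
    simp [add_comm]
  simpa using (tendsto_leftEnd c).add h

/-- The polynomial with a given list of coefficients. -/
noncomputable def polyOf (f : List ℤ) : Polynomial ℤ := evalCoeffs f Polynomial.X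

theorem aeval_polyOf {R : Type} [CommRing R] (f : List ℤ) (x : R) :
    Polynomial.aeval x (polyOf f) = evalCoeffs f x := by
  unfold polyOf evalCoeffs
  induction f with
  | nil => simp
  | cons a f ih => simp [ih]

theorem exists_polyOf_eq (p : Polynomial ℤ) : ∃ f, polyOf f = p := by
  induction p using Polynomial.recOnHorner with
  | M0 => exact ⟨[], rfl⟩
  | MC p a _ _ ih =>
    obtain ⟨f, rfl⟩ := ih
    cases f with
    | nil => exact ⟨[a], by simp [polyOf, evalCoeffs]⟩
    | cons b t => exact ⟨(b + a) :: t, by simp [polyOf, evalCoeffs]; ring⟩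
  | MX p _ ih =>
    obtain ⟨f, rfl⟩ := ih
    exact ⟨0 :: f, by simp [polyOf, evalCoeffs, mul_comm]⟩

theorem continuous_evalCoeffs (f : List ℤ) : Continuous fun x : ℝ => evalCoeffs f x := by
  simp_rw [← aeval_polyOf]
  exact (polyOf f).continuous_aeval

theorem bisect_sign (c : RealCode) (n : ℕ) :
    (leftEnd c n = leftEnd c 0 ∨ evalCoeffs c.1 (leftEnd c n) < 0) ∧
    (leftEnd c n + 1 / 2 ^ (c.2.2 + n) = leftEnd c 0 + 1 / 2 ^ (c.2.2 + 0) ∨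
      0 ≤ evalCoeffs c.1 (leftEnd c n + 1 / 2 ^ (c.2.2 + n))) := by
  induction n with
  | zero => exact ⟨Or.inl rfl, Or.inl rfl⟩
  | succ n ih =>
    have h1 : (1 : ℝ) / 2 ^ (c.2.2 + n) =
        1 / 2 ^ (c.2.2 + n + 1) + 1 / 2 ^ (c.2.2 + n + 1) := by
      rw [pow_succ]; field_simp; norm_num
    rw [← add_assoc c.2.2]
    rcases bisect_step c n with ⟨h, hs⟩ | ⟨h, hs⟩
    · rw [h, add_assoc (leftEnd c n), ← h1]
      exact ⟨Or.inr hs, ih.2⟩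
    · rw [h]
      exact ⟨ih.1, Or.inr hs⟩

/-- Every code denotes an algebraic number. -/
theorem isAlgebraic_realVal (c : RealCode) : IsAlgebraic ℚ (realVal c) := by
  have rat : ∀ q : ℚ, realVal c = (q : ℝ) → IsAlgebraic ℚ (realVal c) := by
    intro q hq
    rw [hq]
    exact isAlgebraic_algebraMap (R := ℚ) (A := ℝ) q
  by_cases hl : ∀ n, leftEnd c n = leftEnd c 0
  · refine rat ((c.2.1 : ℚ) / 2 ^ c.2.2) ?_
    rw [tendsto_nhds_unique (tendsto_leftEnd c)
      (tendsto_const_nhds.congr fun n => (hl n).symm)]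
    simp [leftEnd, bisect]
  by_cases hr : ∀ n, leftEnd c n + 1 / 2 ^ (c.2.2 + n) = leftEnd c 0 + 1 / 2 ^ (c.2.2 + 0)
  · refine rat ((c.2.1 : ℚ) / 2 ^ c.2.2 + 1 / 2 ^ c.2.2) ?_
    rw [tendsto_nhds_unique (tendsto_rightEnd c)
      (tendsto_const_nhds.congr fun n => (hr n).symm)]
    simp [leftEnd, bisect]
  push Not at hl hr
  obtain ⟨N, hN⟩ := hl
  obtain ⟨M, hM⟩ := hr
  have hcont := continuous_evalCoeffs c.1
  have h1 : evalCoeffs c.1 (realVal c) ≤ 0 := by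
    refine le_of_tendsto ((hcont.tendsto _).comp (tendsto_leftEnd c)) ?_
    filter_upwards [eventually_ge_atTop N] with n hn
    have hlt := lt_of_le_of_ne (leftEnd_mono c (Nat.zero_le N)) hN.symm
    exact ((bisect_sign c n).1.resolve_left
      (lt_of_lt_of_le hlt (leftEnd_mono c hn)).ne').le
  have h2 : 0 ≤ evalCoeffs c.1 (realVal c) := by
    refine ge_of_tendsto ((hcont.tendsto _).comp (tendsto_rightEnd c)) ?_
    filter_upwards [eventually_ge_atTop M] with n hn
    have hlt := lt_of_le_of_ne (rightEnd_antitone c (Nat.zero_le M)) hM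
    exact (bisect_sign c n).2.resolve_left
      (lt_of_le_of_lt (rightEnd_antitone c hn) hlt).ne
  have hne : polyOf c.1 ≠ 0 := by
    intro h0
    have h3 := (bisect_sign c N).1.resolve_left hN
    rw [← aeval_polyOf, h0] at h3
    simp at h3
  have hz : IsAlgebraic ℤ (realVal c) :=
    ⟨polyOf c.1, hne, by rw [aeval_polyOf]; exact le_antisymm h1 h2⟩
  exact hz.extendScalars (algebraMap ℤ ℚ).injective_int

/-- Every real algebraic number has a code. -/
theorem exists_realVal_eq (x : ℝ) (hx : IsAlgebraic ℚ x) : ∃ c, realVal c = x := by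
  -- an integer polynomial with a simple root at `x` and positive derivative there
  obtain ⟨p, hp0, hp1⟩ : ∃ p : Polynomial ℤ, Polynomial.aeval x p = 0 ∧
      0 < Polynomial.aeval x (Polynomial.derivative p) := by
    have hi : IsIntegral ℚ x := hx.isIntegral
    have hd : Polynomial.aeval x (Polynomial.derivative (minpoly ℚ x)) ≠ 0 :=
      (minpoly.irreducible hi).separable.aeval_derivative_ne_zero (minpoly.aeval ℚ x)
    obtain ⟨b, hb, hq⟩ := IsLocalization.integerNormalization_spec
      (nonZeroDivisors ℤ) (minpoly ℚ x)
    set q := IsLocalization.integerNormalization (nonZeroDivisors ℤ) (minpoly ℚ x)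
    have hb0 : (b : ℝ) ≠ 0 := by exact_mod_cast nonZeroDivisors.ne_zero hb
    have hq0 : Polynomial.aeval x q = 0 :=
      IsLocalization.integerNormalization_aeval_eq_zero _ _ (minpoly.aeval ℚ x)
    have hq1 : Polynomial.aeval x (Polynomial.derivative q) ≠ 0 := by
      rw [← Polynomial.aeval_map_algebraMap ℚ, ← Polynomial.derivative_map, hq]
      simp [hd, hb0]
    rcases hq1.lt_or_gt with h | h
    · exact ⟨-q, by simp [hq0], by simpa using h⟩
    · exact ⟨q, hq0, h⟩
  obtain ⟨f, rfl⟩ := exists_polyOf_eq p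
  have hder : HasDerivAt (fun y : ℝ => evalCoeffs f y)
      (Polynomial.aeval x (Polynomial.derivative (polyOf f))) x := by
    simp_rw [← aeval_polyOf]
    exact (polyOf f).hasDerivAt_aeval x
  rw [aeval_polyOf] at hp0
  obtain ⟨δ, hδ, hlo, hhi⟩ : ∃ δ > 0, (∀ y, x - δ < y → y < x → evalCoeffs f y < 0) ∧
      (∀ y, x < y → y < x + δ → 0 < evalCoeffs f y) := by
    have hs := (hasDerivAt_iff_tendsto_slope.mp hder).eventually (lt_mem_nhds hp1)
    rw [eventually_nhdsWithin_iff, Metric.eventually_nhds_iff] at hs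
    obtain ⟨δ, hδ, h⟩ := hs
    refine ⟨δ, hδ, fun y h1 h2 => ?_, fun y h1 h2 => ?_⟩
    · have := h (y := y) (by rw [Real.dist_eq, abs_lt]; constructor <;> linarith) h2.ne
      rw [slope_def_field, hp0, sub_zero] at this
      by_contra hc
      exact absurd this (not_lt.mpr (div_nonpos_of_nonneg_of_nonpos (not_lt.mp hc)
        (by linarith)))
    · have := h (y := y) (by rw [Real.dist_eq, abs_lt]; constructor <;> linarith) h1.ne'
      rw [slope_def_field, hp0, sub_zero] at this
      by_contra hc
      exact absurd this (not_lt.mpr (div_nonpos_of_nonpos_of_nonneg (not_lt.mp hc)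
        (by linarith)))
  obtain ⟨k, hk⟩ : ∃ k : ℕ, (1 : ℝ) / 2 ^ k < δ := by
    obtain ⟨k, hk⟩ := exists_pow_lt_of_lt_one hδ (y := (1 / 2 : ℝ)) (by norm_num)
    exact ⟨k, by simpa using hk⟩
  have h2k : (0 : ℝ) < 2 ^ k := by positivity
  refine ⟨(f, ⌈x * 2 ^ k⌉ - 1, k), ?_⟩
  set c : RealCode := (f, ⌈x * 2 ^ k⌉ - 1, k) with hc
  have inv : ∀ n, leftEnd c n < x ∧ x ≤ leftEnd c n + 1 / 2 ^ (c.2.2 + n) := by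
    intro n
    induction n with
    | zero =>
      have e1 : leftEnd c 0 = (⌈x * 2 ^ k⌉ - 1) / 2 ^ k := by simp [leftEnd, bisect, hc]
      have e2 : leftEnd c 0 + 1 / 2 ^ (c.2.2 + 0) = ⌈x * 2 ^ k⌉ / 2 ^ k := by
        rw [e1]; simp [hc]; ring
      rw [e2, e1, div_lt_iff₀ h2k, le_div_iff₀ h2k]
      exact ⟨by linarith [Int.ceil_lt_add_one (x * 2 ^ k)], Int.le_ceil _⟩
    | succ n ih =>
      have h1 : (1 : ℝ) / 2 ^ (c.2.2 + n) =
          1 / 2 ^ (c.2.2 + n + 1) + 1 / 2 ^ (c.2.2 + n + 1) := by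
        rw [pow_succ]; field_simp; norm_num
      have h3 : (1 : ℝ) / 2 ^ (c.2.2 + n) ≤ 1 / 2 ^ k :=
        one_div_le_one_div_of_le h2k (pow_le_pow_right₀ (by norm_num) (Nat.le_add_right _ _))
      have h4 : (0 : ℝ) < 1 / 2 ^ (c.2.2 + n + 1) := by positivity
      have hcf : c.1 = f := rfl
      rw [← add_assoc]
      rcases bisect_step c n with ⟨h, hs⟩ | ⟨h, hs⟩ <;> rw [h] <;> rw [hcf] at hs
      · refine ⟨?_, by linarith⟩
        by_contra hcon
        rcases (not_lt.mp hcon).eq_or_lt with he | hl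
        · rw [← he, hp0] at hs; exact lt_irrefl _ hs
        · exact absurd (hhi _ hl (by linarith)) (not_lt.mpr hs.le)
      · refine ⟨by linarith, ?_⟩
        by_contra hcon
        exact absurd (hlo _ (by linarith) (not_le.mp hcon)) (not_lt.mpr hs)
  exact le_antisymm (le_of_tendsto' (tendsto_leftEnd c) fun n => (inv n).1.le)
    (ge_of_tendsto' (tendsto_rightEnd c) fun n => (inv n).2)

/-- Codes of complex algebraic numbers. -/
abbrev AlgCode : Type := RealCode × RealCode

/-- The complex algebraic number with a given code. -/
noncomputable def algVal (c : AlgCode) : ℂ := ⟨realVal c.1, realVal c.2⟩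

/-- Every code of a complex number denotes an algebraic number. -/
theorem isAlgebraic_algVal (c : AlgCode) : IsAlgebraic ℚ (algVal c) := by
  have hI : IsAlgebraic ℚ Complex.I := by
    refine ⟨Polynomial.X ^ 2 + 1, (Polynomial.monic_X_pow_add_C (1 : ℚ) two_ne_zero).ne_zero, ?_⟩
    simp
  have h1 : ∀ r : RealCode, IsAlgebraic ℚ ((realVal r : ℝ) : ℂ) := fun r =>
    (isAlgebraic_realVal r).algebraMap
  have h2 : algVal c = (realVal c.1 : ℂ) + (realVal c.2 : ℂ) * Complex.I :=
    (Complex.re_add_im (algVal c)).symm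
  rw [h2]
  exact (h1 c.1).add ((h1 c.2).mul hI)

/-- Every complex algebraic number has a code. -/
theorem exists_algVal_eq (z : ℂ) (hz : IsAlgebraic ℚ z) : ∃ c, algVal c = z := by
  have hI : IsAlgebraic ℚ Complex.I := by
    refine ⟨Polynomial.X ^ 2 + 1, (Polynomial.monic_X_pow_add_C (1 : ℚ) two_ne_zero).ne_zero, ?_⟩
    simp
  have h2 : IsAlgebraic ℚ (2 : ℂ)⁻¹ := by
    simpa using isAlgebraic_algebraMap (R := ℚ) (A := ℂ) (2 : ℚ)⁻¹
  have hre : ∀ w : ℂ, IsAlgebraic ℚ w → IsAlgebraic ℚ w.re := by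
    intro w hw
    have hc : IsAlgebraic ℚ (starRingEnd ℂ w) :=
      hw.algHom ((Complex.conjAe : ℂ →ₐ[ℝ] ℂ).restrictScalars ℚ)
    have h : ((w.re : ℝ) : ℂ) = (w + starRingEnd ℂ w) * 2⁻¹ := by
      rw [Complex.add_conj]; push_cast; ring
    have h3 : IsAlgebraic ℚ (algebraMap ℝ ℂ w.re) := by
      rw [Complex.coe_algebraMap, h]
      exact (hw.add hc).mul h2
    exact (isAlgebraic_algebraMap_iff (algebraMap ℝ ℂ).injective).mp h3
  obtain ⟨a, ha⟩ := exists_realVal_eq z.re (hre z hz)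
  obtain ⟨b, hb⟩ := exists_realVal_eq z.im (by
    have := hre (-(z * Complex.I)) ((hz.mul hI).neg)
    simpa using this)
  exact ⟨(a, b), Complex.ext ha hb⟩

/-- Codes of finite arrays of complex algebraic numbers: a number of qubits with a list of rows. -/
abbrev ArrayCode : Type := ℕ × List (List AlgCode)

/-- The vector in `ℂ^(2 ^ n)` given by a list of codes (missing entries are zero). -/
noncomputable def vecOfCodes (n : ℕ) (l : List AlgCode) : EuclideanSpace ℂ (Fin (2 ^ n)) :=
  WithLp.toLp 2 fun i => algVal (l.getD i (([], 0, 0), ([], 0, 0)))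

/-- The `2 ^ n × 2 ^ n` matrix given by the list of its rows (missing entries are zero). -/
noncomputable def matOfCodes (n : ℕ) (L : List (List AlgCode)) :
    Matrix (Fin (2 ^ n)) (Fin (2 ^ n)) ℂ :=
  Matrix.of fun i j => algVal ((L.getD i []).getD j (([], 0, 0), ([], 0, 0)))

/-! ### States -/

/-- The partial trace over the last qubit of `ℂ^(2 ^ (n + 1)) = ℂ^(2 ^ n) ⊗ ℂ²`, where the basis
vector `e i ⊗ e b` of the tensor product is the basis vector with number `2 * i + b`. -/
def partialTrace {n : ℕ} (M : Matrix (Fin (2 ^ (n + 1))) (Fin (2 ^ (n + 1))) ℂ) :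
    Matrix (Fin (2 ^ n)) (Fin (2 ^ n)) ℂ :=
  Matrix.of fun i j => ∑ b : Fin 2,
    M (Fin.cast (pow_succ 2 n).symm (finProdFinEquiv (i, b)))
      (Fin.cast (pow_succ 2 n).symm (finProdFinEquiv (j, b)))

/-- A state: a coherent sequence of density matrices, the `n`-th one on `n` qubits. -/
structure QState where
  /-- The restriction of the state to the first `n` qubits. -/
  seq : ∀ n : ℕ, Matrix (Fin (2 ^ n)) (Fin (2 ^ n)) ℂ
  posSemidef : ∀ n, (seq n).PosSemidef
  trace_eq_one : ∀ n, (seq n).trace = 1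
  coherent : ∀ n, partialTrace (seq (n + 1)) = seq n

/-- The tracial state `τ`, with `τ_n = 2⁻ⁿ I`. -/
noncomputable def tracialState : QState where
  seq n := ((2 : ℂ) ^ n)⁻¹ • (1 : Matrix (Fin (2 ^ n)) (Fin (2 ^ n)) ℂ)
  posSemidef n := by
    apply Matrix.PosSemidef.smul Matrix.PosSemidef.one
    have h : ((2 : ℂ) ^ n)⁻¹ = (((2 : ℝ) ^ n)⁻¹ : ℝ) := by push_cast; rfl
    rw [h]
    exact Complex.zero_le_real.mpr (by positivity)
  trace_eq_one n := by
    simp [Matrix.trace_smul, Matrix.trace_one]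
  coherent n := by
    ext i j
    by_cases h : i = j
    · subst h
      simp [partialTrace, pow_succ]
      ring
    · simp [partialTrace, Matrix.one_apply, h]

/-- A special projection on `n` qubits: a Hermitian projection matrix with complex algebraic
entries. -/
structure SpecialProjection where
  /-- The number of qubits. -/
  qubits : ℕ
  /-- The matrix. -/
  mat : Matrix (Fin (2 ^ qubits)) (Fin (2 ^ qubits)) ℂ
  isStarProjection : IsStarProjection mat
  isAlgebraic : ∀ i j, IsAlgebraic ℚ (mat i j)

/-- `ρ(S) = Tr(ρ_n S)` for a special projection `S` on `n` qubits. -/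
noncomputable def QState.prob (ρ : QState) (S : SpecialProjection) : ℝ :=
  (ρ.seq S.qubits * S.mat).trace.re

/-- `c` is a code of the special projection `S`. -/
def IsCodeOf (c : ArrayCode) (S : SpecialProjection) : Prop :=
  c.1 = S.qubits ∧ S.mat = matOfCodes S.qubits c.2

/-- A sequence of special projections is computable if some computable function gives codes of
its terms. -/
def IsComputableSeq (S : ℕ → SpecialProjection) : Prop :=
  ∃ g : ℕ → ArrayCode, Computable g ∧ ∀ m, IsCodeOf (g m) (S m)

/-! ### Quantum Schnorr randomness -/

/-- A strong Solovay test: a computable sequence of special projections with `∑ τ(S m) < ∞`. -/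
def IsStrongSolovayTest (S : ℕ → SpecialProjection) : Prop :=
  IsComputableSeq S ∧ Summable fun m => tracialState.prob (S m)

/-- A quantum Schnorr test: a strong Solovay test such that `∑ τ(S m)` is a computable real. -/
def IsQuantumSchnorrTest (S : ℕ → SpecialProjection) : Prop :=
  IsStrongSolovayTest S ∧ IsComputableReal (∑' m, tracialState.prob (S m))

/-- `ρ` fails the test `S` at `δ` if `ρ(S m) > δ` for infinitely many `m`. -/
def QState.FailsAt (ρ : QState) (S : ℕ → SpecialProjection) (δ : ℝ) : Prop :=
  ∃ᶠ m in atTop, δ < ρ.prob (S m)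

/-- A state is quantum Schnorr random if it passes every quantum Schnorr test, that is, fails it
at no `δ > 0`. -/
def QState.IsQuantumSchnorrRandom (ρ : QState) : Prop :=
  ∀ S, IsQuantumSchnorrTest S → ∀ δ : ℝ, 0 < δ → ¬ ρ.FailsAt S δ

/-! ### Computable measure machines -/

/-- No element of `A` is a proper prefix of another one. -/
def PrefixFree (A : Set (List Bool)) : Prop :=
  ∀ σ ∈ A, ∀ π ∈ A, σ <+: π → σ = π

/-- Lebesgue (fair coin) measure on infinite bit sequences. -/
noncomputable def cantorMeasure : Measure (ℕ → Bool) :=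
  Measure.infinitePi fun _ => (PMF.uniformOfFintype Bool).toMeasure

/-- The set of the infinite bit sequences that extend some string in `A`. -/
def openSetOf (A : Set (List Bool)) : Set (ℕ → Bool) :=
  {X | ∃ σ ∈ A, ∀ (i : ℕ) (h : i < σ.length), X i = σ[i]}

/-- A computable measure machine: a partial computable function from bit strings to natural numbers
whose domain is prefix-free and has computable Lebesgue measure. -/
def IsComputableMeasureMachine (C : List Bool →. ℕ) : Prop :=
  Partrec C ∧ PrefixFree C.Dom ∧
    IsComputableReal (cantorMeasure (openSetOf C.Dom)).toReal

/-- The natural number `k` is an index of the finite set `F` of vectors in `ℂ^(2 ^ n)` with complex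
algebraic entries, in the fixed numbering of finite lists of codes of vectors. -/
def IsIndexOf {n : ℕ} (k : ℕ) (F : Finset (EuclideanSpace ℂ (Fin (2 ^ n)))) : Prop :=
  ∃ L : List (List AlgCode), Encodable.decode (α := ArrayCode) k = some (n, L) ∧
    (F : Set (EuclideanSpace ℂ (Fin (2 ^ n)))) = {v | ∃ l ∈ L, v = vecOfCodes n l}

/-- `QK_C^ε(τ)`: the infimum of `|σ| + log₂ |F|` over all strings `σ` on which `C` outputs a finite
orthonormal set `F` of vectors in `ℂ^(2 ^ n)` with complex algebraic entries such that
`∑ v ∈ F, ⟨v|τ|v⟩ > ε`. The infimum of the empty set is `∞`. -/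
noncomputable def QK (C : List Bool →. ℕ) (ε : ℝ) {n : ℕ}
    (τ : Matrix (Fin (2 ^ n)) (Fin (2 ^ n)) ℂ) : EReal :=
  sInf {x : EReal | ∃ (σ : List Bool) (F : Finset (EuclideanSpace ℂ (Fin (2 ^ n)))),
    (∃ k ∈ C σ, IsIndexOf k F) ∧
    Orthonormal ℂ (fun v : F => (v : EuclideanSpace ℂ (Fin (2 ^ n)))) ∧
    ε < ∑ v ∈ F, (inner ℂ v (Matrix.toEuclideanLin τ v)).re ∧
    x = (((σ.length : ℝ) + Real.logb 2 (F.card : ℝ) : ℝ) : EReal)}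

end QRand

/-!
Both directions translate between projections of small tracial probability and short descriptions
of orthonormal sets. A projection `S` of rank `r` on `n` qubits has `τ(S) = r / 2 ^ n`, and a string
`σ` that describes `r` vectors contributes `2 ^ (-|σ|)` to the measure of the domain of a machine,
so that `|σ| + log₂ r ≤ n + O(1)` says that `τ(S)` is at most about `2 ^ (-|σ|)`. Thus the sum of a
test and the measure of a domain dominate each other, and as both are computable, a dominated
series has a computable sum as well (`isComputableReal_tsum_of_le`).

The difficulty is that linear algebra over the algebraic numbers has to be carried out by
algorithms. The proof avoids exact arithmetic. Values of codes are computable reals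
(`RComputable.realVal`), strict inequalities between them are semidecidable (`SemiDec.lt`), and an
object that satisfies such inequalities is found by search as soon as it is known to exist
(`SemiDec.exists_choice`). The search is for Gaussian integers, whose equations can be written as
strict inequalities (`eq_zero_of_sum_normSq_lt_one`), and these objects exist since a
Gram-Schmidt argument approximates orthonormal vectors by orthogonal vectors over `ℚ(i)`
(`exists_gaussianRational_orthogonal_near`). An approximation is good enough, because a projection
`P` that nearly contains the range of `Q` satisfies `ρ(Q) ≤ 2 ρ(P) + small`
(`re_trace_mul_le_of_projections`), and a constant factor is harmless on both sides.

From machines to tests: a machine is enumerated, and each described set of vectors is replaced by a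
rational projection of no larger rank that nearly fixes the vectors, or by zero if the description
is not short (`exists_test_of_machine`). Whether the described vectors are orthonormal cannot be
decided, but a failure is noticed by a search in parallel (`exists_computable_intProj`).

From tests to machines: each projection gets a near basis of orthogonal integer vectors
(`exists_isNearBasis`), whose normalizations have algebraic entries `p / √s`, and a string whose
dyadic interval lies between the corresponding partial sums of the test. These strings form a
prefix-free set and describe the near bases (`QState.FailsAt.exists_machine`).
-/

namespace QRand

/-! ### Computability of integer arithmetic -/

attribute [fun_prop] Computable

-- Unfolding this predicate is very expensive when a closure lemma fails to apply.
attribute [local irreducible] Computable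

attribute [fun_prop] Computable.id Computable.const Computable.comp Computable.pair

@[fun_prop]
theorem computable_fst {α β γ : Type} [Primcodable α] [Primcodable β] [Primcodable γ]
    {f : α → β × γ} (hf : Computable f) : Computable fun a => (f a).1 := Computable.fst.comp hf

@[fun_prop]
theorem computable_snd {α β γ : Type} [Primcodable α] [Primcodable β] [Primcodable γ]
    {f : α → β × γ} (hf : Computable f) : Computable fun a => (f a).2 := Computable.snd.comp hf

theorem primrec_natCast_sub_natCast : Primrec₂ fun a b : ℕ => (a : ℤ) - b := by
  have h : Primrec₂ fun a b : ℕ => if b ≤ a then 2 * (a - b) else 2 * (b - a - 1) + 1 := by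
    refine Primrec.ite (Primrec.nat_le.comp Primrec.snd Primrec.fst) ?_ ?_
    · exact Primrec.nat_double.comp (Primrec.nat_sub.comp Primrec.fst Primrec.snd)
    · exact Primrec.nat_double_succ.comp (Primrec.nat_sub.comp
        (Primrec.nat_sub.comp Primrec.snd Primrec.fst) (Primrec.const 1))
  refine Primrec₂.encode_iff.mp (h.of_eq fun a b => ?_)
  split_ifs with hab
  · obtain ⟨c, rfl⟩ := Nat.exists_eq_add_of_le hab
    have : ((b + c : ℕ) : ℤ) - b = Int.ofNat c := by simp
    rw [this]; simp; rfl
  · obtain ⟨c, rfl⟩ := Nat.exists_eq_add_of_lt (not_le.mp hab)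
    have : (a : ℤ) - (a + c + 1 : ℕ) = Int.negSucc c := by
      rw [Int.negSucc_eq]; push_cast; ring
    rw [this]
    have h2 : a + c + 1 - a - 1 = c := by omega
    rw [h2]; rfl

theorem primrec_int_toNat : Primrec Int.toNat := by
  have h : Primrec fun z : ℤ =>
      if (Encodable.encode z) % 2 = 0 then Encodable.encode z / 2 else 0 :=
    Primrec.ite (Primrec.eq.comp (Primrec.nat_mod.comp Primrec.encode (Primrec.const 2))
      (Primrec.const 0)) (Primrec.nat_div.comp Primrec.encode (Primrec.const 2)) (Primrec.const 0)
  refine h.of_eq fun z => ?_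
  rcases z with n | n
  · have : Encodable.encode (Int.ofNat n) = 2 * n := rfl
    rw [this]; simp
  · have : Encodable.encode (Int.negSucc n) = 2 * n + 1 := rfl
    rw [this, if_neg (by omega)]; rfl

theorem primrec_int_neg_toNat : Primrec fun z : ℤ => (-z).toNat := by
  have h : Primrec fun z : ℤ =>
      if (Encodable.encode z) % 2 = 0 then 0 else Encodable.encode z / 2 + 1 :=
    Primrec.ite (Primrec.eq.comp (Primrec.nat_mod.comp Primrec.encode (Primrec.const 2))
      (Primrec.const 0)) (Primrec.const 0)
      (Primrec.succ.comp (Primrec.nat_div.comp Primrec.encode (Primrec.const 2)))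
  refine h.of_eq fun z => ?_
  rcases z with n | n
  · have : Encodable.encode (Int.ofNat n) = 2 * n := rfl
    rw [this]; simp
  · have : Encodable.encode (Int.negSucc n) = 2 * n + 1 := rfl
    rw [this, if_neg (by omega), Int.neg_negSucc]; simp; omega

section Closure

variable {α β γ : Type} [Primcodable α] [Primcodable β] [Primcodable γ]

@[fun_prop]
theorem computable_nat_add {f g : α → ℕ} (hf : Computable f) (hg : Computable g) :
    Computable fun a => f a + g a := Primrec.nat_add.to_comp.comp hf hg

@[fun_prop]
theorem computable_nat_mul {f g : α → ℕ} (hf : Computable f) (hg : Computable g) :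
    Computable fun a => f a * g a := Primrec.nat_mul.to_comp.comp hf hg

@[fun_prop]
theorem computable_nat_sub {f g : α → ℕ} (hf : Computable f) (hg : Computable g) :
    Computable fun a => f a - g a := Primrec.nat_sub.to_comp.comp hf hg

@[fun_prop]
theorem computable_nat_pow {f g : α → ℕ} (hf : Computable f) (hg : Computable g) :
    Computable fun a => f a ^ g a :=
  (Primrec₂.unpaired'.1 Nat.Primrec.pow).to_comp.comp hf hg

@[fun_prop]
theorem computable_int_toNat {f : α → ℤ} (hf : Computable f) : Computable fun a => (f a).toNat :=
  primrec_int_toNat.to_comp.comp hf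

@[fun_prop]
theorem computable_natCast_sub {f g : α → ℕ} (hf : Computable f) (hg : Computable g) :
    Computable fun a => (f a : ℤ) - (g a : ℤ) :=
  primrec_natCast_sub_natCast.to_comp.comp hf hg

@[fun_prop]
theorem computable_natCast_int {f : α → ℕ} (hf : Computable f) : Computable fun a => (f a : ℤ) :=
  (computable_natCast_sub hf (Computable.const 0)).of_eq fun a => by simp

@[fun_prop]
theorem computable_int_neg {f : α → ℤ} (hf : Computable f) : Computable fun a => -f a :=
  (computable_natCast_sub (primrec_int_neg_toNat.to_comp.comp hf)
    (computable_int_toNat hf)).of_eq fun a => by omega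

@[fun_prop]
theorem computable_int_add {f g : α → ℤ} (hf : Computable f) (hg : Computable g) :
    Computable fun a => f a + g a := by
  have h : Computable fun a => (((f a).toNat + (g a).toNat : ℕ) : ℤ) -
      (((-f a).toNat + (-g a).toNat : ℕ) : ℤ) := by fun_prop
  exact h.of_eq fun a => by omega

@[fun_prop]
theorem computable_int_sub {f g : α → ℤ} (hf : Computable f) (hg : Computable g) :
    Computable fun a => f a - g a :=
  (computable_int_add hf (computable_int_neg hg)).of_eq fun _ => (sub_eq_add_neg _ _).symm

@[fun_prop]
theorem computable_int_mul {f g : α → ℤ} (hf : Computable f) (hg : Computable g) :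
    Computable fun a => f a * g a := by
  have h : Computable fun a =>
      (((f a).toNat * (g a).toNat + (-f a).toNat * (-g a).toNat : ℕ) : ℤ) -
      (((f a).toNat * (-g a).toNat + (-f a).toNat * (g a).toNat : ℕ) : ℤ) := by fun_prop
  refine h.of_eq fun a => ?_
  have e1 : f a = ((f a).toNat : ℤ) - ((-f a).toNat : ℤ) := by omega
  have e2 : g a = ((g a).toNat : ℤ) - ((-g a).toNat : ℤ) := by omega
  conv_rhs => rw [e1, e2]
  push_cast
  ring

@[fun_prop]
theorem computable_int_natAbs {f : α → ℤ} (hf : Computable f) :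
    Computable fun a => (f a).natAbs := by
  have h : Computable fun a => (f a).toNat + (-f a).toNat := by fun_prop
  exact h.of_eq fun a => by omega

theorem computable_decide_nat_lt {f g : α → ℕ} (hf : Computable f) (hg : Computable g) :
    Computable fun a => decide (f a < g a) :=
  (PrimrecRel.decide Primrec.nat_lt).to_comp.comp hf hg

theorem computable_decide_nat_le {f g : α → ℕ} (hf : Computable f) (hg : Computable g) :
    Computable fun a => decide (f a ≤ g a) :=
  (PrimrecRel.decide Primrec.nat_le).to_comp.comp hf hg

theorem computable_decide_nat_eq {f g : α → ℕ} (hf : Computable f) (hg : Computable g) :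
    Computable fun a => decide (f a = g a) :=
  (PrimrecRel.decide Primrec.eq).to_comp.comp hf hg

theorem computable_decide_int_lt {f g : α → ℤ} (hf : Computable f) (hg : Computable g) :
    Computable fun a => decide (f a < g a) := by
  have h : Computable fun a => decide (0 < (g a - f a).toNat) :=
    computable_decide_nat_lt (by fun_prop) (by fun_prop)
  exact h.of_eq fun a => by rw [decide_eq_decide]; omega

theorem computable_decide_int_le {f g : α → ℤ} (hf : Computable f) (hg : Computable g) :
    Computable fun a => decide (f a ≤ g a) := by
  have h := computable_decide_int_lt hf (g := fun a => g a + 1) (by fun_prop)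
  exact h.of_eq fun a => by rw [decide_eq_decide]; omega

theorem computable_ite {P : α → Prop} [DecidablePred P] {f g : α → β}
    (hP : Computable fun a => decide (P a)) (hf : Computable f) (hg : Computable g) :
    Computable fun a => if P a then f a else g a :=
  (Computable.cond hP hf hg).of_eq fun a => by by_cases h : P a <;> simp [h]

@[fun_prop]
theorem computable_list_getD {f : α → List β} {g : α → ℕ} (d : β) (hf : Computable f)
    (hg : Computable g) : Computable fun a => (f a).getD (g a) d :=
  (Primrec.list_getD d).to_comp.comp hf hg

@[fun_prop]
theorem computable_list_length {f : α → List β} (hf : Computable f) :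
    Computable fun a => (f a).length := Computable.list_length.comp hf

@[fun_prop]
theorem computable_list_cons {f : α → β} {g : α → List β} (hf : Computable f)
    (hg : Computable g) : Computable fun a => f a :: g a := Computable.list_cons.comp hf hg

@[fun_prop]
theorem computable_encode {f : α → β} (hf : Computable f) :
    Computable fun a => Encodable.encode (f a) := Computable.encode.comp hf

/-- Primitive recursion on `ℕ` in an uncurried form. -/
theorem computable_nat_rec {n : α → ℕ} {g : α → β} {h : α × ℕ × β → β} (hn : Computable n)
    (hg : Computable g) (hh : Computable h) :
    Computable fun a => Nat.rec (motive := fun _ => β) (g a) (fun k y => h (a, k, y)) (n a) :=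
  Computable.nat_rec hn hg hh.to₂

theorem exists_computable_rec {n : α → ℕ} {g : α → β} {h : α × ℕ × β → β} (hn : Computable n)
    (hg : Computable g) (hh : Computable h) : ∃ s : α → ℕ → β, (Computable fun a => s a (n a)) ∧
      (∀ a, s a 0 = g a) ∧ ∀ a i, s a (i + 1) = h (a, i, s a i) :=
  ⟨fun a m => Nat.rec (motive := fun _ => β) (g a) (fun k y => h (a, k, y)) m,
    computable_nat_rec hn hg hh, fun _ => rfl, fun _ _ => rfl⟩

@[fun_prop]
theorem computable_map_range {n : α → ℕ} {f : α → ℕ → β} (hn : Computable n)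
    (hf : Computable fun p : α × ℕ => f p.1 p.2) :
    Computable fun a => (List.range (n a)).map (f a) := by
  have h := computable_nat_rec (β := List β) (n := n) (g := fun _ => [])
    (h := fun p => p.2.2 ++ [f p.1 p.2.1]) hn (by fun_prop)
    (Computable.list_append.comp (by fun_prop) (by fun_prop))
  refine h.of_eq fun a => ?_
  induction n a with
  | zero => rfl
  | succ k ih => rw [List.range_succ, List.map_append]; simp [ih]

@[fun_prop]
theorem computable_map_list [Inhabited β] {l : α → List β} {f : α → β → γ} (hl : Computable l)
    (hf : Computable fun p : α × β => f p.1 p.2) :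
    Computable fun a => (l a).map (f a) := by
  have h : Computable fun a => (List.range (l a).length).map
      fun i => f a ((l a).getD i default) := by
    have := hf.comp (f := fun p : α × β => f p.1 p.2)
      (g := fun p : α × ℕ => (p.1, (l p.1).getD p.2 default)) (by fun_prop)
    exact computable_map_range (by fun_prop) this
  refine h.of_eq fun a => ?_
  refine List.ext_getElem (by simp) fun i h1 h2 => ?_
  simp at h1 ⊢
  rw [List.getElem?_eq_getElem h1]; rfl

theorem computable_list_foldr [Inhabited β] {l : α → List β} {g : α → γ} {h : α × β × γ → γ}
    (hl : Computable l) (hg : Computable g) (hh : Computable h) :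
    Computable fun a => (l a).foldr (fun b y => h (a, b, y)) (g a) := by
  have h1 := computable_nat_rec (n := fun a => (l a).length) (g := g)
    (h := fun p => h (p.1, (l p.1).getD ((l p.1).length - 1 - p.2.1) default, p.2.2))
    (by fun_prop) hg (by fun_prop)
  refine h1.of_eq fun a => ?_
  have key : ∀ k ≤ (l a).length, Nat.rec (motive := fun _ => γ) (g a) (fun k y => h (a,
      (l a).getD ((l a).length - 1 - k) default, y)) k =
      ((l a).drop ((l a).length - k)).foldr (fun b y => h (a, b, y)) (g a) := by
    intro k
    induction k with
    | zero => intro _; simp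
    | succ k ih =>
      intro hk
      have e : (l a).length - k = (l a).length - (k + 1) + 1 := by omega
      have hlt : (l a).length - (k + 1) < (l a).length := by omega
      rw [List.drop_eq_getElem_cons hlt, List.foldr_cons, ← e, ← ih (by omega)]
      have e2 : (l a).length - 1 - k = (l a).length - (k + 1) := by omega
      simp only [e2, List.getD_eq_getElem _ _ hlt]
  simpa using key _ le_rfl

end Closure

/-! ### Computable families of real numbers -/

section RComputable

variable {α β γ : Type} [Primcodable α] [Primcodable β] [Primcodable γ]

/-- A family `f` of real numbers is uniformly computable if fractions `p (a, k) / (q (a, k) + 1)`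
within `2⁻ᵏ` of `f a` can be computed from `a` and `k`. -/
@[fun_prop]
def RComputable (f : α → ℝ) : Prop :=
  ∃ (p : α × ℕ → ℤ) (q : α × ℕ → ℕ), Computable p ∧ Computable q ∧
    ∀ a k, |(p (a, k) : ℝ) / ((q (a, k) : ℝ) + 1) - f a| < (2 : ℝ)⁻¹ ^ k

theorem RComputable.of_eq {f g : α → ℝ} (hf : RComputable f) (h : ∀ a, f a = g a) :
    RComputable g := by
  rwa [← funext h]

theorem isComputableReal_iff {r : ℝ} : IsComputableReal r ↔ RComputable fun _ : Unit => r := by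
  constructor
  · rintro ⟨p, q, hp, hq, h⟩
    exact ⟨fun x => p x.2, fun x => q x.2, by fun_prop, by fun_prop, fun _ k => h k⟩
  · rintro ⟨p, q, hp, hq, h⟩
    exact ⟨fun k => p ((), k), fun k => q ((), k), by fun_prop, by fun_prop, fun k => h () k⟩

@[fun_prop]
theorem RComputable.comp {f : β → ℝ} {g : α → β} (hf : RComputable f) (hg : Computable g) :
    RComputable fun a => f (g a) := by
  obtain ⟨p, q, hp, hq, h⟩ := hf
  exact ⟨fun x => p (g x.1, x.2), fun x => q (g x.1, x.2), by fun_prop, by fun_prop,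
    fun a k => h (g a) k⟩

/-- The approximations may be taken with any computable modulus. -/
theorem RComputable.of_approx {f : α → ℝ} {p : α × ℕ → ℤ} {q : α × ℕ → ℕ} (hp : Computable p)
    (hq : Computable q)
    (h : ∀ a k, |(p (a, k) : ℝ) / ((q (a, k) : ℝ) + 1) - f a| < (2 : ℝ)⁻¹ ^ k) :
    RComputable f := ⟨p, q, hp, hq, h⟩

/-- A quotient of integers with positive denominator. -/
theorem RComputable.div {z : α → ℤ} {n : α → ℕ} (hz : Computable z) (hn : Computable n)
    (h0 : ∀ a, 0 < n a) : RComputable fun a => (z a : ℝ) / (n a : ℝ) := by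
  refine ⟨fun x => z x.1, fun x => n x.1 - 1, by fun_prop, by fun_prop, fun a k => ?_⟩
  have : ((n a - 1 : ℕ) : ℝ) + 1 = n a := by
    exact_mod_cast Nat.sub_add_cancel (h0 a)
  simp only [this, sub_self, abs_zero]
  positivity

@[fun_prop]
theorem RComputable.intCast {z : α → ℤ} (hz : Computable z) : RComputable fun a => (z a : ℝ) :=
  (RComputable.div hz (Computable.const 1) fun _ => one_pos).of_eq fun a => by simp

@[fun_prop]
theorem RComputable.natCast {z : α → ℕ} (hz : Computable z) : RComputable fun a => (z a : ℝ) :=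
  (RComputable.intCast (z := fun a => (z a : ℤ)) (by fun_prop)).of_eq fun a => by simp

theorem RComputable.ratCast (x : ℚ) : RComputable fun _ : α => (x : ℝ) :=
  (RComputable.div (Computable.const x.num) (Computable.const x.den) fun _ => x.pos).of_eq
    fun _ => by exact_mod_cast x.num_div_den

@[fun_prop]
theorem RComputable.zero : RComputable fun _ : α => (0 : ℝ) :=
  (RComputable.ratCast 0).of_eq fun _ => by simp

@[fun_prop]
theorem RComputable.one : RComputable fun _ : α => (1 : ℝ) :=
  (RComputable.ratCast 1).of_eq fun _ => by simp

@[fun_prop]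
theorem RComputable.ofNat (n : ℕ) [n.AtLeastTwo] : RComputable fun _ : α => (ofNat(n) : ℝ) :=
  (RComputable.ratCast (OfNat.ofNat n)).of_eq fun _ => by simp

@[fun_prop]
theorem RComputable.inv_two_pow {n : α → ℕ} (hn : Computable n) :
    RComputable fun a => (2 : ℝ)⁻¹ ^ (n a) :=
  (RComputable.div (Computable.const 1) (n := fun a => 2 ^ n a) (by fun_prop)
    fun _ => by positivity).of_eq fun a => by simp

@[fun_prop]
theorem RComputable.add {f g : α → ℝ} (hf : RComputable f) (hg : RComputable g) :
    RComputable fun a => f a + g a := by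
  obtain ⟨p, q, hp, hq, h⟩ := hf
  obtain ⟨p', q', hp', hq', h'⟩ := hg
  refine ⟨fun x => p (x.1, x.2 + 1) * (q' (x.1, x.2 + 1) + 1 : ℕ) +
      p' (x.1, x.2 + 1) * (q (x.1, x.2 + 1) + 1 : ℕ),
    fun x => (q (x.1, x.2 + 1) + 1) * (q' (x.1, x.2 + 1) + 1) - 1, by fun_prop, by fun_prop,
    fun a k => ?_⟩
  have h1 := h a (k + 1)
  have h2 := h' a (k + 1)
  set Q := q (a, k + 1)
  set Q' := q' (a, k + 1)
  set P := p (a, k + 1)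
  set P' := p' (a, k + 1)
  have e : (((Q + 1) * (Q' + 1) - 1 : ℕ) : ℝ) + 1 = (Q + 1) * (Q' + 1) := by
    exact_mod_cast Nat.sub_add_cancel (show 0 < (Q + 1) * (Q' + 1) by positivity)
  have e2 : ((P * (Q' + 1 : ℕ) + P' * (Q + 1 : ℕ) : ℤ) : ℝ) /
      ((((Q + 1) * (Q' + 1) - 1 : ℕ) : ℝ) + 1)
      - (f a + g a) = (P / (Q + 1 : ℝ) - f a) + (P' / (Q' + 1 : ℝ) - g a) := by
    rw [e]; push_cast
    have := Nat.cast_add_one_ne_zero (R := ℝ) Q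
    have := Nat.cast_add_one_ne_zero (R := ℝ) Q'
    field_simp; ring
  refine lt_of_eq_of_lt (congrArg abs e2) ((abs_add_le _ _).trans_lt
    ((add_lt_add h1 h2).trans_eq ?_))
  rw [pow_succ]; ring

@[fun_prop]
theorem RComputable.neg {f : α → ℝ} (hf : RComputable f) : RComputable fun a => -f a := by
  obtain ⟨p, q, hp, hq, h⟩ := hf
  refine ⟨fun x => -p x, q, by fun_prop, hq, fun a k => ?_⟩
  rw [← abs_neg]
  convert h a k using 2
  push_cast; ring

@[fun_prop]
theorem RComputable.sub {f g : α → ℝ} (hf : RComputable f) (hg : RComputable g) :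
    RComputable fun a => f a - g a :=
  (hf.add hg.neg).of_eq fun _ => (sub_eq_add_neg _ _).symm

@[fun_prop]
theorem RComputable.mul {f g : α → ℝ} (hf : RComputable f) (hg : RComputable g) :
    RComputable fun a => f a * g a := by
  obtain ⟨p, q, hp, hq, h⟩ := hf
  obtain ⟨p', q', hp', hq', h'⟩ := hg
  -- the zeroth approximations bound the factors by `b - 1`, so `b` additional bits suffice
  let b : α → ℕ := fun a => (p (a, 0)).natAbs + (p' (a, 0)).natAbs + 3
  have hb : Computable b := by fun_prop
  refine ⟨fun x => p (x.1, x.2 + b x.1) * p' (x.1, x.2 + b x.1),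
    fun x => (q (x.1, x.2 + b x.1) + 1) * (q' (x.1, x.2 + b x.1) + 1) - 1, by fun_prop,
    by fun_prop, fun a k => ?_⟩
  have h1 := h a (k + b a)
  have h2 := h' a (k + b a)
  have bound : ∀ (P : ℤ) (Q : ℕ) (x : ℝ), |(P : ℝ) / ((Q : ℝ) + 1) - x| < (2 : ℝ)⁻¹ ^ 0 →
      |x| ≤ (P.natAbs : ℝ) + 1 := by
    intro P Q x hx
    have h3 : |(P : ℝ) / ((Q : ℝ) + 1)| ≤ P.natAbs := by
      rw [abs_div, Nat.cast_natAbs, Int.cast_abs]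
      refine div_le_self (abs_nonneg _) ?_
      rw [abs_of_pos (by positivity)]
      linarith [(Nat.cast_nonneg Q : (0 : ℝ) ≤ Q)]
    have h4 := abs_sub_abs_le_abs_sub x ((P : ℝ) / ((Q : ℝ) + 1))
    rw [abs_sub_comm] at h4
    rw [pow_zero] at hx
    linarith
  have hF := bound _ _ _ (h a 0)
  have hG := bound _ _ _ (h' a 0)
  set Q := q (a, k + b a)
  set Q' := q' (a, k + b a)
  set P := p (a, k + b a)
  set P' := p' (a, k + b a)
  have e : (((Q + 1) * (Q' + 1) - 1 : ℕ) : ℝ) + 1 = (Q + 1) * (Q' + 1) := by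
    exact_mod_cast Nat.sub_add_cancel (show 0 < (Q + 1) * (Q' + 1) by positivity)
  have e2 : ((P * P' : ℤ) : ℝ) / ((((Q + 1) * (Q' + 1) - 1 : ℕ) : ℝ) + 1) =
      (P / (Q + 1 : ℝ)) * (P' / (Q' + 1 : ℝ)) := by
    rw [e]; push_cast
    rw [div_mul_div_comm]
  refine lt_of_eq_of_lt (congrArg (fun t : ℝ => |t - f a * g a|) e2) ?_
  set u := (P / (Q + 1 : ℝ))
  set v := (P' / (Q' + 1 : ℝ))
  set δ : ℝ := 2⁻¹ ^ (k + b a) with hδ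
  have hδ0 : 0 < δ := by positivity
  have hδ1 : δ ≤ 1 := pow_le_one₀ (by norm_num) (by norm_num)
  have hb2 : ((b a : ℕ) : ℝ) < 2 ^ b a := by exact_mod_cast Nat.lt_two_pow_self
  have e3 : u * v - f a * g a = (u - f a) * (v - g a) + (u - f a) * g a + f a * (v - g a) := by
    ring
  simp only [e3]
  calc |(u - f a) * (v - g a) + (u - f a) * g a + f a * (v - g a)|
      ≤ |u - f a| * |v - g a| + |u - f a| * |g a| + |f a| * |v - g a| := by
        refine (abs_add_three _ _ _).trans ?_
        simp only [abs_mul, le_refl]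
    _ ≤ δ * 1 + δ * (((p' (a, 0)).natAbs : ℝ) + 1) + (((p (a, 0)).natAbs : ℝ) + 1) * δ := by
        gcongr
        linarith
    _ = δ * b a := by simp only [b]; push_cast; ring
    _ < δ * 2 ^ b a := by gcongr
    _ = 2⁻¹ ^ k := by
        rw [hδ, pow_add, mul_assoc, ← mul_pow]; norm_num

@[fun_prop]
theorem RComputable.pow_two {f : α → ℝ} (hf : RComputable f) : RComputable fun a => f a ^ 2 :=
  (hf.mul hf).of_eq fun _ => (sq _).symm

@[fun_prop]
theorem RComputable.sum_range {n : α → ℕ} {f : α → ℕ → ℝ} (hn : Computable n)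
    (hf : RComputable fun x : α × ℕ => f x.1 x.2) :
    RComputable fun a => ∑ i ∈ Finset.range (n a), f a i := by
  obtain ⟨p, q, hp, hq, h⟩ := hf
  -- partial sums of the `(k + n)`-th approximations, as fractions
  have hstep : Computable fun z : (α × ℕ) × ℕ × ℤ × ℕ =>
      (z.2.2.1 * (q ((z.1.1, z.2.1), z.1.2 + n z.1.1) + 1 : ℕ) +
        p ((z.1.1, z.2.1), z.1.2 + n z.1.1) * (z.2.2.2 + 1 : ℕ),
        (z.2.2.2 + 1) * (q ((z.1.1, z.2.1), z.1.2 + n z.1.1) + 1) - 1) := by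
    have hx : Computable fun z : (α × ℕ) × ℕ × ℤ × ℕ => ((z.1.1, z.2.1), z.1.2 + n z.1.1) := by
      fun_prop
    have hp1 := hp.comp hx
    have hq1 := hq.comp hx
    have h1 : Computable fun z : (α × ℕ) × ℕ × ℤ × ℕ => z.2.2.1 := by fun_prop
    have h2 : Computable fun z : (α × ℕ) × ℕ × ℤ × ℕ => z.2.2.2 + 1 := by fun_prop
    have hq2 := computable_nat_add hq1 (Computable.const 1)
    exact (computable_int_add (computable_int_mul h1 (computable_natCast_int hq2))
      (computable_int_mul hp1 (computable_natCast_int h2))).pair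
      (computable_nat_sub (computable_nat_mul h2 hq2) (Computable.const 1))
  obtain ⟨s, hs, hs0, hs1⟩ := exists_computable_rec (n := fun x : α × ℕ => n x.1)
    (g := fun _ => ((0 : ℤ), 0)) (by fun_prop) (by fun_prop) hstep
  refine RComputable.of_approx (p := fun x => (s x (n x.1)).1) (q := fun x => (s x (n x.1)).2)
    (Computable.fst.comp hs) (Computable.snd.comp hs) fun a k => ?_
  have key : ∀ m, |((s (a, k) m).1 : ℝ) / (((s (a, k) m).2 : ℝ) + 1) -
      ∑ i ∈ Finset.range m, f a i| ≤ m * 2⁻¹ ^ (k + n a) := by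
    intro m
    induction m with
    | zero => simp [hs0]
    | succ m ih =>
      have h1 := h (a, m) (k + n a)
      rw [Finset.sum_range_succ, hs1]
      simp only at h1 ⊢
      generalize s (a, k) m = y at ih ⊢
      generalize q ((a, m), k + n a) = Q at h1 ⊢
      generalize p ((a, m), k + n a) = P at h1 ⊢
      have e : (((y.2 + 1) * (Q + 1) - 1 : ℕ) : ℝ) + 1 = (y.2 + 1) * (Q + 1) := by
        exact_mod_cast Nat.sub_add_cancel (show 0 < (y.2 + 1) * (Q + 1) by positivity)
      have e2 : ((y.1 * (Q + 1 : ℕ) + P * (y.2 + 1 : ℕ) : ℤ) : ℝ) /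
          ((((y.2 + 1) * (Q + 1) - 1 : ℕ) : ℝ) + 1) = y.1 / (y.2 + 1 : ℝ) + P / (Q + 1 : ℝ) := by
        rw [e]; push_cast
        have := Nat.cast_add_one_ne_zero (R := ℝ) Q
        have := Nat.cast_add_one_ne_zero (R := ℝ) y.2
        field_simp
      rw [e2, add_sub_add_comm]
      refine (abs_add_le _ _).trans ?_
      push_cast
      linarith
  refine (key (n a)).trans_lt ?_
  have hb : ((n a : ℕ) : ℝ) < 2 ^ n a := by exact_mod_cast Nat.lt_two_pow_self
  calc (n a : ℝ) * 2⁻¹ ^ (k + n a) < 2 ^ n a * 2⁻¹ ^ (k + n a) := by gcongr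
    _ = 2⁻¹ ^ k := by
        rw [pow_add, mul_left_comm, ← mul_pow]; norm_num

theorem RComputable.ite {P : α → Prop} [DecidablePred P] {f g : α → ℝ}
    (hP : Computable fun a => decide (P a)) (hf : RComputable f) (hg : RComputable g) :
    RComputable fun a => if P a then f a else g a := by
  obtain ⟨p, q, hp, hq, h⟩ := hf
  obtain ⟨p', q', hp', hq', h'⟩ := hg
  have hP' : Computable fun x : α × ℕ => decide (P x.1) := hP.comp Computable.fst
  refine ⟨_, _, computable_ite hP' hp hp', computable_ite hP' hq hq', fun a k => ?_⟩
  by_cases hPa : P a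
  · simpa [hPa] using h a k
  · simpa [hPa] using h' a k

end RComputable

/-! ### Semidecidable predicates -/

section SemiDec

variable {α β γ : Type} [Primcodable α] [Primcodable β] [Primcodable γ]

/-- A predicate is semidecidable if it is the existential projection of a computable relation. -/
def SemiDec (P : α → Prop) : Prop :=
  ∃ f : α × ℕ → Bool, Computable f ∧ ∀ a, P a ↔ ∃ k, f (a, k) = true

theorem SemiDec.of_iff {P Q : α → Prop} (hP : SemiDec P) (h : ∀ a, P a ↔ Q a) : SemiDec Q := by
  rwa [← funext fun a => propext (h a)]

theorem SemiDec.of_decide {P : α → Prop} [DecidablePred P] (hP : Computable fun a => decide (P a)) :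
    SemiDec P :=
  ⟨fun x => decide (P x.1), hP.comp Computable.fst, fun a => by simp⟩

theorem SemiDec.or {P Q : α → Prop} (hP : SemiDec P) (hQ : SemiDec Q) :
    SemiDec fun a => P a ∨ Q a := by
  obtain ⟨f, hf, h⟩ := hP
  obtain ⟨g, hg, h'⟩ := hQ
  refine ⟨fun x => f x || g x, Primrec.or.to_comp.comp hf hg, fun a => ?_⟩
  simp only [h, h', Bool.or_eq_true, exists_or]

theorem SemiDec.and {P Q : α → Prop} (hP : SemiDec P) (hQ : SemiDec Q) :
    SemiDec fun a => P a ∧ Q a := by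
  obtain ⟨f, hf, h⟩ := hP
  obtain ⟨g, hg, h'⟩ := hQ
  have hu : Computable fun x : α × ℕ => Nat.unpair x.2 := Computable.unpair.comp Computable.snd
  refine ⟨fun x => f (x.1, (Nat.unpair x.2).1) && g (x.1, (Nat.unpair x.2).2),
    Primrec.and.to_comp.comp (by fun_prop) (by fun_prop), fun a => ?_⟩
  simp only [h, h', Bool.and_eq_true]
  constructor
  · rintro ⟨⟨i, hi⟩, j, hj⟩
    exact ⟨Nat.pair i j, by simpa using ⟨hi, hj⟩⟩
  · rintro ⟨k, h1, h2⟩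
    exact ⟨⟨_, h1⟩, _, h2⟩

theorem SemiDec.lt {f g : α → ℝ} (hf : RComputable f) (hg : RComputable g) :
    SemiDec fun a => f a < g a := by
  have key : ∀ h : α → ℝ, RComputable h → SemiDec fun a => 0 < h a := by
    rintro h ⟨p, q, hp, hq, hh⟩
    refine ⟨fun x => decide ((q x : ℤ) + 1 < p x * 2 ^ x.2), computable_decide_int_lt ?_ ?_,
      fun a => ?_⟩
    · exact computable_int_add (by fun_prop) (Computable.const 1)
    · refine computable_int_mul hp ?_
      have : Computable fun x : α × ℕ => ((2 ^ x.2 : ℕ) : ℤ) := by fun_prop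
      exact this.of_eq fun x => by push_cast; rfl
    · have e : ∀ k, (q (a, k) : ℤ) + 1 < p (a, k) * 2 ^ k ↔
          (2 : ℝ)⁻¹ ^ k < (p (a, k) : ℝ) / ((q (a, k) : ℝ) + 1) := by
        intro k
        rw [lt_div_iff₀ (by positivity), inv_pow, inv_mul_lt_iff₀ (by positivity)]
        rw [mul_comm (p (a, k))]
        exact_mod_cast Iff.rfl
      simp only [decide_eq_true_eq, e]
      constructor
      · intro h0
        obtain ⟨k, hk⟩ := exists_pow_lt_of_lt_one h0 (y := (2⁻¹ : ℝ)) (by norm_num)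
        refine ⟨k + 1, ?_⟩
        have := abs_lt.mp (hh a (k + 1))
        have e2 : (2 : ℝ)⁻¹ ^ k = 2⁻¹ ^ (k + 1) + 2⁻¹ ^ (k + 1) := by rw [pow_succ]; ring
        linarith [this.1]
      · rintro ⟨k, hk⟩
        have := abs_lt.mp (hh a k)
        linarith [this.2]
  exact (key _ (hg.sub hf)).of_iff fun a => sub_pos

/-- A total semidecidable relation has a computable choice function. -/
theorem SemiDec.exists_choice [Inhabited β] {P : α × β → Prop} (hP : SemiDec P)
    (h : ∀ a, ∃ b, P (a, b)) : ∃ f : α → β, Computable f ∧ ∀ a, P (a, f a) := by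
  obtain ⟨t, ht, hPt⟩ := hP
  -- search through pairs of a code of a value and a witness for it
  let val : ℕ → β := fun k => (Encodable.decode (α := β) (Nat.unpair k).1).getD default
  have hval : Computable val :=
    Computable.option_getD (Computable.decode.comp (Computable.fst.comp Computable.unpair))
      (Computable.const default)
  have hu : Computable fun x : α × ℕ => Nat.unpair x.2 := Computable.unpair.comp Computable.snd
  let test : α → ℕ → Bool := fun a k => t ((a, val k), (Nat.unpair k).2)
  have htest : Computable₂ test := by
    change Computable fun x : α × ℕ => t ((x.1, val x.2), (Nat.unpair x.2).2)
    fun_prop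
  have hex : ∀ a, ∃ k, test a k = true := by
    intro a
    obtain ⟨b, hb⟩ := h a
    obtain ⟨w, hw⟩ := (hPt _).1 hb
    exact ⟨Nat.pair (Encodable.encode b) w, by simpa [test, val] using hw⟩
  classical
  have hfind : Computable fun a => Nat.find (hex a) := by
    refine Partrec.of_eq_tot (Partrec.rfind (p := fun a k => (test a k : Part Bool))
      htest.partrec₂) fun a => ?_
    refine Nat.mem_rfind.2 ⟨by simpa using (Nat.find_spec (hex a)).symm, fun {m} hm => ?_⟩
    have := Nat.find_min (hex a) hm
    simpa using this
  refine ⟨fun a => val (Nat.find (hex a)), hval.comp hfind, fun a => ?_⟩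
  exact (hPt _).2 ⟨_, Nat.find_spec (hex a)⟩

end SemiDec

/-! ### Computing with codes of algebraic numbers -/

section Codes

/-- Horner evaluation at `p / D` in fractions: the result `(u, w)` stands for `u / w`. -/
def evalFrac (f : List ℤ) (p : ℤ) (D : ℕ) : ℤ × ℕ :=
  f.foldr (fun a y => (a * (D * y.2 : ℕ) + p * y.1, D * y.2)) (0, 1)

theorem evalFrac_spec (f : List ℤ) (p : ℤ) {D : ℕ} (hD : 0 < D) :
    0 < (evalFrac f p D).2 ∧
      evalCoeffs f ((p : ℚ) / D) = ((evalFrac f p D).1 : ℚ) / ((evalFrac f p D).2 : ℚ) := by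
  have hD' : (D : ℚ) ≠ 0 := by exact_mod_cast hD.ne'
  induction f with
  | nil => simp [evalFrac, evalCoeffs]
  | cons a f ih =>
    obtain ⟨h1, h2⟩ := ih
    have h1' : ((evalFrac f p D).2 : ℚ) ≠ 0 := by exact_mod_cast h1.ne'
    have e : evalFrac (a :: f) p D = (a * (D * (evalFrac f p D).2 : ℕ) + p * (evalFrac f p D).1,
      D * (evalFrac f p D).2) := rfl
    have e' : evalCoeffs (a :: f) ((p : ℚ) / D) =
        a + (p : ℚ) / D * evalCoeffs f ((p : ℚ) / D) := rfl
    rw [e, e', h2]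
    refine ⟨Nat.mul_pos hD h1, ?_⟩
    push_cast
    field_simp

theorem computable_evalFrac : Computable fun x : List ℤ × ℤ × ℕ => evalFrac x.1 x.2.1 x.2.2 := by
  refine computable_list_foldr (l := fun x : List ℤ × ℤ × ℕ => x.1) (g := fun _ => ((0 : ℤ), 1))
    (h := fun z : (List ℤ × ℤ × ℕ) × ℤ × ℤ × ℕ => (z.2.1 * (z.1.2.2 * z.2.2.2 : ℕ) +
      z.1.2.1 * z.2.2.1, z.1.2.2 * z.2.2.2)) (by fun_prop) (by fun_prop) (by fun_prop)

theorem computable_bisect : Computable fun x : RealCode × ℕ => bisect x.1 x.2 := by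
  have hstep : Computable fun z : (RealCode × ℕ) × ℕ × ℤ =>
      if (evalFrac z.1.1.1 (2 * z.2.2 + 1) (2 ^ (z.1.1.2.2 + z.2.1 + 1))).1 < 0
      then 2 * z.2.2 + 1 else 2 * z.2.2 := by
    have h1 : Computable fun z : (RealCode × ℕ) × ℕ × ℤ =>
        (z.1.1.1, (2 * z.2.2 + 1, 2 ^ (z.1.1.2.2 + z.2.1 + 1))) := by fun_prop
    exact computable_ite
      (computable_decide_int_lt (Computable.fst.comp (computable_evalFrac.comp h1))
      (Computable.const 0)) (by fun_prop) (by fun_prop)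
  obtain ⟨s, hs, hs0, hs1⟩ := exists_computable_rec (n := fun x : RealCode × ℕ => x.2)
    (g := fun x : RealCode × ℕ => x.1.2.1) (by fun_prop) (by fun_prop) hstep
  refine hs.of_eq fun x => ?_
  have key : ∀ n, s x n = bisect x.1 n := by
    intro n
    induction n with
    | zero => rw [hs0]; rfl
    | succ n ih =>
      rw [hs1, bisect, ← ih]
      obtain ⟨h1, h2⟩ := evalFrac_spec x.1.1 (2 * s x n + 1)
        (D := 2 ^ (x.1.2.2 + n + 1)) (by positivity)
      have e : evalCoeffs x.1.1 (((2 * s x n + 1 : ℤ) : ℚ) / 2 ^ (x.1.2.2 + n + 1)) < 0 ↔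
          (evalFrac x.1.1 (2 * s x n + 1) (2 ^ (x.1.2.2 + n + 1))).1 < 0 := by
        rw [Nat.cast_pow, Nat.cast_ofNat] at h2
        rw [h2, div_lt_iff₀ (by exact_mod_cast h1), zero_mul]
        exact_mod_cast Iff.rfl
      simp only [e]
  exact key _

@[fun_prop]
theorem RComputable.realVal {α : Type} [Primcodable α] {c : α → RealCode} (hc : Computable c) :
    RComputable fun a => realVal (c a) := by
  suffices h : RComputable fun c : RealCode => QRand.realVal c from h.comp hc
  refine ⟨fun x => bisect x.1 (x.2 + 1), fun x => 2 ^ (x.1.2.2 + (x.2 + 1)) - 1,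
    computable_bisect.comp (f := fun x : RealCode × ℕ => bisect x.1 x.2)
      (g := fun x : RealCode × ℕ => (x.1, x.2 + 1)) (by fun_prop), by fun_prop, fun c k => ?_⟩
  have e : ((2 ^ (c.2.2 + (k + 1)) - 1 : ℕ) : ℝ) + 1 = 2 ^ (c.2.2 + (k + 1)) := by
    exact_mod_cast Nat.sub_add_cancel (show 0 < 2 ^ (c.2.2 + (k + 1)) by positivity)
  simp only [e]
  change |leftEnd c (k + 1) - QRand.realVal c| < _
  have h1 : leftEnd c (k + 1) ≤ QRand.realVal c := le_ciSup (bddAbove_leftEnd c) (k + 1)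
  have h2 : QRand.realVal c ≤ leftEnd c (k + 1) + 1 / 2 ^ (c.2.2 + (k + 1)) :=
    (rightEnd_antitone c).le_of_tendsto (tendsto_rightEnd c) (k + 1)
  have h3 : (1 : ℝ) / 2 ^ (c.2.2 + (k + 1)) < 2⁻¹ ^ k := by
    rw [inv_pow, ← one_div]
    exact one_div_lt_one_div_of_lt (by positivity)
      (pow_lt_pow_right₀ (by norm_num) (by omega))
  rw [abs_sub_comm, abs_of_nonneg (by linarith)]
  linarith

/-- Bisection of `[a, a + 1]` finds the place where the sign of the polynomial changes. -/
theorem realVal_eq_of_sign {f : List ℤ} {a : ℤ} {x : ℝ} (h1 : (a : ℝ) ≤ x) (h2 : x ≤ a + 1)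
    (h : ∀ y : ℝ, a < y → y < a + 1 →
      (evalCoeffs f y < 0 → y ≤ x) ∧ (0 ≤ evalCoeffs f y → x ≤ y)) :
    realVal (f, a, 0) = x := by
  set c : RealCode := (f, a, 0) with hc
  have h0 : leftEnd c 0 = a := by simp [leftEnd, bisect, hc]
  have inv : ∀ n, leftEnd c n ≤ x ∧ x ≤ leftEnd c n + 1 / 2 ^ (c.2.2 + n) := by
    intro n
    induction n with
    | zero => rw [h0]; simpa [hc] using ⟨h1, h2⟩
    | succ n ih =>
      have e : (1 : ℝ) / 2 ^ (c.2.2 + n) = 1 / 2 ^ (c.2.2 + n + 1) + 1 / 2 ^ (c.2.2 + n + 1) := by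
        rw [pow_succ]; field_simp; norm_num
      have hpos : (0 : ℝ) < 1 / 2 ^ (c.2.2 + n + 1) := by positivity
      have hl := leftEnd_mono c (Nat.zero_le n)
      have hr := rightEnd_antitone c (Nat.zero_le n)
      simp only [h0] at hl hr
      have e1 : (1 : ℝ) / 2 ^ (c.2.2 + 0) = 1 := by simp [hc]
      rw [e1] at hr
      have hm := h (leftEnd c n + 1 / 2 ^ (c.2.2 + n + 1)) (by linarith) (by linarith)
      rw [← add_assoc]
      rcases bisect_step c n with ⟨hs, hv⟩ | ⟨hs, hv⟩ <;> rw [hs]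
      · exact ⟨hm.1 hv, by linarith [ih.2]⟩
      · exact ⟨ih.1, hm.2 hv⟩
  exact le_antisymm (le_of_tendsto' (tendsto_leftEnd c) fun n => (inv n).1)
    (ge_of_tendsto' (tendsto_rightEnd c) fun n => (inv n).2)

/-- A code of `p / q`, provided that `|p / q| ≤ 1`. -/
def fracCode (p : ℤ) (q : ℕ) : RealCode := ([-p, q], if 0 ≤ p then 0 else -1, 0)

theorem realVal_fracCode {p : ℤ} {q : ℕ} (hq : 0 < q) (h : |(p : ℝ) / q| ≤ 1) :
    realVal (fracCode p q) = p / q := by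
  have hq' : (0 : ℝ) < q := by exact_mod_cast hq
  have hs : ∀ y : ℝ, (evalCoeffs [-p, (q : ℤ)] y < 0 → y ≤ p / q) ∧
      (0 ≤ evalCoeffs [-p, (q : ℤ)] y → (p : ℝ) / q ≤ y) := by
    intro y
    rw [le_div_iff₀ hq', div_le_iff₀ hq']
    simp only [evalCoeffs, List.foldr, mul_zero, add_zero, Int.cast_neg, Int.cast_natCast]
    constructor <;> intro <;> linarith
  obtain ⟨hl, hr⟩ := abs_le.mp h
  unfold fracCode
  split_ifs with hp
  · have : (0 : ℝ) ≤ p := by exact_mod_cast hp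
    exact realVal_eq_of_sign (by push_cast; positivity) (by push_cast; linarith)
      fun y _ _ => hs y
  · have : (p : ℝ) < 0 := by exact_mod_cast not_le.mp hp
    have h0 : (p : ℝ) / q ≤ 0 := div_nonpos_of_nonpos_of_nonneg this.le hq'.le
    exact realVal_eq_of_sign (by push_cast; linarith) (by push_cast; linarith) fun y _ _ => hs y

@[fun_prop]
theorem computable_fracCode {α : Type} [Primcodable α] {p : α → ℤ} {q : α → ℕ}
    (hp : Computable p) (hq : Computable q) : Computable fun a => fracCode (p a) (q a) := by
  have h := computable_ite (computable_decide_int_le (Computable.const 0) hp)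
    (Computable.const (0 : ℤ)) (Computable.const (-1 : ℤ))
  have h1 : Computable fun a => [-p a, (q a : ℤ)] := by fun_prop
  exact h1.pair (h.pair (Computable.const 0))

/-- A code of `p / √s`, provided that `p² ≤ s`: this is a root of `s X² - p²`. -/
def sqrtCode (p : ℤ) (s : ℕ) : RealCode :=
  if 0 ≤ p then ([-(p * p), 0, s], 0, 0) else ([p * p, 0, -s], -1, 0)

theorem realVal_sqrtCode {p : ℤ} {s : ℕ} (hs : 0 < s) (h : p ^ 2 ≤ s) :
    realVal (sqrtCode p s) = p / √s := by
  have hs' : (0 : ℝ) < s := by exact_mod_cast hs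
  have hr : 0 < √(s : ℝ) := Real.sqrt_pos.mpr hs'
  have hrr : √(s : ℝ) ^ 2 = s := Real.sq_sqrt hs'.le
  have hps : (p : ℝ) ^ 2 ≤ √(s : ℝ) ^ 2 := by rw [hrr]; exact_mod_cast h
  have habs : |(p : ℝ)| ≤ √s := abs_le_of_sq_le_sq hps hr.le
  obtain ⟨hl, hu⟩ := abs_le.mp habs
  unfold sqrtCode
  split_ifs with hp
  · have hp' : (0 : ℝ) ≤ p := by exact_mod_cast hp
    refine realVal_eq_of_sign (by push_cast; positivity)
      (by push_cast; rw [zero_add, div_le_one hr]; exact hu) fun y hy _ => ?_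
    push_cast at hy
    have e : evalCoeffs [-(p * p), 0, (s : ℤ)] y = (y * √s) ^ 2 - (p : ℝ) ^ 2 := by
      rw [mul_pow, hrr]; simp [evalCoeffs]; ring
    rw [e, le_div_iff₀ hr, div_le_iff₀ hr]
    refine ⟨fun h1 => abs_le_of_sq_le_sq' (by linarith) hp' |>.2,
      fun h1 => abs_le_of_sq_le_sq' (by linarith) (by positivity) |>.2⟩
  · have hp' : (p : ℝ) < 0 := by exact_mod_cast not_le.mp hp
    refine realVal_eq_of_sign (by push_cast; rw [le_div_iff₀ hr]; linarith)
      (by push_cast; rw [neg_add_cancel]; exact div_nonpos_of_nonpos_of_nonneg hp'.le hr.le)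
      fun y _ hy => ?_
    push_cast at hy
    rw [neg_add_cancel] at hy
    have e : evalCoeffs [p * p, 0, -(s : ℤ)] y = (p : ℝ) ^ 2 - (y * √s) ^ 2 := by
      rw [mul_pow, hrr]; simp [evalCoeffs]; ring
    have hy2 : y * √s ≤ 0 := mul_nonpos_of_nonpos_of_nonneg hy.le hr.le
    rw [e, le_div_iff₀ hr, div_le_iff₀ hr]
    refine ⟨fun h1 => ?_, fun h1 => ?_⟩
    · have := abs_le_of_sq_le_sq' (a := -(p : ℝ)) (b := -(y * √s)) (by nlinarith) (by linarith)
      linarith [this.2]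
    · have := abs_le_of_sq_le_sq' (a := -(y * √s)) (b := -(p : ℝ)) (by nlinarith) (by linarith)
      linarith [this.2]

@[fun_prop]
theorem computable_sqrtCode {α : Type} [Primcodable α] {p : α → ℤ} {s : α → ℕ}
    (hp : Computable p) (hs : Computable s) : Computable fun a => sqrtCode (p a) (s a) := by
  have h1 : Computable fun a => ([-(p a * p a), 0, (s a : ℤ)], (0 : ℤ), 0) := by fun_prop
  have h2 : Computable fun a => ([p a * p a, 0, -(s a : ℤ)], (-1 : ℤ), 0) := by fun_prop
  exact computable_ite (computable_decide_int_le (Computable.const 0) hp) h1 h2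

end Codes

/-! ### Sums of computable series -/

/-- A series of nonnegative terms dominated by one with a computable sum has a computable sum:
the tails of the larger series control those of the smaller one. -/
theorem isComputableReal_tsum_of_le {a b : ℕ → ℝ} (ha : RComputable a) (hb : RComputable b)
    (h0 : ∀ m, 0 ≤ b m) (hab : ∀ m, b m ≤ a m) (hs : Summable a)
    (hc : IsComputableReal (∑' m, a m)) : IsComputableReal (∑' m, b m) := by
  have hsb : Summable b := Summable.of_nonneg_of_le h0 hab hs
  rw [isComputableReal_iff] at hc
  have hc' : RComputable fun _ : ℕ × ℕ => ∑' m, a m := hc.comp (Computable.const ())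
  have hpart : RComputable fun x : ℕ × ℕ => ∑ m ∈ Finset.range x.2, a m := by
    have : RComputable fun y : (ℕ × ℕ) × ℕ => a y.2 := ha.comp Computable.snd
    exact RComputable.sum_range Computable.snd this
  have hpow : RComputable fun x : ℕ × ℕ => (2 : ℝ)⁻¹ ^ (x.1 + 1) :=
    RComputable.inv_two_pow (by fun_prop)
  obtain ⟨N, hN, htail⟩ := (SemiDec.lt (hc'.sub hpart) hpow).exists_choice (by
    intro n
    have ht := hs.hasSum.tendsto_sum_nat.const_sub (∑' m, a m)
    rw [sub_self] at ht
    have hpos : (0 : ℝ) < 2⁻¹ ^ (n + 1) := by positivity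
    exact (ht.eventually (gt_mem_nhds hpos)).exists)
  have hbs : RComputable fun n : ℕ => ∑ m ∈ Finset.range (N n), b m := by
    have : RComputable fun y : ℕ × ℕ => b y.2 := hb.comp Computable.snd
    exact RComputable.sum_range hN this
  obtain ⟨p, q, hp, hq, h⟩ := hbs
  refine ⟨fun n => p (n, n + 1), fun n => q (n, n + 1), by fun_prop, by fun_prop, fun n => ?_⟩
  have h1 := h n (n + 1)
  have h2 := htail n
  simp only at h2
  have h3 := hs.sum_add_tsum_nat_add (N n)
  have h4 := hsb.sum_add_tsum_nat_add (N n)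
  have h5 : ∑' i, b (i + N n) ≤ ∑' i, a (i + N n) :=
    ((summable_nat_add_iff _).2 hsb).tsum_le_tsum (fun i => hab _) ((summable_nat_add_iff _).2 hs)
  have h6 : 0 ≤ ∑' i, b (i + N n) := tsum_nonneg fun i => h0 _
  have e : (2 : ℝ)⁻¹ ^ n = 2⁻¹ ^ (n + 1) + 2⁻¹ ^ (n + 1) := by rw [pow_succ]; ring
  rw [abs_lt] at h1 ⊢
  constructor <;> linarith [h1.1, h1.2]

/-! ### Prefix-free machines -/

/-- The domain of a partial computable function has a computable enumeration without repetitions,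
indexed by pairs of an argument and the number of steps of its computation. -/
theorem exists_enumeration_graph {C : List Bool →. ℕ} (hC : Partrec C) :
    ∃ e : ℕ → Option (List Bool × ℕ), Computable e ∧
      (∀ x, x.2 ∈ C x.1 ↔ ∃ m, e m = some x) ∧
      ∀ m m' x x', e m = some x → e m' = some x' → x.1 = x'.1 → m = m' := by
  obtain ⟨cd, hcd⟩ := Nat.Partrec.Code.exists_code.1 hC
  let ev : ℕ → ℕ → Option ℕ := fun s i => Nat.Partrec.Code.evaln s cd i
  have hev : ∀ σ k, k ∈ C σ ↔ ∃ s, ev s (Encodable.encode σ) = some k := by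
    intro σ k
    have h1 : k ∈ C σ ↔ k ∈ cd.eval (Encodable.encode σ) := by
      rw [hcd]; simp
    rw [h1, Nat.Partrec.Code.evaln_complete]
    rfl
  have hevc : Computable fun x : ℕ × ℕ => ev x.1 x.2 :=
    Nat.Partrec.Code.primrec_evaln.to_comp.comp
      (g := fun x : ℕ × ℕ => ((x.1, cd), x.2)) (by fun_prop)
  have hmono : ∀ {s t i k}, s ≤ t → ev s i = some k → ev t i = some k := fun hst h =>
    Nat.Partrec.Code.evaln_mono hst h
  -- the pair of `σ` and `s` counts if the computation on `σ` ends in step `s + 1` exactly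
  let e : ℕ → Option (List Bool × ℕ) := fun m =>
    (Encodable.decode₂ (List Bool) (Nat.unpair m).1).bind fun σ =>
      if (ev (Nat.unpair m).2 (Nat.unpair m).1).isSome = true then none
      else (ev ((Nat.unpair m).2 + 1) (Nat.unpair m).1).map fun k => (σ, k)
  have he : ∀ m σ k, e m = some (σ, k) ↔ Encodable.encode σ = (Nat.unpair m).1 ∧
      ev (Nat.unpair m).2 (Encodable.encode σ) = none ∧
      ev ((Nat.unpair m).2 + 1) (Encodable.encode σ) = some k := by
    intro m σ k
    simp only [e, Option.bind_eq_some_iff, Encodable.decode₂_eq_some]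
    constructor
    · rintro ⟨τ, h1, h2⟩
      split_ifs at h2 with h3
      simp only [Option.map_eq_some_iff, Prod.mk.injEq] at h2
      obtain ⟨k', h4, rfl, rfl⟩ := h2
      exact ⟨h1, by rw [h1]; simpa using h3, by rw [h1]; exact h4⟩
    · rintro ⟨h1, h2, h3⟩
      refine ⟨σ, h1, ?_⟩
      rw [← h1, h2, h3]; simp
  refine ⟨e, ?_, ?_, ?_⟩
  · have hu : Computable fun m : ℕ => Nat.unpair m := Computable.unpair
    refine Computable.option_bind (Primrec.decode₂.to_comp.comp (by fun_prop)) ?_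
    have hu' : Computable fun m : ℕ × List Bool => Nat.unpair m.1 := hu.comp Computable.fst
    refine computable_ite (β := Option (List Bool × ℕ)) ?_ (Computable.const none) ?_
    · have : Computable fun x : ℕ × List Bool =>
          (ev (Nat.unpair x.1).2 (Nat.unpair x.1).1).isSome :=
        Primrec.option_isSome.to_comp.comp (hevc.comp
          (g := fun x : ℕ × List Bool => ((Nat.unpair x.1).2, (Nat.unpair x.1).1)) (by fun_prop))
      exact this.of_eq fun x => by simp
    · refine Computable.option_map (hevc.comp
          (g := fun x : ℕ × List Bool => ((Nat.unpair x.1).2 + 1, (Nat.unpair x.1).1))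
          (by fun_prop)) ?_
      change Computable fun y : (ℕ × List Bool) × ℕ => (y.1.2, y.2)
      fun_prop
  · rintro ⟨σ, k⟩
    rw [hev]
    classical
    constructor
    · intro h
      -- a computation never ends in step `0`, so its last step has a predecessor
      have hmin : ∀ m < Nat.find h, ev m (Encodable.encode σ) = none := by
        intro m hm
        by_contra hne
        obtain ⟨k', hk'⟩ := Option.ne_none_iff_exists'.mp hne
        have h1 := hmono hm.le hk'
        rw [Nat.find_spec h, Option.some_inj] at h1
        exact Nat.find_min h hm (h1 ▸ hk')
      obtain ⟨s, hs⟩ : ∃ s, Nat.find h = s + 1 := by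
        refine Nat.exists_eq_succ_of_ne_zero fun h0 => ?_
        have := Nat.find_spec h
        rw [h0] at this
        simp [ev, Nat.Partrec.Code.evaln] at this
      refine ⟨Nat.pair (Encodable.encode σ) s, (he _ _ _).2 ?_⟩
      simp only [Nat.unpair_pair, true_and]
      exact ⟨hmin s (by omega), hs ▸ Nat.find_spec h⟩
    · rintro ⟨m, hm⟩
      exact ⟨_, ((he _ _ _).1 hm).2.2⟩
  · rintro m m' ⟨σ, k⟩ ⟨σ', k'⟩ h h' rfl
    obtain ⟨h1, h2, h3⟩ := (he _ _ _).1 h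
    obtain ⟨h1', h2', h3'⟩ := (he _ _ _).1 h'
    have hs : (Nat.unpair m).2 = (Nat.unpair m').2 := by
      rcases lt_trichotomy (Nat.unpair m).2 (Nat.unpair m').2 with hlt | heq | hlt
      · rw [hmono (Nat.succ_le_of_lt hlt) h3] at h2'; simp at h2'
      · exact heq
      · rw [hmono (Nat.succ_le_of_lt hlt) h3'] at h2; simp at h2
    rw [← Nat.pair_unpair m, ← Nat.pair_unpair m', hs, ← h1, ← h1']

/-- The set of infinite sequences extending `σ`. -/
def cylinderOf (σ : List Bool) : Set (ℕ → Bool) :=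
  {X | ∀ (i : ℕ) (h : i < σ.length), X i = σ[i]}

theorem cylinderOf_eq_pi (σ : List Bool) :
    cylinderOf σ = Set.pi (Finset.range σ.length) fun i => {σ.getD i false} := by
  ext X
  simp only [cylinderOf, Set.mem_ofPred_eq, Set.mem_pi, Finset.coe_range, Set.mem_Iio,
    Set.mem_singleton_iff]
  refine forall_congr' fun i => forall_congr' fun h => ?_
  rw [List.getD_eq_getElem _ _ h]

theorem measurableSet_cylinderOf (σ : List Bool) : MeasurableSet (cylinderOf σ) := by
  rw [cylinderOf_eq_pi]
  exact MeasurableSet.pi (Finset.countable_toSet _) fun _ _ => measurableSet_singleton _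

theorem cantorMeasure_cylinderOf (σ : List Bool) :
    cantorMeasure (cylinderOf σ) = 2⁻¹ ^ σ.length := by
  rw [cylinderOf_eq_pi, cantorMeasure, Measure.infinitePi_pi _ fun _ _ => measurableSet_singleton _]
  simp

theorem disjoint_cylinderOf {σ π : List Bool} (h1 : ¬ σ <+: π) (h2 : ¬ π <+: σ) :
    Disjoint (cylinderOf σ) (cylinderOf π) := by
  have key : ∀ {σ π : List Bool} (X), X ∈ cylinderOf σ → X ∈ cylinderOf π →
      σ.length ≤ π.length → σ <+: π := by
    intro σ π X hσ hπ hle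
    rw [List.prefix_iff_eq_take]
    refine List.ext_getElem (by simpa using hle) fun i hi _ => ?_
    rw [List.getElem_take, ← hσ i hi, ← hπ i (hi.trans_le hle)]
  rw [Set.disjoint_left]
  intro X hσ hπ
  rcases le_total σ.length π.length with h | h
  · exact h1 (key X hσ hπ h)
  · exact h2 (key X hπ hσ h)

instance : IsProbabilityMeasure cantorMeasure := by
  unfold cantorMeasure; infer_instance

/-- The measure of the open set generated by a prefix-free set, as a sum along an enumeration of
the set without repetitions. -/
theorem hasSum_cantorMeasure {A : Set (List Bool)} (hA : PrefixFree A) {t : ℕ → Option (List Bool)}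
    (hmem : ∀ σ, σ ∈ A ↔ ∃ m, t m = some σ)
    (hinj : ∀ m m' σ, t m = some σ → t m' = some σ → m = m') :
    HasSum (fun m => (t m).elim 0 fun σ => (2 : ℝ)⁻¹ ^ σ.length)
      (cantorMeasure (openSetOf A)).toReal := by
  let U : ℕ → Set (ℕ → Bool) := fun m => (t m).elim ∅ cylinderOf
  have hU : openSetOf A = ⋃ m, U m := by
    ext X
    simp only [openSetOf, Set.mem_ofPred_eq, Set.mem_iUnion, U]
    constructor
    · rintro ⟨σ, hσ, hX⟩
      obtain ⟨m, hm⟩ := (hmem σ).1 hσ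
      exact ⟨m, by rw [hm]; exact hX⟩
    · rintro ⟨m, hm⟩
      cases ht : t m with
      | none => simp [ht] at hm
      | some σ => exact ⟨σ, (hmem σ).2 ⟨m, ht⟩, by rw [ht] at hm; exact hm⟩
  have hmeas : ∀ m, MeasurableSet (U m) := by
    intro m
    simp only [U]
    cases t m with
    | none => exact MeasurableSet.empty
    | some σ => exact measurableSet_cylinderOf σ
  have hdisj : Pairwise (Function.onFun Disjoint U) := by
    intro m m' hne
    simp only [Function.onFun, U]
    cases h : t m with
    | none => simp
    | some σ =>
      cases h' : t m' with
      | none => simp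
      | some π =>
        have hσ := (hmem σ).2 ⟨m, h⟩
        have hπ := (hmem π).2 ⟨m', h'⟩
        have hσπ : σ ≠ π := by rintro rfl; exact hne (hinj _ _ _ h h')
        exact disjoint_cylinderOf (fun hp => hσπ (hA _ hσ _ hπ hp))
          (fun hp => hσπ (hA _ hπ _ hσ hp).symm)
  have hval : ∀ m, (cantorMeasure (U m)).toReal =
      (t m).elim 0 fun σ => (2 : ℝ)⁻¹ ^ σ.length := by
    intro m
    simp only [U]
    cases t m with
    | none => simp
    | some σ => simp [cantorMeasure_cylinderOf]
  have hfin : ∑' m, cantorMeasure (U m) ≠ ⊤ := by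
    rw [← measure_iUnion hdisj hmeas]; exact measure_ne_top _ _
  rw [hU, measure_iUnion hdisj hmeas]
  have := ENNReal.hasSum_toReal hfin
  rw [← ENNReal.tsum_toReal_eq (fun m => measure_ne_top _ _)] at this
  simpa only [hval] using this

/-! ### Projections and density matrices -/

section Projections

open Matrix

variable {ι κ : Type} [Fintype ι] [Fintype κ]

theorem re_trace_vecMulVec_mul_bounds (a x : ι → ℂ) :
    0 ≤ (vecMulVec a (star a) * vecMulVec x (star x)).trace.re ∧
      (vecMulVec a (star a) * vecMulVec x (star x)).trace.re ≤
        (vecMulVec a (star a)).trace.re * (vecMulVec x (star x)).trace.re := by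
  have h1 : ∀ v : ι → ℂ, (vecMulVec v (star v)).trace.re = ‖WithLp.toLp 2 v‖ ^ 2 := by
    intro v
    rw [trace_vecMulVec, EuclideanSpace.norm_sq_eq, dotProduct, Complex.re_sum]
    refine Finset.sum_congr rfl fun i _ => ?_
    simp [Complex.mul_conj, Complex.normSq_eq_norm_sq, -Complex.ofReal_pow]
  have h2 : (vecMulVec a (star a) * vecMulVec x (star x)).trace.re =
      ‖inner ℂ (WithLp.toLp 2 a : EuclideanSpace ℂ ι) (WithLp.toLp 2 x)‖ ^ 2 := by
    rw [vecMulVec_mul_vecMulVec, trace_vecMulVec, EuclideanSpace.inner_toLp_toLp]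
    rw [dotProduct_smul, smul_eq_mul, dotProduct_comm (star a) x]
    have : a ⬝ᵥ star x = star (x ⬝ᵥ star a) := by
      rw [← star_dotProduct_star, star_star]
    rw [this, Complex.star_def, Complex.mul_conj, Complex.normSq_eq_norm_sq, Complex.ofReal_re]
  rw [h1, h1, h2, ← mul_pow]
  exact ⟨by positivity, pow_le_pow_left₀ (norm_nonneg _) (norm_inner_le_norm _ _) 2⟩

theorem re_trace_mul_bounds {A X : Matrix ι ι ℂ} (hA : A.PosSemidef) (hX : X.PosSemidef) :
    0 ≤ (A * X).trace.re ∧ (A * X).trace.re ≤ A.trace.re * X.trace.re := by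
  obtain ⟨m, a, rfl⟩ := posSemidef_iff_eq_sum_vecMulVec.mp hA
  obtain ⟨k, x, rfl⟩ := posSemidef_iff_eq_sum_vecMulVec.mp hX
  simp only [Finset.sum_mul_sum, trace_sum, Complex.re_sum]
  exact ⟨Finset.sum_nonneg fun i _ => Finset.sum_nonneg fun j _ =>
      (re_trace_vecMulVec_mul_bounds _ _).1,
    Finset.sum_le_sum fun i _ => Finset.sum_le_sum fun j _ =>
      (re_trace_vecMulVec_mul_bounds _ _).2⟩

theorem IsStarProjection.posSemidef {P : Matrix ι ι ℂ} (hP : IsStarProjection P) :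
    P.PosSemidef := by
  have h : P = Pᴴ * P := by
    rw [show Pᴴ = P from hP.isSelfAdjoint]; exact hP.isIdempotentElem.symm
  rw [h]; exact posSemidef_conjTranspose_mul_self P

/-- If `P` nearly contains the range of `Q`, in the sense that `Tr Q - Tr (Q P)` is small, then a
state gives to `P` at least about half of what it gives to `Q`. This follows from
`Q ≤ 2 P Q P + 2 (1 - P) Q (1 - P)`. -/
theorem re_trace_mul_le_of_projections [DecidableEq ι] {ρ P Q : Matrix ι ι ℂ} (hρ : ρ.PosSemidef)
    (hρ1 : ρ.trace = 1) (hP : IsStarProjection P) (hQ : IsStarProjection Q) :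
    (ρ * Q).trace.re ≤ 2 * (ρ * P).trace.re + 2 * (Q.trace - (Q * P).trace).re := by
  have hPP : P * P = P := hP.isIdempotentElem
  have hPs : Pᴴ = P := hP.isSelfAdjoint
  have hQp := IsStarProjection.posSemidef hQ
  have hQ1 : (1 - Q).PosSemidef := IsStarProjection.posSemidef hQ.one_sub
  have hps : (P - (1 - P))ᴴ = P - (1 - P) := by simp [hPs]
  have h1s : (1 - P)ᴴ = 1 - P := by simp [hPs]
  have X1 : ((P - (1 - P)) * Q * (P - (1 - P))).PosSemidef := by
    have := hQp.mul_mul_conjTranspose_same (P - (1 - P)); rwa [hps] at this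
  have X2 : (P * (1 - Q) * P).PosSemidef := by
    have := hQ1.mul_mul_conjTranspose_same P; rwa [hPs] at this
  have X3 : ((1 - P) * Q * (1 - P)).PosSemidef := by
    have := hQp.mul_mul_conjTranspose_same (1 - P); rwa [h1s] at this
  -- the parallelogram law for `P` and `1 - P` with respect to the form given by `Q`
  have e1 : (P - (1 - P)) * Q * (P - (1 - P)) + Q =
      2 • (P - P * (1 - Q) * P) + 2 • ((1 - P) * Q * (1 - P)) := by
    simp only [two_smul, mul_sub, sub_mul, mul_one, one_mul, hPP]
    abel
  have e2 : ((1 - P) * Q * (1 - P)).trace = Q.trace - (Q * P).trace := by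
    rw [trace_mul_comm, ← mul_assoc,
      show (1 - P) * (1 - P) = 1 - P from hP.one_sub.isIdempotentElem, sub_mul, one_mul,
      trace_sub, trace_mul_comm P Q]
  have b1 := (re_trace_mul_bounds hρ X1).1
  have b2 := (re_trace_mul_bounds hρ X2).1
  have b3 := (re_trace_mul_bounds hρ X3).2
  rw [hρ1, e2, Complex.one_re, one_mul] at b3
  have e3 := congrArg (fun Y => (ρ * Y).trace.re) e1
  simp only [mul_add, mul_sub, two_smul, trace_add, trace_sub, Complex.add_re, Complex.sub_re]
    at e3 b1 b2 b3 ⊢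
  linarith

/-- The columns of `V` form an orthonormal basis of the range of the projection `V * Vᴴ`. -/
theorem isStarProjection_mul_conjTranspose [DecidableEq κ] {V : Matrix ι κ ℂ} (hV : Vᴴ * V = 1) :
    IsStarProjection (V * Vᴴ) where
  isIdempotentElem := by
    rw [IsIdempotentElem, Matrix.mul_assoc, ← Matrix.mul_assoc Vᴴ, hV, Matrix.one_mul]
  isSelfAdjoint := by
    rw [IsSelfAdjoint, star_eq_conjTranspose, conjTranspose_mul, conjTranspose_conjTranspose]

theorem trace_mul_conjTranspose [DecidableEq κ] {V : Matrix ι κ ℂ} (hV : Vᴴ * V = 1) :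
    (V * Vᴴ).trace = Fintype.card κ := by
  rw [trace_mul_comm, hV, trace_one]

theorem re_trace_conjTranspose_mul_self (A : Matrix ι κ ℂ) :
    (Aᴴ * A).trace.re = ∑ j, ∑ i, ((A i j).re ^ 2 + (A i j).im ^ 2) := by
  rw [trace, Complex.re_sum]
  refine Finset.sum_congr rfl fun j _ => ?_
  rw [diag_apply, mul_apply, Complex.re_sum]
  refine Finset.sum_congr rfl fun i _ => ?_
  simp [conjTranspose_apply]; ring

theorem trace_sub_trace_mul_projection {V : Matrix ι κ ℂ} {S : Matrix ι ι ℂ}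
    (hS : IsStarProjection S) :
    ((V * Vᴴ).trace - (V * Vᴴ * S).trace).re =
      ∑ j, ∑ i, (((V - S * V) i j).re ^ 2 + ((V - S * V) i j).im ^ 2) := by
  have hSs : Sᴴ = S := hS.isSelfAdjoint
  have hSS : S * S = S := hS.isIdempotentElem
  rw [← re_trace_conjTranspose_mul_self]
  congr 1
  have e1 : (V - S * V)ᴴ * (V - S * V) = Vᴴ * V - Vᴴ * (S * V) := by
    rw [conjTranspose_sub, conjTranspose_mul, hSs, Matrix.sub_mul, Matrix.mul_sub,
      Matrix.mul_sub, Matrix.mul_assoc Vᴴ S V, Matrix.mul_assoc Vᴴ S (S * V),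
      ← Matrix.mul_assoc S S V, hSS]
    abel
  rw [e1, trace_sub, trace_mul_comm V, Matrix.mul_assoc, trace_mul_comm V, Matrix.mul_assoc]

theorem trace_mul_mul_conjTranspose [DecidableEq ι] (V : Matrix ι κ ℂ) (ρ : Matrix ι ι ℂ) :
    (ρ * (V * Vᴴ)).trace = ∑ j, inner ℂ (WithLp.toLp 2 (V.col j) : EuclideanSpace ℂ ι)
      (Matrix.toEuclideanLin ρ (WithLp.toLp 2 (V.col j))) := by
  rw [← Matrix.mul_assoc, trace_mul_comm, ← Matrix.mul_assoc, trace]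
  refine Finset.sum_congr rfl fun j _ => ?_
  rw [Matrix.toLpLin_toLp, EuclideanSpace.inner_toLp_toLp, diag_apply, Matrix.mul_assoc, mul_apply,
    dotProduct]
  refine Finset.sum_congr rfl fun i _ => ?_
  simp [mul_apply, mulVec, dotProduct, col_apply, mul_comm]

theorem conjTranspose_mul_self_eq_one_iff {κ : Type} [DecidableEq κ] {v : κ → EuclideanSpace ℂ ι} :
    (Matrix.of fun i j => v j i)ᴴ * (Matrix.of fun i j => v j i) = 1 ↔ Orthonormal ℂ v := by
  rw [orthonormal_iff_ite, ← Matrix.ext_iff]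
  refine forall_congr' fun j => forall_congr' fun k => ?_
  rw [mul_apply, one_apply, EuclideanSpace.inner_eq_star_dotProduct, dotProduct]
  simp [mul_comm]

/-- Every projection matrix is of the form `V * Vᴴ` with orthonormal columns. -/
theorem exists_eq_mul_conjTranspose [DecidableEq ι] {S : Matrix ι ι ℂ} (hS : IsStarProjection S) :
    ∃ (r : ℕ) (v : Fin r → EuclideanSpace ℂ ι), Orthonormal ℂ v ∧
      S = (Matrix.of fun i j => v j i) * (Matrix.of fun i j => v j i)ᴴ := by
  have hSs : Sᴴ = S := hS.isSelfAdjoint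
  have hSS : S * S = S := hS.isIdempotentElem
  let T := Matrix.toEuclideanLin S
  let b := stdOrthonormalBasis ℂ (LinearMap.range T)
  have hSb : ∀ j, S *ᵥ (WithLp.ofLp (b j : EuclideanSpace ℂ ι)) =
      WithLp.ofLp (b j : EuclideanSpace ℂ ι) := by
    intro j
    obtain ⟨y, hy⟩ := (b j).2
    rw [← hy]
    change S *ᵥ (S *ᵥ WithLp.ofLp y) = S *ᵥ WithLp.ofLp y
    rw [mulVec_mulVec, hSS]
  have hb : Orthonormal ℂ fun j => (b j : EuclideanSpace ℂ ι) :=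
    b.orthonormal.comp_linearIsometry (LinearMap.range T).subtypeₗᵢ
  refine ⟨_, fun j => (b j : EuclideanSpace ℂ ι), hb, ?_⟩
  set V : Matrix ι (Fin (Module.finrank ℂ (LinearMap.range T))) ℂ :=
    Matrix.of fun i j => (b j : EuclideanSpace ℂ ι) i with hVdef
  have hSV : S * V = V := by
    ext i j
    have := congrFun (hSb j) i
    simpa [mul_apply, mulVec, dotProduct, hVdef] using this
  have hVS : Vᴴ * S = Vᴴ := by
    have := congrArg conjTranspose hSV
    rwa [conjTranspose_mul, hSs] at this
  -- the columns of `S` lie in the range of `S`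
  have key : V * Vᴴ * S = S := by
    ext i k
    have hx := b.sum_repr' ⟨T (WithLp.toLp 2 (Pi.single k 1)), LinearMap.mem_range_self _ _⟩
    have hx2 := congrArg (fun y : LinearMap.range T => (y : EuclideanSpace ℂ ι) i) hx
    have hT : ∀ i, T (WithLp.toLp 2 (Pi.single k 1)) i = S i k := by
      intro i
      change (S *ᵥ Pi.single k 1) i = S i k
      simp
    simp only [hT] at hx2
    rw [← hx2, Matrix.mul_assoc, mul_apply]
    simp only [Submodule.coe_sum, Submodule.coe_smul, WithLp.ofLp_sum, WithLp.ofLp_smul,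
      Finset.sum_apply, Pi.smul_apply, smul_eq_mul]
    refine Finset.sum_congr rfl fun j _ => ?_
    rw [mul_comm]
    congr 1
    rw [Submodule.coe_inner, EuclideanSpace.inner_eq_star_dotProduct, mul_apply, dotProduct]
    refine Finset.sum_congr rfl fun l _ => ?_
    simp only [hT]
    simp [hVdef, mul_comm]
  rw [Matrix.mul_assoc, hVS] at key
  exact key.symm

end Projections

/-! ### Rational orthogonal families -/

section Density

variable {ι : Type} [Fintype ι]

/-- The field `ℚ(i)` of complex numbers with rational real and imaginary parts. -/
def gaussianRationals : Subfield ℂ where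
  carrier := {z | (∃ p : ℚ, (p : ℝ) = z.re) ∧ ∃ q : ℚ, (q : ℝ) = z.im}
  mul_mem' := by
    rintro z w ⟨⟨a, ha⟩, b, hb⟩ ⟨⟨c, hc⟩, d, hd⟩
    exact ⟨⟨a * c - b * d, by simp [← ha, ← hb, ← hc, ← hd]⟩,
      a * d + b * c, by simp [← ha, ← hb, ← hc, ← hd]⟩
  one_mem' := ⟨⟨1, by simp⟩, 0, by simp⟩
  add_mem' := by
    rintro z w ⟨⟨a, ha⟩, b, hb⟩ ⟨⟨c, hc⟩, d, hd⟩
    exact ⟨⟨a + c, by simp [← ha, ← hc]⟩, b + d, by simp [← hb, ← hd]⟩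
  zero_mem' := ⟨⟨0, by simp⟩, 0, by simp⟩
  neg_mem' := by
    rintro z ⟨⟨a, ha⟩, b, hb⟩
    exact ⟨⟨-a, by simp [← ha]⟩, -b, by simp [← hb]⟩
  inv_mem' := by
    rintro z ⟨⟨a, ha⟩, b, hb⟩
    exact ⟨⟨a / (a * a + b * b), by simp [← ha, ← hb, Complex.inv_re, Complex.normSq_apply]⟩,
      -b / (a * a + b * b), by simp [← ha, ← hb, Complex.inv_im, Complex.normSq_apply]⟩

theorem mem_gaussianRationals {z : ℂ} : z ∈ gaussianRationals ↔
    (∃ p : ℚ, (p : ℝ) = z.re) ∧ ∃ q : ℚ, (q : ℝ) = z.im := Iff.rfl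

theorem conj_mem_gaussianRationals {z : ℂ} (hz : z ∈ gaussianRationals) :
    (starRingEnd ℂ) z ∈ gaussianRationals := by
  obtain ⟨⟨a, ha⟩, b, hb⟩ := hz
  exact ⟨⟨a, by simp [ha]⟩, -b, by simp [hb]⟩

theorem inner_mem_gaussianRationals {x y : EuclideanSpace ℂ ι} (hx : ∀ i, x i ∈ gaussianRationals)
    (hy : ∀ i, y i ∈ gaussianRationals) : inner ℂ x y ∈ gaussianRationals := by
  rw [EuclideanSpace.inner_eq_star_dotProduct, dotProduct]
  exact sum_mem fun i _ => mul_mem (hy i) (conj_mem_gaussianRationals (hx i))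

theorem exists_gaussianRational_near (b : EuclideanSpace ℂ ι) {η : ℝ} (hη : 0 < η) :
    ∃ x : EuclideanSpace ℂ ι, (∀ i, x i ∈ gaussianRationals) ∧ ‖x - b‖ < η := by
  have h1 : Dense (gaussianRationals : Set ℂ) := by
    have h2 : Dense (Set.range ((↑) : ℚ → ℝ) ×ˢ Set.range ((↑) : ℚ → ℝ)) :=
      Rat.denseRange_cast.prod Rat.denseRange_cast
    have h3 := h2.preimage Complex.equivRealProdCLM.toHomeomorph.isOpenMap
    convert h3 using 1
    ext z
    simp [mem_gaussianRationals]
  have h4 : Dense {x : ι → ℂ | ∀ i, x i ∈ gaussianRationals} := by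
    have := dense_pi Set.univ (s := fun _ : ι => (gaussianRationals : Set ℂ)) fun _ _ => h1
    convert this using 1
    ext x; simp
  have h5 := h4.preimage (PiLp.homeomorph 2 (fun _ : ι => ℂ)).isOpenMap
  obtain ⟨x, hx, hd⟩ := h5.exists_dist_lt b hη
  exact ⟨x, hx, by rwa [← dist_eq_norm, dist_comm]⟩

/-- Orthonormal families can be approximated by orthogonal families of vectors with entries
in `ℚ(i)`: the Gram–Schmidt process without normalization stays inside `ℚ(i)`. -/
theorem exists_gaussianRational_orthogonal_near {r : ℕ} {b : Fin r → EuclideanSpace ℂ ι}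
    (hb : Orthonormal ℂ b) {η : ℝ} (hη : 0 < η) :
    ∃ u : Fin r → EuclideanSpace ℂ ι, (∀ j i, u j i ∈ gaussianRationals) ∧
      (∀ j k, j ≠ k → inner ℂ (u j) (u k) = 0) ∧ ∀ j, ‖u j - b j‖ < η := by
  induction r generalizing η with
  | zero => exact ⟨fun j => j.elim0, fun j => j.elim0, fun j => j.elim0, fun j => j.elim0⟩
  | succ r ih =>
    -- each of the `r` corrections of the new vector has norm at most `6 * δ`
    let δ : ℝ := min (1 / 2) (η / (6 * r + 2))
    have hδ : 0 < δ := by positivity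
    have hδ1 : δ ≤ 1 / 2 := min_le_left _ _
    have hδ2 : δ * (6 * r + 2) ≤ η := by
      rw [← le_div_iff₀ (by positivity)]; exact min_le_right _ _
    have hb' : Orthonormal ℂ fun j : Fin r => b j.castSucc :=
      hb.comp _ (Fin.castSucc_injective r)
    obtain ⟨u, hu, horth, hnear⟩ := ih hb' hδ
    obtain ⟨x, hx, hxb⟩ := exists_gaussianRational_near (b (Fin.last r)) hδ
    have hun : ∀ j, 1 / 2 ≤ ‖u j‖ := by
      intro j
      have h1 := norm_sub_norm_le (b j.castSucc) (u j)
      rw [hb.1, norm_sub_rev] at h1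
      linarith [hnear j]
    have hu0 : ∀ j, inner ℂ (u j) (u j) ≠ 0 := by
      intro j h
      have := hun j
      rw [inner_self_eq_zero.mp h, norm_zero] at this
      linarith
    let y : EuclideanSpace ℂ ι := x - ∑ j, (inner ℂ (u j) x / inner ℂ (u j) (u j)) • u j
    have hyu : ∀ j, inner ℂ (u j) y = 0 := by
      intro j
      simp only [y, inner_sub_right, inner_sum, inner_smul_right]
      rw [Finset.sum_eq_single j (fun k _ hk => by rw [horth j k hk.symm, mul_zero]) (by simp),
        div_mul_cancel₀ _ (hu0 j), sub_self]
    have hy : ∀ i, y i ∈ gaussianRationals := by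
      intro i
      have : y i = x i - ∑ j, (inner ℂ (u j) x / inner ℂ (u j) (u j)) * u j i := by
        simp [y, WithLp.ofLp_sum]
      rw [this]
      exact sub_mem (hx i) (sum_mem fun j _ => mul_mem (div_mem
        (inner_mem_gaussianRationals (hu j) hx) (inner_mem_gaussianRationals (hu j) (hu j)))
        (hu j i))
    have hyb : ‖y - b (Fin.last r)‖ < η := by
      have hx2 : ‖x‖ ≤ 2 := by
        have h1 := norm_sub_norm_le x (b (Fin.last r))
        rw [hb.1] at h1
        linarith
      have hterm : ∀ j, ‖(inner ℂ (u j) x / inner ℂ (u j) (u j)) • u j‖ ≤ 6 * δ := by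
        intro j
        have h0 : inner ℂ (b j.castSucc) (b (Fin.last r)) = 0 :=
          hb.2 (Fin.castSucc_lt_last j).ne
        have h1 : inner ℂ (u j) x = inner ℂ (u j - b j.castSucc) x +
            inner ℂ (b j.castSucc) (x - b (Fin.last r)) := by
          rw [inner_sub_left, inner_sub_right, h0]; ring
        have h2 : ‖inner ℂ (u j) x‖ ≤ 3 * δ := by
          rw [h1]
          refine (norm_add_le _ _).trans ?_
          have h3 := norm_inner_le_norm (𝕜 := ℂ) (u j - b j.castSucc) x
          have h4 := norm_inner_le_norm (𝕜 := ℂ) (b j.castSucc) (x - b (Fin.last r))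
          rw [hb.1, one_mul] at h4
          have h5 : ‖u j - b j.castSucc‖ * ‖x‖ ≤ δ * 2 :=
            mul_le_mul (hnear j).le hx2 (norm_nonneg _) hδ.le
          linarith
        have hpos : 0 < ‖u j‖ := by linarith [hun j]
        rw [norm_smul, norm_div, inner_self_eq_norm_sq_to_K, norm_pow, RCLike.norm_ofReal,
          abs_norm, div_mul_eq_mul_div, sq, mul_div_mul_right _ _ hpos.ne',
          div_le_iff₀ hpos]
        nlinarith [hun j]
      have h6 : y - b (Fin.last r) = (x - b (Fin.last r)) -
          ∑ j, (inner ℂ (u j) x / inner ℂ (u j) (u j)) • u j := by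
        simp only [y]; abel
      rw [h6]
      refine (norm_sub_le _ _).trans_lt ?_
      have h7 := (norm_sum_le Finset.univ
        fun j => (inner ℂ (u j) x / inner ℂ (u j) (u j)) • u j).trans
        (Finset.sum_le_sum fun j _ => hterm j)
      rw [Finset.sum_const, Finset.card_univ, Fintype.card_fin, nsmul_eq_mul] at h7
      have : 0 < δ := hδ
      linarith
    refine ⟨Fin.snoc u y, ?_, ?_, ?_⟩
    · intro j
      refine Fin.lastCases ?_ (fun j => ?_) j
      · simpa using hy
      · simpa using hu j
    · intro j k
      refine Fin.lastCases ?_ (fun j => ?_) j <;> refine Fin.lastCases ?_ (fun k => ?_) k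
      · simp
      · intro _
        rw [Fin.snoc_last, Fin.snoc_castSucc, ← inner_conj_symm, hyu, map_zero]
      · intro _
        rw [Fin.snoc_last, Fin.snoc_castSucc, hyu]
      · intro hjk
        rw [Fin.snoc_castSucc, Fin.snoc_castSucc]
        exact horth j k fun h => hjk (by rw [h])
    · intro j
      refine Fin.lastCases ?_ (fun j => ?_) j
      · simpa using hyb
      · rw [Fin.snoc_castSucc]
        have : δ ≤ η := by
          have h8 : δ * 1 ≤ δ * (6 * r + 2) := by
            gcongr
            have : (0 : ℝ) ≤ r := by positivity
            linarith
          linarith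
        exact (hnear j).trans_le this

/-- The Gaussian integer given by a pair of integers, as a complex number. -/
def gaussInt (w : ℤ × ℤ) : ℂ := ⟨w.1, w.2⟩

/-- Clearing denominators in a finite family of elements of `ℚ(i)`. -/
theorem exists_common_denominator {κ : Type} [Finite κ] {z : κ → ℂ}
    (hz : ∀ k, z k ∈ gaussianRationals) :
    ∃ (D : ℕ) (w : κ → ℤ × ℤ), 0 < D ∧ ∀ k, gaussInt (w k) = D * z k := by
  choose p hp using fun k => (mem_gaussianRationals.1 (hz k)).1
  choose q hq using fun k => (mem_gaussianRationals.1 (hz k)).2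
  obtain ⟨b, hb⟩ := IsLocalization.exist_integer_multiples_of_finite (nonZeroDivisors ℤ)
    (Sum.elim p q)
  choose f hf using hb
  have hb0 : (b : ℤ) ≠ 0 := nonZeroDivisors.ne_zero b.2
  -- the sign of `b` is moved into the numerators
  refine ⟨(b : ℤ).natAbs, fun k => ((b : ℤ).sign * f (Sum.inl k), (b : ℤ).sign * f (Sum.inr k)),
    Int.natAbs_pos.mpr hb0, fun k => ?_⟩
  have habs : ((((b : ℤ).natAbs : ℕ) : ℝ)) = ((b : ℤ).sign : ℝ) * ((b : ℤ) : ℝ) := by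
    rw [← Int.cast_natCast, ← Int.cast_mul, Int.sign_mul_self_eq_abs, Int.natCast_natAbs]
  have h1 := congrArg (fun t : ℚ => (t : ℝ)) (hf (Sum.inl k))
  have h2 := congrArg (fun t : ℚ => (t : ℝ)) (hf (Sum.inr k))
  simp only [algebraMap_int_eq, eq_intCast, Sum.elim_inl, Sum.elim_inr, zsmul_eq_mul,
    Rat.cast_mul, Rat.cast_intCast, hp, hq] at h1 h2
  apply Complex.ext
  · simp only [gaussInt, Int.cast_mul, Complex.mul_re, Complex.natCast_re, Complex.natCast_im,
      zero_mul, sub_zero, h1, habs]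
    ring
  · simp only [gaussInt, Int.cast_mul, Complex.mul_im, Complex.natCast_re, Complex.natCast_im,
      zero_mul, add_zero, h2, habs]
    ring

end Density

/-! ### Computable families of complex numbers -/

section CComputable

variable {α β : Type} [Primcodable α] [Primcodable β]

/-- A family of complex numbers is uniformly computable if its real and imaginary parts are. -/
@[fun_prop]
def CComputable (f : α → ℂ) : Prop :=
  RComputable (fun a => (f a).re) ∧ RComputable fun a => (f a).im

@[fun_prop]
theorem CComputable.sub {f g : α → ℂ} (hf : CComputable f) (hg : CComputable g) :
    CComputable fun a => f a - g a := ⟨hf.1.sub hg.1, hf.2.sub hg.2⟩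

@[fun_prop]
theorem CComputable.mul {f g : α → ℂ} (hf : CComputable f) (hg : CComputable g) :
    CComputable fun a => f a * g a :=
  ⟨(hf.1.mul hg.1).sub (hf.2.mul hg.2), (hf.1.mul hg.2).add (hf.2.mul hg.1)⟩

@[fun_prop]
theorem CComputable.conj {f : α → ℂ} (hf : CComputable f) :
    CComputable fun a => (starRingEnd ℂ) (f a) := ⟨hf.1, hf.2.neg⟩

@[fun_prop]
theorem CComputable.natCast {f : α → ℕ} (hf : Computable f) : CComputable fun a => (f a : ℂ) :=
  ⟨RComputable.natCast hf, RComputable.zero⟩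

@[fun_prop]
theorem CComputable.gaussInt {f : α → ℤ × ℤ} (hf : Computable f) :
    CComputable fun a => gaussInt (f a) :=
  ⟨RComputable.intCast (by fun_prop), RComputable.intCast (by fun_prop)⟩

@[fun_prop]
theorem CComputable.algVal {f : α → AlgCode} (hf : Computable f) :
    CComputable fun a => algVal (f a) :=
  ⟨RComputable.realVal (by fun_prop), RComputable.realVal (by fun_prop)⟩

@[fun_prop]
theorem CComputable.sum_range {n : α → ℕ} {f : α → ℕ → ℂ} (hn : Computable n)
    (hf : CComputable fun x : α × ℕ => f x.1 x.2) :
    CComputable fun a => ∑ i ∈ Finset.range (n a), f a i :=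
  ⟨(RComputable.sum_range hn hf.1).of_eq fun _ => (Complex.re_sum _ _).symm,
    (RComputable.sum_range hn hf.2).of_eq fun _ => (Complex.im_sum _ _).symm⟩

@[fun_prop]
theorem RComputable.normSq {f : α → ℂ} (hf : CComputable f) :
    RComputable fun a => Complex.normSq (f a) := (hf.1.mul hf.1).add (hf.2.mul hf.2)

@[fun_prop]
theorem RComputable.re {f : α → ℂ} (hf : CComputable f) : RComputable fun a => (f a).re := hf.1

end CComputable

/-! ### Projections with rational entries -/

section IntProj

open Matrix

theorem gaussInt_mem (w : ℤ × ℤ) : gaussInt w ∈ GaussianInt.toComplex.range :=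
  ⟨⟨w.1, w.2⟩, by apply Complex.ext <;> simp [gaussInt]⟩

theorem conj_mem_gaussianInt {z : ℂ} (hz : z ∈ GaussianInt.toComplex.range) :
    (starRingEnd ℂ) z ∈ GaussianInt.toComplex.range := by
  obtain ⟨x, rfl⟩ := hz
  exact ⟨star x, GaussianInt.toComplex_star x⟩

/-- Equations between Gaussian integers can be expressed by strict inequalities. -/
theorem eq_zero_of_sum_normSq_lt_one {κ : Type} {s : Finset κ} {f : κ → ℂ}
    (hf : ∀ k ∈ s, f k ∈ GaussianInt.toComplex.range) (h : ∑ k ∈ s, Complex.normSq (f k) < 1) :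
    ∀ k ∈ s, f k = 0 := by
  intro k hk
  obtain ⟨x, hx⟩ := hf k hk
  have h1 : Complex.normSq (f k) < 1 :=
    (Finset.single_le_sum (fun i _ => Complex.normSq_nonneg (f i)) hk).trans_lt h
  rw [← hx] at h1 ⊢
  change Complex.normSq (x : ℂ) < 1 at h1
  rw [← GaussianInt.intCast_real_norm] at h1
  have h2 : x.norm < 1 := by exact_mod_cast h1
  have h3 : x.norm = 0 := le_antisymm (by omega) (GaussianInt.norm_nonneg x)
  rw [(Zsqrtd.norm_eq_zero_iff (by norm_num) x).mp h3, map_zero]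

/-- The entry of a matrix of Gaussian integers given by the list of its rows. -/
def intEntry (M : List (List (ℤ × ℤ))) (i j : ℕ) : ℂ := gaussInt ((M.getD i []).getD j (0, 0))

@[fun_prop]
theorem CComputable.intEntry {α : Type} [Primcodable α] {M : α → List (List (ℤ × ℤ))}
    {i j : α → ℕ} (hM : Computable M) (hi : Computable i) (hj : Computable j) :
    CComputable fun a => intEntry (M a) (i a) (j a) :=
  CComputable.gaussInt (by fun_prop)

/-- The matrix `D⁻¹ M`, where `M` is a matrix of Gaussian integers. -/
noncomputable def intProj (n : ℕ) (M : List (List (ℤ × ℤ))) (D : ℕ) :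
    Matrix (Fin (2 ^ n)) (Fin (2 ^ n)) ℂ :=
  Matrix.of fun i j => intEntry M i j / D

/-- `D⁻¹ M` is a projection of rank `r`. -/
structure IsIntProj (n : ℕ) (M : List (List (ℤ × ℤ))) (D r : ℕ) : Prop where
  pos : 0 < D
  isStarProjection : IsStarProjection (intProj n M D)
  trace_eq : (intProj n M D).trace = r

/-- A sum of squared absolute values of Gaussian integers. For `D > 0` it is zero if `D⁻¹ M` is a
projection of rank `r`, and at least `1` otherwise. -/
noncomputable def intProjDefect (n : ℕ) (M : List (List (ℤ × ℤ))) (D r : ℕ) : ℝ :=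
  ∑ i ∈ Finset.range (2 ^ n), ∑ j ∈ Finset.range (2 ^ n),
      Complex.normSq (∑ k ∈ Finset.range (2 ^ n), intEntry M i k * intEntry M k j -
        D * intEntry M i j) +
    ∑ i ∈ Finset.range (2 ^ n), ∑ j ∈ Finset.range (2 ^ n),
      Complex.normSq (intEntry M i j - (starRingEnd ℂ) (intEntry M j i)) +
    Complex.normSq (∑ i ∈ Finset.range (2 ^ n), intEntry M i i - D * r)

theorem isIntProj_iff {n : ℕ} {M : List (List (ℤ × ℤ))} {D r : ℕ} :
    IsIntProj n M D r ↔ 0 < D ∧ intProjDefect n M D r < 1 := by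
  have hmem : ∀ i j, intEntry M i j ∈ GaussianInt.toComplex.range := fun i j => gaussInt_mem _
  have hnat : ∀ m : ℕ, (m : ℂ) ∈ GaussianInt.toComplex.range := fun m => natCast_mem _ m
  have key : intProjDefect n M D r < 1 ↔
      (∀ i j : Fin (2 ^ n), ∑ k : Fin (2 ^ n), intEntry M i k * intEntry M k j =
        D * intEntry M i j) ∧
      (∀ i j : Fin (2 ^ n), intEntry M i j = (starRingEnd ℂ) (intEntry M j i)) ∧
      ∑ i : Fin (2 ^ n), intEntry M i i = D * r := by
    unfold intProjDefect
    simp only [Finset.sum_range]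
    constructor
    · intro h
      have n1 : 0 ≤ ∑ i : Fin (2 ^ n), ∑ j : Fin (2 ^ n),
        Complex.normSq (∑ k : Fin (2 ^ n), intEntry M i k * intEntry M k j -
          D * intEntry M i j) :=
        Finset.sum_nonneg fun i _ => Finset.sum_nonneg fun j _ => Complex.normSq_nonneg _
      have n2 : 0 ≤ ∑ i : Fin (2 ^ n), ∑ j : Fin (2 ^ n),
        Complex.normSq (intEntry M i j - (starRingEnd ℂ) (intEntry M j i)) :=
        Finset.sum_nonneg fun i _ => Finset.sum_nonneg fun j _ => Complex.normSq_nonneg _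
      have n3 := Complex.normSq_nonneg (∑ i : Fin (2 ^ n), intEntry M i i - D * r)
      refine ⟨fun i j => ?_, fun i j => ?_, ?_⟩
      · have h1 := eq_zero_of_sum_normSq_lt_one (s := Finset.univ ×ˢ Finset.univ)
          (f := fun x : Fin (2 ^ n) × Fin (2 ^ n) =>
            ∑ k : Fin (2 ^ n), intEntry M x.1 k * intEntry M k x.2 - D * intEntry M x.1 x.2)
          (fun x _ => sub_mem (sum_mem fun k _ => mul_mem (hmem _ _) (hmem _ _))
            (mul_mem (hnat _) (hmem _ _))) (by rw [Finset.sum_product]; linarith)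
          (i, j) (by simp)
        exact sub_eq_zero.mp h1
      · have h1 := eq_zero_of_sum_normSq_lt_one (s := Finset.univ ×ˢ Finset.univ)
          (f := fun x : Fin (2 ^ n) × Fin (2 ^ n) =>
            intEntry M x.1 x.2 - (starRingEnd ℂ) (intEntry M x.2 x.1))
          (fun x _ => sub_mem (hmem _ _) (conj_mem_gaussianInt (hmem _ _)))
          (by rw [Finset.sum_product]; linarith)
          (i, j) (by simp)
        exact sub_eq_zero.mp h1
      · have h1 := eq_zero_of_sum_normSq_lt_one (s := Finset.univ)
          (f := fun _ : Unit => ∑ i : Fin (2 ^ n), intEntry M i i - D * r)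
          (fun x _ => sub_mem (sum_mem fun k _ => hmem _ _)
            (mul_mem (hnat _) (hnat _)))
          (by simp only [Finset.univ_unique, Finset.sum_singleton]; linarith)
          () (by simp)
        exact sub_eq_zero.mp h1
    · rintro ⟨h1, h2, h3⟩
      simp only [h1, sub_self, map_zero, Finset.sum_const_zero, h3, zero_add, add_zero]
      simp only [← h2, sub_self, map_zero, Finset.sum_const_zero, zero_lt_one]
  have main : ∀ hD : 0 < D, ((IsStarProjection (intProj n M D) ∧ (intProj n M D).trace = r) ↔
      intProjDefect n M D r < 1) := by
    intro hD
    have hD' : (D : ℂ) ≠ 0 := by exact_mod_cast hD.ne'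
    rw [key]
    constructor
    · rintro ⟨⟨h1, h2⟩, h3⟩
      refine ⟨fun i j => ?_, fun i j => ?_, ?_⟩
      · have := congrFun (congrFun h1 i) j
        simp only [mul_apply, intProj, of_apply, div_mul_div_comm, ← Finset.sum_div] at this
        field_simp at this
        exact this
      · have := congrFun (congrFun h2 i) j
        simp only [star_apply, intProj, of_apply, star_div₀, star_natCast] at this
        field_simp at this
        exact this.symm
      · simp only [trace, diag_apply, intProj, of_apply, ← Finset.sum_div] at h3
        field_simp at h3
        exact h3
    · rintro ⟨h1, h2, h3⟩
      refine ⟨⟨?_, ?_⟩, ?_⟩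
      · ext i j
        simp only [mul_apply, intProj, of_apply, div_mul_div_comm, ← Finset.sum_div, h1]
        field_simp
      · ext i j
        simp only [star_apply, intProj, of_apply, star_div₀, star_natCast]
        rw [h2 i j]; rfl
      · simp only [trace, diag_apply, intProj, of_apply, ← Finset.sum_div, h3]
        field_simp
  exact ⟨fun h => ⟨h.pos, (main h.pos).1 ⟨h.isStarProjection, h.trace_eq⟩⟩,
    fun h => ⟨h.1, ((main h.1).2 h.2).1, ((main h.1).2 h.2).2⟩⟩

theorem RComputable.intProjDefect {α : Type} [Primcodable α] {n D r : α → ℕ}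
    {M : α → List (List (ℤ × ℤ))} (hn : Computable n) (hM : Computable M) (hD : Computable D)
    (hr : Computable r) : RComputable fun a => intProjDefect (n a) (M a) (D a) (r a) := by
  unfold QRand.intProjDefect
  fun_prop

theorem normSq_apply_le_one {n : ℕ} {P : Matrix (Fin n) (Fin n) ℂ} (hP : IsStarProjection P)
    (i j : Fin n) : Complex.normSq (P i j) ≤ 1 := by
  have h1 : ∀ i j, P j i = (starRingEnd ℂ) (P i j) := fun i j =>
    (congrFun (congrFun hP.isSelfAdjoint j) i).symm
  have h2 : P j j = ((∑ k, Complex.normSq (P k j) : ℝ) : ℂ) := by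
    have := congrFun (congrFun hP.isIdempotentElem j) j
    rw [mul_apply] at this
    rw [← this]
    push_cast
    refine Finset.sum_congr rfl fun k _ => ?_
    rw [h1 k j, mul_comm, Complex.mul_conj]
  have h3 : (P j j).re = ∑ k, Complex.normSq (P k j) := by
    have := congrArg Complex.re h2
    rwa [Complex.ofReal_re] at this
  have h4 : ∀ k, Complex.normSq (P k j) ≤ (P j j).re := fun k => by
    rw [h3]
    exact Finset.single_le_sum (fun l _ => Complex.normSq_nonneg (P l j)) (Finset.mem_univ k)
  have h5 := h4 j
  rw [Complex.normSq_apply] at h5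
  have h6 : (P j j).re ≤ 1 := by nlinarith [mul_self_nonneg (P j j).im]
  exact (h4 i).trans h6

theorem getD_map_range {β : Type} {n i : ℕ} (f : ℕ → β) (d : β) (hi : i < n) :
    ((List.range n).map f).getD i d = f i := by
  rw [List.getD_eq_getElem _ _ (by simpa using hi), List.getElem_map, List.getElem_range]

theorem getD_ofFn {β : Type} {n : ℕ} (f : Fin n → β) (d : β) (i : Fin n) :
    (List.ofFn f).getD i d = f i := by
  rw [List.getD_eq_getElem _ _ (by simp), List.getElem_ofFn]

/-- The code of the matrix `D⁻¹ M`. -/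
def intProjCode (n : ℕ) (M : List (List (ℤ × ℤ))) (D : ℕ) : ArrayCode :=
  (n, (List.range (2 ^ n)).map fun i => (List.range (2 ^ n)).map fun j =>
    (fracCode ((M.getD i []).getD j (0, 0)).1 D, fracCode ((M.getD i []).getD j (0, 0)).2 D))

theorem computable_intProjCode {α : Type} [Primcodable α] {n D : α → ℕ}
    {M : α → List (List (ℤ × ℤ))} (hn : Computable n) (hM : Computable M) (hD : Computable D) :
    Computable fun a => intProjCode (n a) (M a) (D a) := by
  unfold intProjCode
  have h : Computable fun x : (α × ℕ) × ℕ =>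
      (fracCode (((M x.1.1).getD x.1.2 []).getD x.2 (0, 0)).1 (D x.1.1),
        fracCode (((M x.1.1).getD x.1.2 []).getD x.2 (0, 0)).2 (D x.1.1)) := by fun_prop
  have h2 := computable_map_range (α := α × ℕ) (n := fun x => 2 ^ n x.1)
    (f := fun x j => (fracCode (((M x.1).getD x.2 []).getD j (0, 0)).1 (D x.1),
        fracCode (((M x.1).getD x.2 []).getD j (0, 0)).2 (D x.1))) (by fun_prop) h
  exact hn.pair (computable_map_range (by fun_prop) h2)

theorem IsIntProj.matOfCodes_eq {n : ℕ} {M : List (List (ℤ × ℤ))} {D r : ℕ}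
    (h : IsIntProj n M D r) : matOfCodes n (intProjCode n M D).2 = intProj n M D := by
  have hD : (0 : ℝ) < D := by exact_mod_cast h.pos
  ext i j
  have hle := normSq_apply_le_one h.isStarProjection i j
  have e : intProj n M D i j = ⟨(((M.getD i []).getD j (0, 0)).1 : ℝ) / D,
      (((M.getD i []).getD j (0, 0)).2 : ℝ) / D⟩ := by
    simp only [intProj, of_apply, intEntry, gaussInt]
    apply Complex.ext
    · rw [Complex.div_natCast_re]
    · rw [Complex.div_natCast_im]
  rw [e] at hle ⊢
  rw [Complex.normSq_mk] at hle
  have h1 : |(((M.getD i []).getD j (0, 0)).1 : ℝ) / D| ≤ 1 := by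
    rw [← sq_le_one_iff_abs_le_one]
    nlinarith [mul_self_nonneg ((((M.getD i []).getD j (0, 0)).2 : ℝ) / D)]
  have h2 : |(((M.getD i []).getD j (0, 0)).2 : ℝ) / D| ≤ 1 := by
    rw [← sq_le_one_iff_abs_le_one]
    nlinarith [mul_self_nonneg ((((M.getD i []).getD j (0, 0)).1 : ℝ) / D)]
  simp only [matOfCodes, of_apply, intProjCode]
  rw [getD_map_range _ _ i.2, getD_map_range _ _ j.2]
  simp only [algVal, realVal_fracCode h.pos h1, realVal_fracCode h.pos h2]

/-- The special projection `D⁻¹ M`. -/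
noncomputable def IsIntProj.toSpecialProjection {n : ℕ} {M : List (List (ℤ × ℤ))} {D r : ℕ}
    (h : IsIntProj n M D r) : SpecialProjection where
  qubits := n
  mat := intProj n M D
  isStarProjection := h.isStarProjection
  isAlgebraic i j := by
    rw [← h.matOfCodes_eq]
    exact isAlgebraic_algVal _

theorem isIntProj_zero (n : ℕ) : IsIntProj n [] 1 0 := by
  have h0 : intProj n [] 1 = 0 := by
    ext i j
    simp only [intProj, intEntry, List.getD_nil, of_apply, Matrix.zero_apply]
    apply Complex.ext <;> simp [gaussInt]
  exact ⟨one_pos, by rw [h0]; exact IsStarProjection.zero _, by rw [h0]; simp⟩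

theorem exists_intEntry_eq {r n : ℕ} (w : Fin r × Fin n → ℤ × ℤ) :
    ∃ M : List (List (ℤ × ℤ)), M.length = r ∧
      ∀ (i : Fin r) (j : Fin n), intEntry M i j = gaussInt (w (i, j)) := by
  refine ⟨List.ofFn fun i => List.ofFn fun j => w (i, j), List.length_ofFn, fun i j => ?_⟩
  rw [intEntry, getD_ofFn, getD_ofFn]

end IntProj

/-! ### Rational projections close to a given orthonormal family -/

section RationalProjection

open Matrix

variable {ι : Type} [Fintype ι]

theorem norm_toLp_mulVec_le {P : Matrix ι ι ℂ} (hP : IsStarProjection P)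
    (x : EuclideanSpace ℂ ι) : ‖WithLp.toLp 2 (P *ᵥ x.ofLp)‖ ≤ ‖x‖ := by
  set y : EuclideanSpace ℂ ι := WithLp.toLp 2 (P *ᵥ x.ofLp) with hy
  have h1 : inner ℂ y y = inner ℂ x y := by
    rw [hy, EuclideanSpace.inner_toLp_toLp, EuclideanSpace.inner_eq_star_dotProduct,
      star_mulVec, show Pᴴ = P from hP.isSelfAdjoint, dotProduct_comm, ← dotProduct_mulVec,
      mulVec_mulVec, show P * P = P from hP.isIdempotentElem, dotProduct_comm]
  have h2 : ‖y‖ * ‖y‖ ≤ ‖x‖ * ‖y‖ := by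
    have h3 := norm_inner_le_norm (𝕜 := ℂ) x y
    rw [← h1, inner_self_eq_norm_sq_to_K, norm_pow, RCLike.norm_ofReal, abs_norm, sq] at h3
    exact h3
  rcases (norm_nonneg y).eq_or_lt with h0 | h0
  · rw [← h0]; exact norm_nonneg x
  · exact le_of_mul_le_mul_right h2 h0

theorem norm_toLp_mulVec_sub_le [DecidableEq ι] {P : Matrix ι ι ℂ} (hP : IsStarProjection P)
    {u : EuclideanSpace ℂ ι} (hu : P *ᵥ u.ofLp = u.ofLp) (x : EuclideanSpace ℂ ι) :
    ‖WithLp.toLp 2 (P *ᵥ x.ofLp) - x‖ ≤ ‖x - u‖ := by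
  have h := norm_toLp_mulVec_le hP.one_sub (x - u)
  rw [WithLp.ofLp_sub, mulVec_sub, sub_mulVec, sub_mulVec, one_mulVec, one_mulVec, hu, sub_self,
    sub_zero] at h
  rw [norm_sub_rev]
  exact h

/-- The projection onto the span of an orthogonal family of nonzero vectors with entries in `ℚ(i)`
has entries in `ℚ(i)`. -/
theorem exists_gaussianRational_projection_near [DecidableEq ι] {r : ℕ}
    {b : Fin r → EuclideanSpace ℂ ι} (hb : Orthonormal ℂ b) {η : ℝ} (hη : 0 < η) :
    ∃ P : Matrix ι ι ℂ, IsStarProjection P ∧ P.trace = r ∧ (∀ i j, P i j ∈ gaussianRationals) ∧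
      ∀ j, ‖WithLp.toLp 2 (P *ᵥ (b j).ofLp) - b j‖ < η := by
  obtain ⟨u, hu, horth, hnear⟩ := exists_gaussianRational_orthogonal_near hb
    (lt_min hη one_pos)
  have hu0 : ∀ j, 0 < ‖u j‖ := by
    intro j
    have h1 := norm_sub_norm_le (b j) (u j)
    rw [hb.1, norm_sub_rev] at h1
    linarith [(hnear j).trans_le (min_le_right _ _)]
  let v : Fin r → EuclideanSpace ℂ ι := fun j => ((‖u j‖⁻¹ : ℝ) : ℂ) • u j
  have hv : Orthonormal ℂ v := by
    refine ⟨fun j => ?_, fun j k hjk => ?_⟩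
    · rw [norm_smul, Complex.norm_real, norm_inv, norm_norm, inv_mul_cancel₀ (hu0 j).ne']
    · simp only [v]
      rw [inner_smul_left, inner_smul_right, horth j k hjk, mul_zero, mul_zero]
  set V : Matrix ι (Fin r) ℂ := Matrix.of fun i j => v j i with hVdef
  have hV : Vᴴ * V = 1 := conjTranspose_mul_self_eq_one_iff.2 hv
  have hPu : ∀ j, (V * Vᴴ) *ᵥ (u j).ofLp = (u j).ofLp := by
    intro j
    have h1 : (u j).ofLp = (‖u j‖ : ℂ) • (V *ᵥ Pi.single j 1) := by
      ext i
      have : (‖u j‖ : ℂ) ≠ 0 := by exact_mod_cast (hu0 j).ne'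
      simp [hVdef, v, mul_inv_cancel_left₀ this]
    rw [h1, mulVec_smul, mulVec_mulVec, Matrix.mul_assoc, hV, Matrix.mul_one]
  refine ⟨V * Vᴴ, isStarProjection_mul_conjTranspose hV,
    by rw [trace_mul_conjTranspose hV, Fintype.card_fin], fun i k => ?_, fun j => ?_⟩
  · rw [mul_apply]
    refine sum_mem fun j _ => ?_
    have h2 : V i j * Vᴴ j k = u j i * (starRingEnd ℂ) (u j k) / inner ℂ (u j) (u j) := by
      have h3 : (‖u j‖ : ℂ) ≠ 0 := by exact_mod_cast (hu0 j).ne'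
      rw [inner_self_eq_norm_sq_to_K]
      simp [hVdef, v, conjTranspose_apply]
      field_simp
    rw [h2]
    exact div_mem (mul_mem (hu j i) (conj_mem_gaussianRationals (hu j k)))
      (inner_mem_gaussianRationals (hu j) (hu j))
  · refine (norm_toLp_mulVec_sub_le (isStarProjection_mul_conjTranspose hV) (hPu j) _).trans_lt ?_
    rw [norm_sub_rev]
    exact (hnear j).trans_le (min_le_left _ _)

end RationalProjection

/-! ### From orthonormal sets of algebraic vectors to rational projections -/

section VectorLists

open Matrix

/-- The entry with number `i` of the vector with number `l` in a list of vectors. -/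
noncomputable def vecEntry (L : List (List AlgCode)) (l i : ℕ) : ℂ :=
  algVal ((L.getD l []).getD i (([], 0, 0), ([], 0, 0)))

@[fun_prop]
theorem CComputable.vecEntry {α : Type} [Primcodable α] {L : α → List (List AlgCode)}
    {l i : α → ℕ} (hL : Computable L) (hl : Computable l) (hi : Computable i) :
    CComputable fun a => vecEntry (L a) (l a) (i a) :=
  CComputable.algVal (by fun_prop)

/-- The vector with number `l` in a list of vectors. -/
noncomputable def vecAt (n : ℕ) (L : List (List AlgCode)) (l : ℕ) :
    EuclideanSpace ℂ (Fin (2 ^ n)) := vecOfCodes n (L.getD l [])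

theorem vecAt_apply (n : ℕ) (L : List (List AlgCode)) (l : ℕ) (i : Fin (2 ^ n)) :
    vecAt n L l i = vecEntry L l i := rfl

/-- The entries of the Gram matrix of a list of vectors. -/
noncomputable def gram (n : ℕ) (L : List (List AlgCode)) (l l' : ℕ) : ℂ :=
  ∑ i ∈ Finset.range (2 ^ n), (starRingEnd ℂ) (vecEntry L l i) * vecEntry L l' i

theorem gram_eq_inner (n : ℕ) (L : List (List AlgCode)) (l l' : ℕ) :
    gram n L l l' = inner ℂ (vecAt n L l) (vecAt n L l') := by
  rw [gram, Finset.sum_range, EuclideanSpace.inner_eq_star_dotProduct, dotProduct]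
  exact Finset.sum_congr rfl fun i _ => mul_comm _ _

@[fun_prop]
theorem CComputable.gram {α : Type} [Primcodable α] {n l l' : α → ℕ} {L : α → List (List AlgCode)}
    (hn : Computable n) (hL : Computable L) (hl : Computable l) (hl' : Computable l') :
    CComputable fun a => gram (n a) (L a) (l a) (l' a) := by
  unfold QRand.gram
  fun_prop

/-- This is zero if the vectors of the list form an orthonormal set, possibly with repetitions, and
positive otherwise: in the first case all entries of the Gram matrix are `0` or `1`. -/
noncomputable def orthonormalDefect (n : ℕ) (L : List (List AlgCode)) : ℝ :=
  ∑ l ∈ Finset.range L.length, ∑ l' ∈ Finset.range L.length,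
      Complex.normSq (gram n L l l') * Complex.normSq (gram n L l l' - (1 : ℕ)) +
    ∑ l ∈ Finset.range L.length, Complex.normSq (gram n L l l - (1 : ℕ))

/-- This is less than one only if the list `I` has no repetitions, provided that the vectors of the
list `L` form an orthonormal set. -/
noncomputable def selectionDefect (n : ℕ) (L : List (List AlgCode)) (I : List ℕ) : ℝ :=
  ∑ a ∈ Finset.range I.length, ∑ b ∈ Finset.range I.length,
    Complex.normSq (gram n L (I.getD a 0) (I.getD b 0) - (if a = b then 1 else 0 : ℕ))

/-- The sum of `‖M v - D v‖²` over the vectors `v` of the list `L`. -/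
noncomputable def fixedDefect (n : ℕ) (L : List (List AlgCode)) (M : List (List (ℤ × ℤ))) (D : ℕ) :
    ℝ :=
  ∑ l ∈ Finset.range L.length, ∑ i ∈ Finset.range (2 ^ n),
    Complex.normSq (∑ k ∈ Finset.range (2 ^ n), intEntry M i k * vecEntry L l k -
      D * vecEntry L l i)

section

variable {α : Type} [Primcodable α] {n D : α → ℕ} {L : α → List (List AlgCode)} {I : α → List ℕ}
  {M : α → List (List (ℤ × ℤ))}

theorem RComputable.orthonormalDefect (hn : Computable n) (hL : Computable L) :
    RComputable fun a => orthonormalDefect (n a) (L a) := by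
  unfold QRand.orthonormalDefect
  fun_prop

theorem RComputable.selectionDefect (hn : Computable n) (hL : Computable L) (hI : Computable I) :
    RComputable fun a => selectionDefect (n a) (L a) (I a) := by
  unfold QRand.selectionDefect
  have h1 : Computable fun x : (α × ℕ) × ℕ => if x.1.2 = x.2 then 1 else 0 :=
    computable_ite (computable_decide_nat_eq (by fun_prop) (by fun_prop))
      (Computable.const 1) (Computable.const 0)
  fun_prop

theorem RComputable.fixedDefect (hn : Computable n) (hL : Computable L) (hM : Computable M)
    (hD : Computable D) : RComputable fun a => fixedDefect (n a) (L a) (M a) (D a) := by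
  unfold QRand.fixedDefect
  fun_prop

end

theorem fixedDefect_eq (n : ℕ) (L : List (List AlgCode)) (M : List (List (ℤ × ℤ))) {D : ℕ}
    (hD : 0 < D) : fixedDefect n L M D = (D : ℝ) ^ 2 * ∑ l ∈ Finset.range L.length,
      ‖WithLp.toLp 2 (intProj n M D *ᵥ (vecAt n L l).ofLp) - vecAt n L l‖ ^ 2 := by
  have hD' : (D : ℂ) ≠ 0 := by exact_mod_cast hD.ne'
  rw [fixedDefect, Finset.mul_sum]
  refine Finset.sum_congr rfl fun l _ => ?_
  rw [EuclideanSpace.norm_sq_eq, Finset.mul_sum, Finset.sum_range]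
  refine Finset.sum_congr rfl fun i _ => ?_
  have e : ∑ k ∈ Finset.range (2 ^ n), intEntry M i k * vecEntry L l k - D * vecEntry L l i =
      (D : ℂ) * (WithLp.toLp 2 (intProj n M D *ᵥ (vecAt n L l).ofLp) - vecAt n L l) i := by
    simp only [PiLp.sub_apply, mulVec, dotProduct, intProj, of_apply, vecAt_apply,
      div_mul_eq_mul_div, ← Finset.sum_div, Finset.sum_range]
    field_simp
  rw [e, Complex.normSq_mul, Complex.normSq_natCast, Complex.normSq_eq_norm_sq, sq (D : ℝ)]

/-- The vectors of the list form an orthonormal set, possibly with repetitions. -/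
def IsOrthonormalList (n : ℕ) (L : List (List AlgCode)) : Prop :=
  ∀ l < L.length, ∀ l' < L.length, gram n L l l = 1 ∧ (gram n L l l' = 0 ∨ gram n L l l' = 1)

theorem not_orthonormalDefect_pos_iff {n : ℕ} {L : List (List AlgCode)} :
    ¬ 0 < orthonormalDefect n L ↔ IsOrthonormalList n L := by
  have n1 : ∀ l ∈ Finset.range L.length, 0 ≤ ∑ l' ∈ Finset.range L.length,
      Complex.normSq (gram n L l l') * Complex.normSq (gram n L l l' - (1 : ℕ)) := fun l _ =>
    Finset.sum_nonneg fun l' _ => mul_nonneg (Complex.normSq_nonneg _) (Complex.normSq_nonneg _)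
  have n2 : ∀ l ∈ Finset.range L.length, 0 ≤ Complex.normSq (gram n L l l - (1 : ℕ)) := fun l _ =>
    Complex.normSq_nonneg _
  have n3 := Finset.sum_nonneg n1
  have n4 := Finset.sum_nonneg n2
  rw [not_lt, orthonormalDefect]
  constructor
  · intro h l hl l' hl'
    have h1 := (Finset.sum_eq_zero_iff_of_nonneg n1).1 (by linarith) l (Finset.mem_range.2 hl)
    rw [Finset.sum_eq_zero_iff_of_nonneg fun l' _ =>
      mul_nonneg (Complex.normSq_nonneg _) (Complex.normSq_nonneg _)] at h1
    have h2 := h1 l' (Finset.mem_range.2 hl')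
    have h3 := (Finset.sum_eq_zero_iff_of_nonneg n2).1 (by linarith) l (Finset.mem_range.2 hl)
    rw [mul_eq_zero, Complex.normSq_eq_zero, Complex.normSq_eq_zero, sub_eq_zero,
      Nat.cast_one] at h2
    rw [Complex.normSq_eq_zero, sub_eq_zero, Nat.cast_one] at h3
    exact ⟨h3, h2⟩
  · intro h
    refine le_of_eq ?_
    rw [Finset.sum_eq_zero, Finset.sum_eq_zero, add_zero]
    · intro l hl
      rw [Finset.mem_range] at hl
      rw [(h l hl l hl).1, Nat.cast_one, sub_self, map_zero]
    · intro l hl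
      refine Finset.sum_eq_zero fun l' hl' => ?_
      rw [Finset.mem_range] at hl hl'
      rcases (h l hl l' hl').2 with h0 | h0 <;> rw [h0] <;> simp

theorem mem_of_isIndexOf {n : ℕ} {L : List (List AlgCode)}
    {F : Finset (EuclideanSpace ℂ (Fin (2 ^ n)))}
    (hF : (F : Set (EuclideanSpace ℂ (Fin (2 ^ n)))) = {v | ∃ l ∈ L, v = vecOfCodes n l})
    (v : EuclideanSpace ℂ (Fin (2 ^ n))) : v ∈ F ↔ ∃ l < L.length, vecAt n L l = v := by
  rw [← Finset.mem_coe, hF]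
  constructor
  · rintro ⟨x, hx, rfl⟩
    obtain ⟨l, hl, rfl⟩ := List.getElem_of_mem hx
    exact ⟨l, hl, by rw [vecAt, List.getD_eq_getElem _ _ hl]⟩
  · rintro ⟨l, hl, rfl⟩
    exact ⟨L[l], List.getElem_mem hl, by rw [vecAt, List.getD_eq_getElem _ _ hl]⟩

theorem isOrthonormalList_of_orthonormal {n : ℕ} {L : List (List AlgCode)}
    {F : Finset (EuclideanSpace ℂ (Fin (2 ^ n)))}
    (hF : ∀ v, v ∈ F ↔ ∃ l < L.length, vecAt n L l = v)
    (ho : Orthonormal ℂ fun v : F => (v : EuclideanSpace ℂ (Fin (2 ^ n)))) :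
    IsOrthonormalList n L := by
  intro l hl l' hl'
  classical
  have h1 : ∀ v v' : F, inner ℂ v.1 v'.1 = if v = v' then (1 : ℂ) else 0 := orthonormal_iff_ite.1 ho
  have h2 := h1 ⟨_, (hF _).2 ⟨l, hl, rfl⟩⟩ ⟨_, (hF _).2 ⟨l', hl', rfl⟩⟩
  have h3 := h1 ⟨_, (hF _).2 ⟨l, hl, rfl⟩⟩ ⟨_, (hF _).2 ⟨l, hl, rfl⟩⟩
  simp only at h2 h3
  rw [gram_eq_inner, gram_eq_inner, h2, h3]
  refine ⟨if_pos trivial, ?_⟩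
  split_ifs <;> simp

theorem IsOrthonormalList.norm_eq_one {n : ℕ} {L : List (List AlgCode)}
    (h : IsOrthonormalList n L) {l : ℕ} (hl : l < L.length) : ‖vecAt n L l‖ = 1 := by
  have h1 := (h l hl l hl).1
  rw [gram_eq_inner, inner_self_eq_norm_sq_to_K] at h1
  have h2 : ‖vecAt n L l‖ ^ 2 = 1 := Complex.ofReal_injective (by simpa using h1)
  exact (pow_eq_one_iff_of_nonneg (norm_nonneg _) two_ne_zero).1 h2

theorem IsOrthonormalList.eq_of_gram_eq_one {n : ℕ} {L : List (List AlgCode)}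
    (h : IsOrthonormalList n L) {l l' : ℕ} (hl : l < L.length) (hl' : l' < L.length)
    (h1 : gram n L l l' = 1) : vecAt n L l = vecAt n L l' := by
  rw [gram_eq_inner] at h1
  exact (inner_eq_one_iff_of_norm_eq_one (h.norm_eq_one hl) (h.norm_eq_one hl')).1 h1

/-- An orthonormal list has a sublist of indices without repetitions of vectors, and a rational
projection of the same rank that nearly fixes all its vectors. -/
theorem IsOrthonormalList.exists_intProj {n : ℕ} {L : List (List AlgCode)}
    (h : IsOrthonormalList n L) (E : ℕ) : ∃ (M : List (List (ℤ × ℤ))) (D : ℕ) (I : List ℕ),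
      IsIntProj n M D I.length ∧ selectionDefect n L I < 1 ∧
        E * fixedDefect n L M D < (D : ℝ) ^ 2 := by
  classical
  -- the same vector may occur in the list several times
  let T : Finset (EuclideanSpace ℂ (Fin (2 ^ n))) := (Finset.range L.length).image (vecAt n L)
  let b : Fin T.card → EuclideanSpace ℂ (Fin (2 ^ n)) := fun a => (T.equivFin.symm a).1
  have hbinj : Function.Injective b := Subtype.val_injective.comp T.equivFin.symm.injective
  have hbT : ∀ a, ∃ l < L.length, vecAt n L l = b a := by
    intro a
    obtain ⟨l, hl, h⟩ := Finset.mem_image.1 (T.equivFin.symm a).2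
    exact ⟨l, Finset.mem_range.1 hl, h⟩
  have hLb : ∀ l < L.length, ∃ a, b a = vecAt n L l := by
    intro l hl
    refine ⟨T.equivFin ⟨vecAt n L l, Finset.mem_image_of_mem _ (Finset.mem_range.2 hl)⟩, ?_⟩
    simp [b]
  choose idx hidx hidxb using hbT
  have hb : Orthonormal ℂ b := by
    refine ⟨fun a => ?_, fun a a' haa' => ?_⟩
    · rw [← hidxb a]; exact h.norm_eq_one (hidx a)
    · show inner ℂ (b a) (b a') = 0
      rw [← hidxb a, ← hidxb a', ← gram_eq_inner]
      refine (h _ (hidx a) _ (hidx a')).2.resolve_right fun h1 => haa' (hbinj ?_)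
      rw [← hidxb a, ← hidxb a', h.eq_of_gram_eq_one (hidx a) (hidx a') h1]
  set η : ℝ := 1 / ((L.length + 1) * (E + 1)) with hη
  have hη0 : 0 < η := by positivity
  obtain ⟨P, hP, hPtr, hPrat, hPnear⟩ := exists_gaussianRational_projection_near hb hη0
  obtain ⟨D, w, hD, hw⟩ := exists_common_denominator
    (z := fun x : Fin (2 ^ n) × Fin (2 ^ n) => P x.1 x.2) fun x => hPrat x.1 x.2
  obtain ⟨M, -, hM⟩ := exists_intEntry_eq w
  have hD' : (D : ℂ) ≠ 0 := by exact_mod_cast hD.ne'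
  have hPM : intProj n M D = P := by
    ext i j
    rw [intProj, of_apply, hM, hw, mul_div_cancel_left₀ _ hD']
  refine ⟨M, D, List.ofFn idx, ⟨hD, hPM ▸ hP, by rw [hPM, hPtr, List.length_ofFn]⟩, ?_, ?_⟩
  · have h0 : selectionDefect n L (List.ofFn idx) = 0 := by
      rw [selectionDefect, List.length_ofFn, Finset.sum_range]
      refine Finset.sum_eq_zero fun a _ => ?_
      rw [Finset.sum_range]
      refine Finset.sum_eq_zero fun a' _ => ?_
      rw [getD_ofFn, getD_ofFn, gram_eq_inner, hidxb, hidxb, orthonormal_iff_ite.1 hb]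
      by_cases haa' : a = a'
      · simp [haa']
      · simp [haa', Fin.val_injective.ne haa']
    rw [h0]; exact one_pos
  · rw [fixedDefect_eq n L M hD, hPM]
    have h1 : ∑ l ∈ Finset.range L.length,
        ‖WithLp.toLp 2 (P *ᵥ (vecAt n L l).ofLp) - vecAt n L l‖ ^ 2 ≤ L.length * η ^ 2 := by
      have h2 := Finset.sum_le_card_nsmul (Finset.range L.length)
        (fun l => ‖WithLp.toLp 2 (P *ᵥ (vecAt n L l).ofLp) - vecAt n L l‖ ^ 2) (η ^ 2) (by
          intro l hl
          obtain ⟨a, ha⟩ := hLb l (Finset.mem_range.1 hl)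
          rw [← ha]
          exact pow_le_pow_left₀ (norm_nonneg _) (hPnear a).le 2)
      simpa using h2
    have h3 : (E : ℝ) * (L.length * η ^ 2) < 1 := by
      have hE : (0 : ℝ) ≤ E := by positivity
      have hL : (0 : ℝ) ≤ L.length := by positivity
      have h4 : η * ((L.length + 1) * (E + 1)) = 1 := by rw [hη]; field_simp
      have h5 : η ≤ 1 := by
        rw [hη, div_le_one (by positivity)]
        nlinarith
      have h6 : (E : ℝ) * L.length < (L.length + 1) * (E + 1) := by nlinarith
      calc (E : ℝ) * (L.length * η ^ 2) = (E * L.length * η) * η := by ring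
        _ ≤ (E * L.length * η) * 1 := by gcongr
        _ = η * (E * L.length) := by ring
        _ < η * ((L.length + 1) * (E + 1)) := by gcongr
        _ = 1 := h4
    have hD2 : (0 : ℝ) < (D : ℝ) ^ 2 := by
      have : (0 : ℝ) < D := by exact_mod_cast hD
      positivity
    calc (E : ℝ) * ((D : ℝ) ^ 2 * ∑ l ∈ Finset.range L.length,
        ‖WithLp.toLp 2 (P *ᵥ (vecAt n L l).ofLp) - vecAt n L l‖ ^ 2)
        ≤ E * ((D : ℝ) ^ 2 * (L.length * η ^ 2)) := by gcongr
      _ = (D : ℝ) ^ 2 * (E * (L.length * η ^ 2)) := by ring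
      _ < (D : ℝ) ^ 2 * 1 := by gcongr
      _ = (D : ℝ) ^ 2 := mul_one _

/-- The candidates `((n, L), (M, D, I))` in the search for a rational projection `(M, D)` and a list
`I` of indices of distinct vectors, given the list `L` of vectors on `n` qubits. -/
abbrev ProjectionSearch : Type :=
  (ℕ × List (List AlgCode)) × List (List (ℤ × ℤ)) × ℕ × List ℕ

/-- From a list of codes of vectors one computes a projection with rational entries which, if the
vectors form an orthonormal set, has at most the rank of their span and nearly fixes the vectors.
If they do not form an orthonormal set, this is noticed by a search in parallel. -/
theorem exists_computable_intProj (E : ℕ) :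
    ∃ f : ℕ × List (List AlgCode) → List (List (ℤ × ℤ)) × ℕ × List ℕ, Computable f ∧
      ∀ n L, IsIntProj n (f (n, L)).1 (f (n, L)).2.1 (f (n, L)).2.2.length ∧
        (IsOrthonormalList n L → selectionDefect n L (f (n, L)).2.2 < 1 ∧
          E * fixedDefect n L (f (n, L)).1 (f (n, L)).2.1 < ((f (n, L)).2.1 : ℝ) ^ 2) := by
  have hn : Computable fun x : ProjectionSearch => x.1.1 := by fun_prop
  have hL : Computable fun x : ProjectionSearch => x.1.2 := by fun_prop
  have hM : Computable fun x : ProjectionSearch => x.2.1 := by fun_prop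
  have hD : Computable fun x : ProjectionSearch => x.2.2.1 := by fun_prop
  have hI : Computable fun x : ProjectionSearch => x.2.2.2 := by fun_prop
  have hproj : SemiDec fun x : ProjectionSearch => IsIntProj x.1.1 x.2.1 x.2.2.1 x.2.2.2.length :=
    ((SemiDec.of_decide (computable_decide_nat_lt (Computable.const 0) hD)).and
      (SemiDec.lt (RComputable.intProjDefect hn hM hD (by fun_prop)) RComputable.one)).of_iff
      fun x => isIntProj_iff.symm
  have hdef : SemiDec fun x : ProjectionSearch => 0 < orthonormalDefect x.1.1 x.1.2 :=
    SemiDec.lt RComputable.zero (RComputable.orthonormalDefect hn hL)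
  have hsel : SemiDec fun x : ProjectionSearch => selectionDefect x.1.1 x.1.2 x.2.2.2 < 1 :=
    SemiDec.lt (RComputable.selectionDefect hn hL hI) RComputable.one
  have hfix : SemiDec fun x : ProjectionSearch => E * fixedDefect x.1.1 x.1.2 x.2.1 x.2.2.1 <
      (x.2.2.1 : ℝ) ^ 2 :=
    SemiDec.lt ((RComputable.natCast (Computable.const E)).mul
      (RComputable.fixedDefect hn hL hM hD)) (RComputable.natCast hD).pow_two
  obtain ⟨f, hf, hfs⟩ := (hproj.and (hdef.or (hsel.and hfix))).exists_choice  (by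
    rintro ⟨n, L⟩
    by_cases h : IsOrthonormalList n L
    · obtain ⟨M, D, I, h1, h2⟩ := h.exists_intProj E
      exact ⟨(M, D, I), h1, Or.inr h2⟩
    · refine ⟨([], 1, []), isIntProj_zero n, Or.inl ?_⟩
      by_contra h1
      exact h (not_orthonormalDefect_pos_iff.1 h1))
  refine ⟨f, hf, fun n L => ⟨(hfs (n, L)).1, fun h => ?_⟩⟩
  exact (hfs (n, L)).2.resolve_left (not_orthonormalDefect_pos_iff.2 h)

theorem IsOrthonormalList.length_le_card {n : ℕ} {L : List (List AlgCode)}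
    (h : IsOrthonormalList n L) {F : Finset (EuclideanSpace ℂ (Fin (2 ^ n)))}
    (hF : ∀ v, v ∈ F ↔ ∃ l < L.length, vecAt n L l = v) {I : List ℕ}
    (hI : selectionDefect n L I < 1) : I.length ≤ F.card := by
  have hterm : ∀ a b : Fin I.length,
      Complex.normSq
        (gram n L (I.getD a 0) (I.getD b 0) - (if (a : ℕ) = b then 1 else 0 : ℕ)) < 1 := by
    intro a b
    refine lt_of_le_of_lt ?_ hI
    rw [selectionDefect]
    refine le_trans ?_ (Finset.single_le_sum (f := fun a => ∑ b ∈ Finset.range I.length,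
      Complex.normSq (gram n L (I.getD a 0) (I.getD b 0) - (if a = b then 1 else 0 : ℕ)))
      (fun a _ => Finset.sum_nonneg fun b _ =>
      Complex.normSq_nonneg _) (Finset.mem_range.2 a.2))
    exact Finset.single_le_sum (f := fun b => Complex.normSq
      (gram n L (I.getD a 0) (I.getD b 0) - (if (a : ℕ) = b then 1 else 0 : ℕ)))
      (fun b _ => Complex.normSq_nonneg _) (Finset.mem_range.2 b.2)
  -- an index outside of the list would denote the zero vector
  have hlt : ∀ a : Fin I.length, I.getD a 0 < L.length := by
    intro a
    by_contra hge
    have h0 : vecAt n L (I.getD a 0) = 0 := by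
      have hr : realVal ([], 0, 0) = 0 :=
        realVal_eq_of_sign (by simp) (by simp) fun y hy _ =>
          ⟨fun h => by simp [evalCoeffs] at h, fun _ => by simpa using hy.le⟩
      ext i
      rw [vecAt_apply, vecEntry, List.getD_eq_default _ _ (not_lt.1 hge)]
      simp [algVal, hr]
      rfl
    have h1 := hterm a a
    rw [gram_eq_inner, h0] at h1
    simp at h1
  have hinj : Function.Injective fun a : Fin I.length => vecAt n L (I.getD a 0) := by
    intro a b hab
    by_contra hne
    have h1 := hterm a b
    have h2 : gram n L (I.getD a 0) (I.getD b 0) = 1 := by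
      have := (h _ (hlt a) _ (hlt a)).1
      rw [gram_eq_inner] at this ⊢
      simp only at hab
      rwa [hab] at this ⊢
    rw [h2, if_neg (Fin.val_injective.ne hne)] at h1
    simp at h1
  have := Finset.card_le_card_of_injOn (s := Finset.univ) (t := F) _
    (fun a _ => Finset.mem_coe.2 ((hF _).2 ⟨_, hlt a, rfl⟩)) hinj.injOn
  simpa using this

/-- A rational projection that nearly fixes the vectors of an orthonormal set `F` is nearly as
probable as the span of `F`, up to a factor of `2`. -/
theorem sum_inner_lt_of_fixedDefect {n : ℕ} {L : List (List AlgCode)}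
    {F : Finset (EuclideanSpace ℂ (Fin (2 ^ n)))}
    (hF : ∀ v, v ∈ F ↔ ∃ l < L.length, vecAt n L l = v)
    (ho : Orthonormal ℂ fun v : F => (v : EuclideanSpace ℂ (Fin (2 ^ n))))
    {M : List (List (ℤ × ℤ))} {D r E : ℕ} (hM : IsIntProj n M D r) (hE : 0 < E)
    (hfix : E * fixedDefect n L M D < (D : ℝ) ^ 2)
    {ρ : Matrix (Fin (2 ^ n)) (Fin (2 ^ n)) ℂ} (hρ : ρ.PosSemidef) (hρ1 : ρ.trace = 1) :
    ∑ v ∈ F, (inner ℂ v (Matrix.toEuclideanLin ρ v)).re <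
      2 * (ρ * intProj n M D).trace.re + 2 / E := by
  classical
  set V : Matrix (Fin (2 ^ n)) F ℂ := Matrix.of fun i v => (v : EuclideanSpace ℂ (Fin (2 ^ n))) i
    with hV
  set P := intProj n M D with hP
  have hV1 : Vᴴ * V = 1 := conjTranspose_mul_self_eq_one_iff.2 ho
  have h1 := re_trace_mul_le_of_projections hρ hρ1 hM.isStarProjection
    (isStarProjection_mul_conjTranspose hV1)
  rw [trace_sub_trace_mul_projection hM.isStarProjection, trace_mul_mul_conjTranspose,
    Complex.re_sum] at h1
  have h2 : ∑ v ∈ F, (inner ℂ v (Matrix.toEuclideanLin ρ v)).re =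
      ∑ v : F, (inner ℂ (WithLp.toLp 2 (V.col v) : EuclideanSpace ℂ (Fin (2 ^ n)))
        (Matrix.toEuclideanLin ρ (WithLp.toLp 2 (V.col v)))).re := by
    rw [← Finset.sum_coe_sort]
    rfl
  have h3 : ∑ v : F, ∑ i, (((V - P * V) i v).re ^ 2 + ((V - P * V) i v).im ^ 2) =
      ∑ v ∈ F, ‖WithLp.toLp 2 (P *ᵥ v.ofLp) - v‖ ^ 2 := by
    rw [← Finset.sum_coe_sort F fun v => ‖WithLp.toLp 2 (P *ᵥ v.ofLp) - v‖ ^ 2]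
    refine Finset.sum_congr rfl fun v _ => ?_
    rw [norm_sub_rev, EuclideanSpace.norm_sq_eq]
    refine Finset.sum_congr rfl fun i _ => ?_
    rw [← Complex.normSq_eq_norm_sq, Complex.normSq_apply]
    simp only [hV, Matrix.sub_apply, of_apply, mul_apply, PiLp.sub_apply, mulVec, dotProduct]
    ring
  have h4 : ∑ v ∈ F, ‖WithLp.toLp 2 (P *ᵥ v.ofLp) - v‖ ^ 2 ≤ ∑ l ∈ Finset.range L.length,
      ‖WithLp.toLp 2 (P *ᵥ (vecAt n L l).ofLp) - vecAt n L l‖ ^ 2 := by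
    have hFi : F = (Finset.range L.length).image (vecAt n L) := by
      ext v; simp [hF]
    rw [hFi]
    exact Finset.sum_image_le_of_nonneg (fun v _ => by positivity)
  rw [fixedDefect_eq n L M hM.pos] at hfix
  have hD2 : (0 : ℝ) < (D : ℝ) ^ 2 := by
    have : (0 : ℝ) < D := by exact_mod_cast hM.pos
    positivity
  have hE' : (0 : ℝ) < E := by exact_mod_cast hE
  have h5 : ∑ l ∈ Finset.range L.length,
      ‖WithLp.toLp 2 (P *ᵥ (vecAt n L l).ofLp) - vecAt n L l‖ ^ 2 < 1 / E := by
    rw [lt_div_iff₀ hE']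
    have : (D : ℝ) ^ 2 * ((∑ l ∈ Finset.range L.length,
      ‖WithLp.toLp 2 (P *ᵥ (vecAt n L l).ofLp) - vecAt n L l‖ ^ 2) * E) < (D : ℝ) ^ 2 * 1 := by
      linarith
    exact lt_of_mul_lt_mul_left this hD2.le
  have h6 : (2 : ℝ) / E = 2 * (1 / E) := by ring
  rw [h2, h6]
  linarith

end VectorLists

/-! ### From machines to tests -/

theorem RComputable.elim_inv_two_pow {α : Type} [Primcodable α] {t : α → Option (List Bool)}
    (ht : Computable t) : RComputable fun a => (t a).elim 0 fun σ => (2 : ℝ)⁻¹ ^ σ.length := by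
  have h1 : Computable fun a => decide ((t a).isSome = true) :=
    (Primrec.option_isSome.to_comp.comp ht).of_eq fun a => by simp
  have h2 : Computable fun a => ((t a).getD []).length :=
    computable_list_length (Computable.option_getD ht (Computable.const []))
  refine (RComputable.ite h1 (RComputable.inv_two_pow h2) RComputable.zero).of_eq fun a => ?_
  cases t a <;> simp

theorem tracialState_prob {S : SpecialProjection} {r : ℕ} (h : S.mat.trace = r) :
    tracialState.prob S = r * (2 : ℝ)⁻¹ ^ S.qubits := by
  have e : tracialState.seq S.qubits * S.mat = ((2 : ℂ) ^ S.qubits)⁻¹ • S.mat := by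
    simp [tracialState]
  have e2 : ((2 : ℂ) ^ S.qubits)⁻¹ * r = ((r * (2 : ℝ)⁻¹ ^ S.qubits : ℝ) : ℂ) := by
    push_cast
    rw [inv_pow, mul_comm]
  rw [QState.prob, e, Matrix.trace_smul, h, smul_eq_mul, e2, Complex.ofReal_re]

theorem mem_dom_iff_of_enumeration {C : List Bool →. ℕ} {e : ℕ → Option (List Bool × ℕ)}
    (he : ∀ x, x.2 ∈ C x.1 ↔ ∃ m, e m = some x) (σ : List Bool) :
    σ ∈ C.Dom ↔ ∃ m, (e m).map Prod.fst = some σ := by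
  rw [PFun.mem_dom]
  constructor
  · rintro ⟨k, hk⟩
    obtain ⟨m, hm⟩ := (he (σ, k)).1 hk
    exact ⟨m, by rw [hm]; rfl⟩
  · rintro ⟨m, hm⟩
    obtain ⟨x, hx, rfl⟩ := Option.map_eq_some_iff.1 hm
    exact ⟨x.2, (he x).2 ⟨m, hx⟩⟩

/-- The orthonormal sets `F` described by a computable measure machine with
`|σ| + log₂ |F| ≤ n + B` are covered, up to a factor `2` and a term `2 / E`, by the projections
of one quantum Schnorr test: the `m`-th computation of the machine contributes a rational
projection of rank at most `|F|` that nearly fixes `F`, so the sum of the tracial probabilities is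
dominated termwise by the sum of `2 ^ B * 2 ^ (-|σ|)`, which is computable. -/
theorem exists_test_of_machine {C : List Bool →. ℕ} (hC : IsComputableMeasureMachine C) (B : ℕ)
    {E : ℕ} (hE : 0 < E) : ∃ S : ℕ → SpecialProjection, IsQuantumSchnorrTest S ∧
      ∀ (n : ℕ) (σ : List Bool) (F : Finset (EuclideanSpace ℂ (Fin (2 ^ n)))),
        (∃ k ∈ C σ, IsIndexOf k F) →
        Orthonormal ℂ (fun v : F => (v : EuclideanSpace ℂ (Fin (2 ^ n)))) →
        F.card * 2 ^ σ.length ≤ 2 ^ (n + B) →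
        ∃ m, (S m).qubits = n ∧ ∀ ρ : QState,
          ∑ v ∈ F, (inner ℂ v (Matrix.toEuclideanLin (ρ.seq n) v)).re <
            2 * ρ.prob (S m) + 2 / E := by
  obtain ⟨hCp, hCf, hCm⟩ := hC
  obtain ⟨e, hec, heC, heinj⟩ := exists_enumeration_graph hCp
  obtain ⟨f, hf, hfs⟩ := exists_computable_intProj E
  -- the enumeration with decoded outputs
  let e' : ℕ → Option (List Bool × ArrayCode) := fun m =>
    (e m).bind fun x => (Encodable.decode (α := ArrayCode) x.2).map fun c => (x.1, c)
  have hec' : Computable e' := by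
    have h1 : Computable₂ fun (_ : ℕ) (x : List Bool × ℕ) =>
        (Encodable.decode (α := ArrayCode) x.2).map fun c => (x.1, c) := by
      refine Computable.option_map (Computable.decode.comp ?_) ?_
      · exact Computable.snd.comp Computable.snd
      · have h0 : Computable fun y : (ℕ × (List Bool × ℕ)) × ArrayCode => (y.1.2.1, y.2) := by
          fun_prop
        exact h0.to₂
    exact Computable.option_bind hec h1
  -- descriptions that are not short are replaced by the zero projection
  let g : List Bool × ArrayCode → ℕ × List (List (ℤ × ℤ)) × ℕ × ℕ := fun x =>
    if (f x.2).2.2.length * 2 ^ x.1.length ≤ 2 ^ (x.2.1 + B) then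
      (x.2.1, (f x.2).1, (f x.2).2.1, (f x.2).2.2.length) else (0, [], 1, 0)
  have hg : Computable g :=
    computable_ite (computable_decide_nat_le (by fun_prop) (by fun_prop)) (by fun_prop)
      (Computable.const _)
  let q : ℕ → ℕ × List (List (ℤ × ℤ)) × ℕ × ℕ := fun m => ((e' m).map g).getD (0, [], 1, 0)
  have hq : Computable q :=
    Computable.option_getD (Computable.option_map hec' (hg.comp Computable.snd).to₂)
      (Computable.const _)
  have hgP : ∀ x, IsIntProj (g x).1 (g x).2.1 (g x).2.2.1 (g x).2.2.2 := by
    intro x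
    simp only [g]
    split_ifs
    · exact (hfs x.2.1 x.2.2).1
    · exact isIntProj_zero 0
  have hqP : ∀ m, IsIntProj (q m).1 (q m).2.1 (q m).2.2.1 (q m).2.2.2 := by
    intro m
    simp only [q]
    cases e' m with
    | none => exact isIntProj_zero 0
    | some x => exact hgP x
  let S : ℕ → SpecialProjection := fun m => (hqP m).toSpecialProjection
  have hτ : ∀ m, tracialState.prob (S m) = ((q m).2.2.2 : ℝ) * (2 : ℝ)⁻¹ ^ (q m).1 := fun m =>
    tracialState_prob (hqP m).trace_eq
  let t : ℕ → Option (List Bool) := fun m => (e m).map Prod.fst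
  have ht : Computable t := Computable.option_map hec (Computable.fst.comp Computable.snd).to₂
  let a : ℕ → ℝ := fun m => ((2 ^ B : ℕ) : ℝ) * (t m).elim 0 fun σ => (2 : ℝ)⁻¹ ^ σ.length
  have ha : RComputable a :=
    (RComputable.natCast (Computable.const _)).mul (RComputable.elim_inv_two_pow ht)
  have hsum : HasSum a (((2 ^ B : ℕ) : ℝ) * (cantorMeasure (openSetOf C.Dom)).toReal) := by
    refine (hasSum_cantorMeasure hCf (mem_dom_iff_of_enumeration heC) ?_).mul_left _
    intro m m' σ hm hm'
    obtain ⟨x, hx, rfl⟩ := Option.map_eq_some_iff.1 hm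
    obtain ⟨x', hx', hxx'⟩ := Option.map_eq_some_iff.1 hm'
    exact heinj m m' x x' hx hx' hxx'.symm
  have hac : IsComputableReal (∑' m, a m) := by
    rw [hsum.tsum_eq, isComputableReal_iff]
    exact (RComputable.natCast (Computable.const _)).mul (isComputableReal_iff.1 hCm)
  have hb : RComputable fun m => ((q m).2.2.2 : ℝ) * (2 : ℝ)⁻¹ ^ (q m).1 := by fun_prop
  have hb0 : ∀ m, 0 ≤ ((q m).2.2.2 : ℝ) * (2 : ℝ)⁻¹ ^ (q m).1 := fun m => by positivity
  have hba : ∀ m, ((q m).2.2.2 : ℝ) * (2 : ℝ)⁻¹ ^ (q m).1 ≤ a m := by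
    intro m
    have ha0 : 0 ≤ a m := by
      simp only [a]
      cases t m with
      | none => simp
      | some σ => simp only [Option.elim_some]; positivity
    cases hm : e m with
    | none =>
      have : q m = (0, [], 1, 0) := by simp [q, e', hm]
      rw [this]; simpa using ha0
    | some x =>
      cases hx : Encodable.decode (α := ArrayCode) x.2 with
      | none =>
        have : q m = (0, [], 1, 0) := by simp only [q, e', hm, Option.bind_some, hx]; rfl
        rw [this]; simpa using ha0
      | some c =>
        have hqm : q m = g (x.1, c) := by simp only [q, e', hm, Option.bind_some, hx]; rfl
        rw [hqm]
        simp only [g]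
        split_ifs with hle
        · have ham : a m = ((2 ^ B : ℕ) : ℝ) * (2 : ℝ)⁻¹ ^ x.1.length := by
            simp only [a, t, hm]; rfl
          rw [ham]
          have hle' : ((f c).2.2.length : ℝ) * 2 ^ x.1.length ≤ 2 ^ c.1 * 2 ^ B := by
            rw [← pow_add]; exact_mod_cast hle
          push_cast
          rw [inv_pow, inv_pow, ← div_eq_mul_inv, ← div_eq_mul_inv,
            div_le_div_iff₀ (by positivity) (by positivity)]
          linarith
        · simpa using ha0
  have hbs := Summable.of_nonneg_of_le hb0 hba hsum.summable
  refine ⟨S, ⟨⟨⟨fun m => intProjCode (q m).1 (q m).2.1 (q m).2.2.1,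
    computable_intProjCode (by fun_prop) (by fun_prop) (by fun_prop), fun m =>
      ⟨rfl, (hqP m).matOfCodes_eq.symm⟩⟩, ?_⟩, ?_⟩, ?_⟩
  · simpa only [hτ] using hbs
  · simp only [hτ]
    exact isComputableReal_tsum_of_le ha hb hb0 hba hsum.summable hac
  · rintro n σ F ⟨k, hk, L, hdec, hF⟩ ho hcard
    have hF' := mem_of_isIndexOf hF
    obtain ⟨m, hm⟩ := (heC (σ, k)).1 hk
    have hL := isOrthonormalList_of_orthonormal hF' ho
    obtain ⟨hsel, hfix⟩ := (hfs n L).2 hL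
    have hr := hL.length_le_card hF' hsel
    have hqm : q m = g (σ, n, L) := by simp only [q, e', hm, Option.bind_some, hdec]; rfl
    have hg' : g (σ, n, L) = (n, (f (n, L)).1, (f (n, L)).2.1, (f (n, L)).2.2.length) :=
      if_pos ((Nat.mul_le_mul_right _ hr).trans hcard)
    have hqm' := hqm.trans hg'
    refine ⟨m, congrArg Prod.fst hqm', fun ρ => ?_⟩
    have h1 := sum_inner_lt_of_fixedDefect hF' ho (hfs n L).1 hE hfix (ρ.posSemidef n)
      (ρ.trace_eq_one n)
    have h2 : ρ.prob (S m) = (ρ.seq n * intProj n (f (n, L)).1 (f (n, L)).2.1).trace.re := by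
      show (ρ.seq (q m).1 * intProj (q m).1 (q m).2.1 (q m).2.2.1).trace.re = _
      rw [hqm']
    rw [h2]
    exact h1

theorem QState.IsQuantumSchnorrRandom.eventually_lt_QK {ρ : QState}
    (hρ : ρ.IsQuantumSchnorrRandom) {C : List Bool →. ℕ} (hC : IsComputableMeasureMachine C)
    {ε : ℝ} (hε : 0 < ε) (d : ℝ) :
    ∀ᶠ n : ℕ in atTop, (((n : ℝ) + d : ℝ) : EReal) < QK C ε (ρ.seq n) := by
  by_contra hcon
  rw [not_eventually] at hcon
  obtain ⟨B, hB⟩ := exists_nat_ge (d + 1)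
  obtain ⟨E, hE⟩ := exists_nat_gt (4 / ε)
  have hE0 : (0 : ℝ) < E := lt_trans (by positivity) hE
  obtain ⟨S, hS, hcov⟩ := exists_test_of_machine hC B (E := E) (by exact_mod_cast hE0)
  refine hρ S hS (ε / 4) (by positivity) ?_
  rw [QState.FailsAt, Nat.frequently_atTop_iff_infinite]
  rw [Nat.frequently_atTop_iff_infinite] at hcon
  refine Set.Infinite.of_image (fun m => (S m).qubits) (hcon.mono ?_)
  intro n hn
  have hlt : QK C ε (ρ.seq n) < (((n : ℝ) + (d + 1) : ℝ) : EReal) :=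
    (not_lt.1 hn).trans_lt (EReal.coe_lt_coe_iff.2 (by linarith))
  obtain ⟨x, ⟨σ, F, hF, ho, hsum, rfl⟩, hx⟩ := sInf_lt_iff.1 hlt
  have hcardpos : 0 < F.card := by
    rw [Finset.card_pos, Finset.nonempty_iff_ne_empty]
    rintro rfl
    simp only [Finset.sum_empty] at hsum
    linarith
  have hcard : F.card * 2 ^ σ.length ≤ 2 ^ (n + B) := by
    have h1 : (σ.length : ℝ) + Real.logb 2 F.card ≤ ((n + B : ℕ) : ℝ) := by
      have := EReal.coe_lt_coe_iff.1 hx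
      push_cast
      linarith
    have hF0 : (0 : ℝ) < F.card := by exact_mod_cast hcardpos
    have h2 : (F.card : ℝ) * 2 ^ σ.length ≤ 2 ^ (n + B) := by
      have h3 : Real.logb 2 ((F.card : ℝ) * 2 ^ σ.length) ≤ ((n + B : ℕ) : ℝ) := by
        rw [Real.logb_mul hF0.ne' (by positivity), Real.logb_pow,
          Real.logb_self_eq_one one_lt_two]
        linarith
      rw [Real.logb_le_iff_le_rpow one_lt_two (by positivity), Real.rpow_natCast] at h3
      exact h3
    exact_mod_cast h2
  obtain ⟨m, hm, hρm⟩ := hcov n σ F hF ho hcard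
  refine ⟨m, ?_, hm⟩
  have h1 := hρm ρ
  have h2 : 2 / (E : ℝ) < ε / 2 := by
    rw [div_lt_iff₀ hE0]
    rw [div_lt_iff₀ hε] at hE
    linarith
  show ε / 4 < ρ.prob (S m)
  linarith

/-! ### Orthogonal integer vectors close to the range of a projection -/

section NearBasis

open Matrix

/-- The vector with number `j` in a list of vectors of Gaussian integers. -/
noncomputable def intVec (n : ℕ) (W : List (List (ℤ × ℤ))) (j : ℕ) :
    EuclideanSpace ℂ (Fin (2 ^ n)) := WithLp.toLp 2 fun i => intEntry W j i

theorem intVec_apply (n : ℕ) (W : List (List (ℤ × ℤ))) (j : ℕ) (i : Fin (2 ^ n)) :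
    intVec n W j i = intEntry W j i := rfl

/-- The sum of `|⟨w_j, w_k⟩|²` over `j ≠ k`. -/
noncomputable def orthogonalDefect (n : ℕ) (W : List (List (ℤ × ℤ))) : ℝ :=
  ∑ j ∈ Finset.range W.length, ∑ k ∈ Finset.range W.length,
    Complex.normSq ((if j = k then 0 else 1 : ℕ) *
      ∑ i ∈ Finset.range (2 ^ n), (starRingEnd ℂ) (intEntry W j i) * intEntry W k i)

/-- The sum of `(‖w_j‖² - K²)²`. -/
noncomputable def normDefect (n : ℕ) (W : List (List (ℤ × ℤ))) (K : ℕ) : ℝ :=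
  ∑ j ∈ Finset.range W.length,
    (∑ i ∈ Finset.range (2 ^ n), Complex.normSq (intEntry W j i) - (K : ℝ) ^ 2) ^ 2

/-- The sum of `‖S w_j - w_j‖²`, where `S` is given by the list `L` of its rows. -/
noncomputable def spanDefect (n : ℕ) (L : List (List AlgCode)) (W : List (List (ℤ × ℤ))) : ℝ :=
  ∑ j ∈ Finset.range W.length, ∑ i ∈ Finset.range (2 ^ n),
    Complex.normSq (∑ k ∈ Finset.range (2 ^ n), vecEntry L i k * intEntry W j k - intEntry W j i)

/-- The trace of the matrix given by the list `L` of its rows. -/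
noncomputable def traceOf (n : ℕ) (L : List (List AlgCode)) : ℂ :=
  ∑ i ∈ Finset.range (2 ^ n), vecEntry L i i

/-- The vectors of Gaussian integers in the list `W` are orthogonal, of norm about `K`, as many as
the trace of the projection given by `L`, and nearly in its range, with a relative error measured
by `E`. Everything is expressed by strict inequalities between computable reals. -/
structure IsNearBasis (E n : ℕ) (L : List (List AlgCode)) (W : List (List (ℤ × ℤ))) (K : ℕ) :
    Prop where
  orthogonal : orthogonalDefect n W < 1
  norm : 4 * normDefect n W K < ((K ^ 4 : ℕ) : ℝ)
  span : E * spanDefect n L W < (K : ℝ) ^ 2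
  rank : Complex.normSq (traceOf n L - W.length) < 1

section

variable {α : Type} [Primcodable α] {n K : α → ℕ} {L : α → List (List AlgCode)}
  {W : α → List (List (ℤ × ℤ))}

theorem RComputable.orthogonalDefect (hn : Computable n) (hW : Computable W) :
    RComputable fun a => orthogonalDefect (n a) (W a) := by
  unfold QRand.orthogonalDefect
  have h1 : Computable fun x : (α × ℕ) × ℕ => if x.1.2 = x.2 then 0 else 1 :=
    computable_ite (computable_decide_nat_eq (by fun_prop) (by fun_prop))
      (Computable.const 0) (Computable.const 1)
  fun_prop

theorem RComputable.normDefect (hn : Computable n) (hW : Computable W) (hK : Computable K) :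
    RComputable fun a => normDefect (n a) (W a) (K a) := by
  unfold QRand.normDefect
  fun_prop

theorem RComputable.spanDefect (hn : Computable n) (hL : Computable L) (hW : Computable W) :
    RComputable fun a => spanDefect (n a) (L a) (W a) := by
  unfold QRand.spanDefect
  fun_prop

@[fun_prop]
theorem CComputable.traceOf (hn : Computable n) (hL : Computable L) :
    CComputable fun a => traceOf (n a) (L a) := by
  unfold QRand.traceOf
  fun_prop

theorem SemiDec.isNearBasis (E : ℕ) (hn : Computable n) (hL : Computable L) (hW : Computable W)
    (hK : Computable K) : SemiDec fun a => IsNearBasis E (n a) (L a) (W a) (K a) := by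
  have h1 := SemiDec.lt (RComputable.orthogonalDefect hn hW) RComputable.one
  have h2 := SemiDec.lt ((RComputable.ofNat 4).mul (RComputable.normDefect hn hW hK))
    (RComputable.natCast (z := fun a => K a ^ 4) (by fun_prop))
  have h3 := SemiDec.lt ((RComputable.natCast (Computable.const E)).mul
    (RComputable.spanDefect hn hL hW)) (RComputable.natCast hK).pow_two
  have h4 := SemiDec.lt (f := fun a => Complex.normSq (QRand.traceOf (n a) (L a) - (W a).length))
    (by fun_prop) RComputable.one
  exact (h1.and (h2.and (h3.and h4))).of_iff fun a =>
    ⟨fun h => ⟨h.1, h.2.1, h.2.2.1, h.2.2.2⟩, fun h => ⟨h.1, h.2, h.3, h.4⟩⟩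

end

theorem traceOf_eq (n : ℕ) (L : List (List AlgCode)) : traceOf n L = (matOfCodes n L).trace :=
  Finset.sum_range _

theorem sum_normSq_intEntry (n : ℕ) (W : List (List (ℤ × ℤ))) (j : ℕ) :
    ∑ i ∈ Finset.range (2 ^ n), Complex.normSq (intEntry W j i) = ‖intVec n W j‖ ^ 2 := by
  rw [EuclideanSpace.norm_sq_eq, Finset.sum_range]
  exact Finset.sum_congr rfl fun i _ => Complex.normSq_eq_norm_sq _

theorem sum_conj_mul_intEntry (n : ℕ) (W : List (List (ℤ × ℤ))) (j k : ℕ) :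
    ∑ i ∈ Finset.range (2 ^ n), (starRingEnd ℂ) (intEntry W j i) * intEntry W k i =
      inner ℂ (intVec n W j) (intVec n W k) := by
  rw [Finset.sum_range, EuclideanSpace.inner_eq_star_dotProduct, dotProduct]
  exact Finset.sum_congr rfl fun i _ => mul_comm _ _

theorem spanDefect_eq (n : ℕ) (L : List (List AlgCode)) (W : List (List (ℤ × ℤ))) :
    spanDefect n L W = ∑ j ∈ Finset.range W.length,
      ‖WithLp.toLp 2 (matOfCodes n L *ᵥ (intVec n W j).ofLp) - intVec n W j‖ ^ 2 := by
  refine Finset.sum_congr rfl fun j _ => ?_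
  rw [EuclideanSpace.norm_sq_eq, Finset.sum_range]
  refine Finset.sum_congr rfl fun i _ => ?_
  rw [Complex.normSq_eq_norm_sq, Finset.sum_range]
  rfl

/-- The range of a projection has near bases of any precision: perturb an orthonormal basis to an
orthogonal family with entries in `ℚ(i)` and clear denominators. -/
theorem exists_isNearBasis (E : ℕ) {n : ℕ} {L : List (List AlgCode)}
    (hS : IsStarProjection (matOfCodes n L)) : ∃ W K, IsNearBasis E n L W K := by
  obtain ⟨r, v, hv, hSv⟩ := exists_eq_mul_conjTranspose hS
  set V : Matrix (Fin (2 ^ n)) (Fin r) ℂ := Matrix.of fun i j => v j i with hVdef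
  have hV : Vᴴ * V = 1 := conjTranspose_mul_self_eq_one_iff.2 hv
  have htr : traceOf n L = r := by
    rw [traceOf_eq, hSv, trace_mul_conjTranspose hV, Fintype.card_fin]
  have hfix : ∀ j, matOfCodes n L *ᵥ (v j).ofLp = (v j).ofLp := by
    intro j
    have h1 : (v j).ofLp = V *ᵥ Pi.single j 1 := by
      ext i
      simp [hVdef]
    rw [h1, hSv, mulVec_mulVec, Matrix.mul_assoc, hV, Matrix.mul_one]
  -- an error of `η ≤ 1` in a unit vector changes the square of its norm by at most `3 * η`
  set η : ℝ := 1 / (6 * ((r + 1) * (E + 1))) with hη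
  have hη0 : 0 < η := by positivity
  obtain ⟨u, hu, horth, hnear⟩ := exists_gaussianRational_orthogonal_near hv hη0
  obtain ⟨D, w, hD, hw⟩ := exists_common_denominator
    (z := fun x : Fin r × Fin (2 ^ n) => u x.1 x.2) fun x => hu x.1 x.2
  obtain ⟨W, hWr, hW⟩ := exists_intEntry_eq w
  have hDpos : (0 : ℝ) < D := by exact_mod_cast hD
  have hWu : ∀ j : Fin r, intVec n W j = (D : ℂ) • u j := by
    intro j
    ext i
    rw [intVec_apply, hW, hw, PiLp.smul_apply, smul_eq_mul]
  have hr0 : (0 : ℝ) ≤ r := by positivity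
  have hE0 : (0 : ℝ) ≤ E := by positivity
  have hηeq : η * (6 * ((r + 1) * (E + 1))) = 1 := by rw [hη]; field_simp
  have hη1 : η ≤ 1 := by
    have h1 : (1 : ℝ) ≤ 6 * ((r + 1) * (E + 1)) := by nlinarith
    rw [hη]
    exact (div_le_one (by positivity)).2 h1
  have hη2 : 36 * (r * η ^ 2) < 1 := by
    have h1 : (r : ℝ) < 1 / 36 * (6 * ((r + 1) * (E + 1))) ^ 2 := by
      have : (r : ℝ) + 1 ≤ (r + 1) * (E + 1) := by nlinarith
      nlinarith
    calc 36 * (r * η ^ 2) = 36 * η ^ 2 * r := by ring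
      _ < 36 * η ^ 2 * (1 / 36 * (6 * ((r + 1) * (E + 1))) ^ 2) := by gcongr
      _ = (η * (6 * ((r + 1) * (E + 1)))) ^ 2 := by ring
      _ = 1 := by rw [hηeq, one_pow]
  have hη3 : E * (r * η ^ 2) < 1 := by
    have h1 : (E : ℝ) * r < (6 * ((r + 1) * (E + 1))) ^ 2 := by
      have h2 : (E : ℝ) * r < (r + 1) * (E + 1) := by nlinarith
      have h3 : (1 : ℝ) ≤ (r + 1) * (E + 1) := by nlinarith
      nlinarith
    calc E * (r * η ^ 2) = η ^ 2 * (E * r) := by ring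
      _ < η ^ 2 * (6 * ((r + 1) * (E + 1))) ^ 2 := by gcongr
      _ = (η * (6 * ((r + 1) * (E + 1)))) ^ 2 := by ring
      _ = 1 := by rw [hηeq, one_pow]
  refine ⟨W, D, ?_, ?_, ?_, ?_⟩
  · have h0 : orthogonalDefect n W = 0 := by
      rw [orthogonalDefect, hWr, Finset.sum_range]
      refine Finset.sum_eq_zero fun j _ => ?_
      rw [Finset.sum_range]
      refine Finset.sum_eq_zero fun k _ => ?_
      rw [sum_conj_mul_intEntry, hWu, hWu, inner_smul_left, inner_smul_right]
      by_cases hjk : j = k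
      · simp [hjk]
      · rw [horth j k hjk]; simp
    rw [h0]; exact one_pos
  · have h1 : normDefect n W D ≤ r * (9 * η ^ 2 * (D : ℝ) ^ 4) := by
      rw [normDefect, hWr, Finset.sum_range]
      have h2 := Finset.sum_le_card_nsmul (Finset.univ : Finset (Fin r))
        (fun j => (∑ i ∈ Finset.range (2 ^ n), Complex.normSq (intEntry W j i) - (D : ℝ) ^ 2) ^ 2)
        (9 * η ^ 2 * (D : ℝ) ^ 4) (by
          intro j _
          have e : ‖intVec n W j‖ = D * ‖u j‖ := by
            rw [hWu, norm_smul, Complex.norm_natCast]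
          rw [sum_normSq_intEntry, e]
          have h3 : |‖u j‖ - 1| < η := by
            have := abs_norm_sub_norm_le (u j) (v j)
            rw [hv.1] at this
            exact this.trans_lt (hnear j)
          obtain ⟨h4, h5⟩ := abs_lt.1 h3
          have h6 : (‖u j‖ ^ 2 - 1) ^ 2 ≤ (3 * η) ^ 2 := by
            refine sq_le_sq' ?_ ?_ <;> nlinarith [norm_nonneg (u j)]
          calc ((D * ‖u j‖) ^ 2 - (D : ℝ) ^ 2) ^ 2 = (D : ℝ) ^ 4 * (‖u j‖ ^ 2 - 1) ^ 2 := by ring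
            _ ≤ (D : ℝ) ^ 4 * (3 * η) ^ 2 := by gcongr
            _ = 9 * η ^ 2 * (D : ℝ) ^ 4 := by ring)
      simpa using h2
    have hD4 : (0 : ℝ) < (D : ℝ) ^ 4 := by positivity
    push_cast
    calc 4 * normDefect n W D ≤ 4 * (r * (9 * η ^ 2 * (D : ℝ) ^ 4)) := by gcongr
      _ = 36 * (r * η ^ 2) * (D : ℝ) ^ 4 := by ring
      _ < 1 * (D : ℝ) ^ 4 := by gcongr
      _ = (D : ℝ) ^ 4 := one_mul _
  · have h1 : spanDefect n L W ≤ r * (η ^ 2 * (D : ℝ) ^ 2) := by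
      rw [spanDefect_eq, hWr, Finset.sum_range]
      have h2 := Finset.sum_le_card_nsmul (Finset.univ : Finset (Fin r))
        (fun j => ‖WithLp.toLp 2 (matOfCodes n L *ᵥ (intVec n W j).ofLp) - intVec n W j‖ ^ 2)
        (η ^ 2 * (D : ℝ) ^ 2) (by
          intro j _
          have e : WithLp.toLp 2 (matOfCodes n L *ᵥ (intVec n W j).ofLp) - intVec n W j =
              (D : ℂ) • (WithLp.toLp 2 (matOfCodes n L *ᵥ (u j).ofLp) - u j) := by
            rw [hWu, WithLp.ofLp_smul, mulVec_smul, WithLp.toLp_smul, smul_sub]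
          rw [e, norm_smul, Complex.norm_natCast]
          have h3 := (norm_toLp_mulVec_sub_le hS (hfix j) (u j)).trans (hnear j).le
          calc ((D : ℝ) * ‖WithLp.toLp 2 (matOfCodes n L *ᵥ (u j).ofLp) - u j‖) ^ 2
              ≤ (D * η) ^ 2 := by gcongr
            _ = η ^ 2 * (D : ℝ) ^ 2 := by ring)
      simpa using h2
    have hD2 : (0 : ℝ) < (D : ℝ) ^ 2 := by positivity
    calc E * spanDefect n L W ≤ E * (r * (η ^ 2 * (D : ℝ) ^ 2)) := by gcongr
      _ = E * (r * η ^ 2) * (D : ℝ) ^ 2 := by ring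
      _ < 1 * (D : ℝ) ^ 2 := by gcongr
      _ = (D : ℝ) ^ 2 := one_mul _
  · rw [htr, hWr, sub_self, map_zero]
    exact one_pos

/-- The squared norm of a vector of Gaussian integers. -/
def normSqNat (n : ℕ) (l : List (ℤ × ℤ)) : ℕ :=
  ∑ i ∈ Finset.range (2 ^ n), ((l.getD i (0, 0)).1.natAbs ^ 2 + (l.getD i (0, 0)).2.natAbs ^ 2)

theorem computable_nat_sum_range {α : Type} [Primcodable α] {n : α → ℕ} {f : α → ℕ → ℕ}
    (hn : Computable n) (hf : Computable fun x : α × ℕ => f x.1 x.2) :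
    Computable fun a => ∑ i ∈ Finset.range (n a), f a i := by
  obtain ⟨s, hs, hs0, hs1⟩ := exists_computable_rec (g := fun _ : α => 0)
    (h := fun x : α × ℕ × ℕ => x.2.2 + f x.1 x.2.1) hn (Computable.const 0) (by
      have : Computable fun x : α × ℕ × ℕ => f x.1 x.2.1 := hf.comp
        (g := fun x : α × ℕ × ℕ => (x.1, x.2.1)) (by fun_prop)
      fun_prop)
  refine hs.of_eq fun a => ?_
  have key : ∀ k, s a k = ∑ i ∈ Finset.range k, f a i := by
    intro k
    induction k with
    | zero => simp [hs0]
    | succ k ih => rw [hs1, ih, Finset.sum_range_succ]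
  exact key _

/-- The codes of the normalizations of the vectors in a list. -/
def unitCodes (n : ℕ) (W : List (List (ℤ × ℤ))) : List (List AlgCode) :=
  W.map fun l => (List.range (2 ^ n)).map fun i =>
    (sqrtCode (l.getD i (0, 0)).1 (normSqNat n l), sqrtCode (l.getD i (0, 0)).2 (normSqNat n l))

theorem computable_unitCodes {α : Type} [Primcodable α] {n : α → ℕ} {W : α → List (List (ℤ × ℤ))}
    (hn : Computable n) (hW : Computable W) : Computable fun a => unitCodes (n a) (W a) := by
  unfold unitCodes
  have h1 : Computable fun x : α × List (ℤ × ℤ) => normSqNat (n x.1) x.2 := by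
    unfold normSqNat
    simp only [sq]
    exact computable_nat_sum_range (by fun_prop) (by fun_prop)
  have h2 : Computable fun x : (α × List (ℤ × ℤ)) × ℕ => normSqNat (n x.1.1) x.1.2 :=
    h1.comp Computable.fst
  have h3 : Computable fun x : (α × List (ℤ × ℤ)) × ℕ =>
      (sqrtCode (x.1.2.getD x.2 (0, 0)).1 (normSqNat (n x.1.1) x.1.2),
        sqrtCode (x.1.2.getD x.2 (0, 0)).2 (normSqNat (n x.1.1) x.1.2)) := by fun_prop
  exact computable_map_list hW (computable_map_range (α := α × List (ℤ × ℤ))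
    (n := fun x => 2 ^ n x.1) (f := fun x i =>
      (sqrtCode (x.2.getD i (0, 0)).1 (normSqNat (n x.1) x.2),
        sqrtCode (x.2.getD i (0, 0)).2 (normSqNat (n x.1) x.2))) (by fun_prop) h3)

theorem vecOfCodes_unitCodes {n : ℕ} {W : List (List (ℤ × ℤ))} {j : ℕ} (hj : j < W.length)
    (h0 : 0 < ‖intVec n W j‖) :
    vecOfCodes n ((unitCodes n W).getD j []) = ((‖intVec n W j‖⁻¹ : ℝ) : ℂ) • intVec n W j := by
  set l := W.getD j [] with hl
  -- the number under the square root in the codes is the squared norm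
  have hs : (normSqNat n l : ℝ) = ‖intVec n W j‖ ^ 2 := by
    rw [← sum_normSq_intEntry, normSqNat]
    push_cast
    refine Finset.sum_congr rfl fun i _ => ?_
    rw [intEntry, ← hl, gaussInt, Complex.normSq_mk, Nat.cast_natAbs, Nat.cast_natAbs]
    push_cast
    rw [sq_abs, sq_abs, sq, sq]
  have hs0 : 0 < normSqNat n l := by
    have : (0 : ℝ) < normSqNat n l := by rw [hs]; positivity
    exact_mod_cast this
  have hsqrt : √(normSqNat n l : ℝ) = ‖intVec n W j‖ := by
    rw [hs, Real.sqrt_sq (norm_nonneg _)]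
  have hle : ∀ i : Fin (2 ^ n), (l.getD i (0, 0)).1 ^ 2 ≤ (normSqNat n l : ℤ) ∧
      (l.getD i (0, 0)).2 ^ 2 ≤ (normSqNat n l : ℤ) := by
    intro i
    have h1 : (l.getD i (0, 0)).1.natAbs ^ 2 + (l.getD i (0, 0)).2.natAbs ^ 2 ≤ normSqNat n l :=
      Finset.single_le_sum (f := fun i : ℕ =>
        (l.getD i (0, 0)).1.natAbs ^ 2 + (l.getD i (0, 0)).2.natAbs ^ 2)
        (fun _ _ => Nat.zero_le _) (Finset.mem_range.2 i.2)
    have h2 : (((l.getD i (0, 0)).1.natAbs ^ 2 + (l.getD i (0, 0)).2.natAbs ^ 2 : ℕ) : ℤ) ≤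
      normSqNat n l := by exact_mod_cast h1
    push_cast at h2
    rw [sq_abs, sq_abs] at h2
    constructor <;> nlinarith [sq_nonneg (l.getD i (0, 0)).1, sq_nonneg (l.getD i (0, 0)).2]
  have hcode : (unitCodes n W).getD j [] = (List.range (2 ^ n)).map fun i =>
      (sqrtCode (l.getD i (0, 0)).1 (normSqNat n l),
        sqrtCode (l.getD i (0, 0)).2 (normSqNat n l)) := by
    rw [List.getD_eq_getElem _ _ (by simpa [unitCodes] using hj), hl,
      List.getD_eq_getElem _ _ hj]
    simp [unitCodes]
  ext i
  have e : vecOfCodes n ((unitCodes n W).getD j []) i =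
      algVal (((unitCodes n W).getD j []).getD i (([], 0, 0), ([], 0, 0))) := rfl
  rw [e, hcode, getD_map_range _ _ i.2, PiLp.smul_apply, intVec_apply, intEntry, ← hl, smul_eq_mul]
  apply Complex.ext
  · rw [Complex.re_ofReal_mul, algVal, realVal_sqrtCode hs0 (hle i).1, hsqrt, div_eq_inv_mul]
    rfl
  · rw [Complex.im_ofReal_mul, algVal, realVal_sqrtCode hs0 (hle i).2, hsqrt, div_eq_inv_mul]
    rfl

theorem IsNearBasis.trace_eq {E n : ℕ} {L : List (List AlgCode)} {W : List (List (ℤ × ℤ))}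
    {K : ℕ} (h : IsNearBasis E n L W K) (hS : IsStarProjection (matOfCodes n L)) :
    (matOfCodes n L).trace = W.length := by
  obtain ⟨r, v, hv, hSv⟩ := exists_eq_mul_conjTranspose hS
  have htr : (matOfCodes n L).trace = r := by
    rw [hSv, trace_mul_conjTranspose (conjTranspose_mul_self_eq_one_iff.2 hv), Fintype.card_fin]
  have h1 := eq_zero_of_sum_normSq_lt_one (s := Finset.univ)
    (f := fun _ : Unit => traceOf n L - W.length)
    (fun _ _ => by
      rw [traceOf_eq, htr]
      exact sub_mem (natCast_mem _ _) (natCast_mem _ _))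
    (by simpa using h.rank) () (Finset.mem_univ _)
  rw [← traceOf_eq]
  exact sub_eq_zero.1 h1

/-- A near basis, normalized, is an orthonormal set described by computable codes, whose span has at
least about half the probability of the projection. -/
theorem IsNearBasis.exists_finset {E n : ℕ} {L : List (List AlgCode)} {W : List (List (ℤ × ℤ))}
    {K : ℕ} (h : IsNearBasis E n L W K) (hE : 0 < E) (hS : IsStarProjection (matOfCodes n L)) :
    ∃ F : Finset (EuclideanSpace ℂ (Fin (2 ^ n))),
      IsIndexOf (Encodable.encode ((n, unitCodes n W) : ArrayCode)) F ∧
      Orthonormal ℂ (fun v : F => (v : EuclideanSpace ℂ (Fin (2 ^ n)))) ∧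
      F.card = W.length ∧ ∀ ρ : Matrix (Fin (2 ^ n)) (Fin (2 ^ n)) ℂ, ρ.PosSemidef → ρ.trace = 1 →
        (ρ * matOfCodes n L).trace.re ≤
          2 * ∑ v ∈ F, (inner ℂ v (Matrix.toEuclideanLin ρ v)).re + 4 / E := by
  classical
  have hE' : (0 : ℝ) < E := by exact_mod_cast hE
  have hnd : 0 ≤ normDefect n W K := Finset.sum_nonneg fun j _ => sq_nonneg _
  have hK4 : (0 : ℝ) < (K : ℝ) ^ 4 := by
    have := h.norm
    push_cast at this
    linarith
  have hK2 : (0 : ℝ) < (K : ℝ) ^ 2 := by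
    rcases (sq_nonneg (K : ℝ)).eq_or_lt with h0 | h0
    · have : (K : ℝ) ^ 4 = ((K : ℝ) ^ 2) ^ 2 := by ring
      rw [this, ← h0] at hK4
      norm_num at hK4
    · exact h0
  have hK0 : (K : ℝ) ≠ 0 := fun h0 => by rw [h0] at hK2; norm_num at hK2
  have hnorm : ∀ j : Fin W.length, (K : ℝ) ^ 2 / 2 < ‖intVec n W j‖ ^ 2 := by
    intro j
    have h1 : (‖intVec n W j‖ ^ 2 - (K : ℝ) ^ 2) ^ 2 ≤ normDefect n W K := by
      rw [← sum_normSq_intEntry]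
      exact Finset.single_le_sum (f := fun j => (∑ i ∈ Finset.range (2 ^ n),
        Complex.normSq (intEntry W j i) - (K : ℝ) ^ 2) ^ 2) (fun j _ => sq_nonneg _)
        (Finset.mem_range.2 j.2)
    have h2 := h.norm
    push_cast at h2
    have h3 : (‖intVec n W j‖ ^ 2 - (K : ℝ) ^ 2) ^ 2 < ((K : ℝ) ^ 2 / 2) ^ 2 := by
      have : ((K : ℝ) ^ 2 / 2) ^ 2 = (K : ℝ) ^ 4 / 4 := by ring
      linarith
    linarith [(abs_lt_of_sq_lt_sq' h3 (by positivity)).1]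
  have hpos : ∀ j : Fin W.length, 0 < ‖intVec n W j‖ := by
    intro j
    by_contra h0
    have h1 := hnorm j
    rw [le_antisymm (not_lt.1 h0) (norm_nonneg _)] at h1
    norm_num at h1
    linarith
  have horth : ∀ j k : Fin W.length, j ≠ k → inner ℂ (intVec n W j) (intVec n W k) = 0 := by
    intro j k hjk
    have h1 := eq_zero_of_sum_normSq_lt_one
      (s := Finset.range W.length ×ˢ Finset.range W.length)
      (f := fun x : ℕ × ℕ => (if x.1 = x.2 then 0 else 1 : ℕ) *
        ∑ i ∈ Finset.range (2 ^ n), (starRingEnd ℂ) (intEntry W x.1 i) * intEntry W x.2 i)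
      (fun x _ => mul_mem (natCast_mem _ _) (sum_mem fun i _ =>
        mul_mem (conj_mem_gaussianInt (gaussInt_mem _)) (gaussInt_mem _)))
      (by rw [Finset.sum_product]; exact h.orthogonal)
      ((j : ℕ), (k : ℕ)) (by simp)
    simp only [if_neg (Fin.val_injective.ne hjk), Nat.cast_one, one_mul] at h1
    rwa [sum_conj_mul_intEntry] at h1
  let v : Fin W.length → EuclideanSpace ℂ (Fin (2 ^ n)) := fun j =>
    ((‖intVec n W j‖⁻¹ : ℝ) : ℂ) • intVec n W j
  have hv : Orthonormal ℂ v := by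
    refine ⟨fun j => ?_, fun j k hjk => ?_⟩
    · rw [norm_smul, Complex.norm_real, norm_inv, norm_norm, inv_mul_cancel₀ (hpos j).ne']
    · simp only [v]
      rw [inner_smul_left, inner_smul_right, horth j k hjk, mul_zero, mul_zero]
  have hvinj : Function.Injective v := hv.linearIndependent.injective
  have hcodes : ∀ j : Fin W.length, vecOfCodes n ((unitCodes n W).getD j []) = v j := fun j =>
    vecOfCodes_unitCodes j.2 (hpos j)
  have hlen : (unitCodes n W).length = W.length := by simp [unitCodes]
  refine ⟨Finset.univ.image v, ⟨unitCodes n W, Encodable.encodek _, ?_⟩, ?_, ?_, ?_⟩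
  · ext x
    rw [Finset.coe_image, Finset.coe_univ, Set.image_univ]
    constructor
    · rintro ⟨j, rfl⟩
      have hj : (j : ℕ) < (unitCodes n W).length := by rw [hlen]; exact j.2
      refine ⟨(unitCodes n W)[(j : ℕ)], List.getElem_mem hj, ?_⟩
      rw [← hcodes j, List.getD_eq_getElem _ _ hj]
    · rintro ⟨l, hl, rfl⟩
      obtain ⟨j, hj, rfl⟩ := List.getElem_of_mem hl
      refine ⟨⟨j, hlen ▸ hj⟩, ?_⟩
      rw [← hcodes ⟨j, hlen ▸ hj⟩, List.getD_eq_getElem _ _ hj]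
  · rw [orthonormal_iff_ite]
    rintro ⟨x, hx⟩ ⟨y, hy⟩
    obtain ⟨j, -, rfl⟩ := Finset.mem_image.1 hx
    obtain ⟨k, -, rfl⟩ := Finset.mem_image.1 hy
    simp only [Subtype.mk.injEq, hvinj.eq_iff]
    exact orthonormal_iff_ite.1 hv j k
  · rw [Finset.card_image_of_injective _ hvinj, Finset.card_univ, Fintype.card_fin]
  · intro ρ hρ hρ1
    set V : Matrix (Fin (2 ^ n)) (Fin W.length) ℂ := Matrix.of fun i j => v j i with hVdef
    have hV : Vᴴ * V = 1 := conjTranspose_mul_self_eq_one_iff.2 hv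
    have h1 := re_trace_mul_le_of_projections hρ hρ1 (isStarProjection_mul_conjTranspose hV) hS
    have h2 : (matOfCodes n L).trace = (V * Vᴴ).trace := by
      rw [h.trace_eq hS, trace_mul_conjTranspose hV, Fintype.card_fin]
    rw [h2, trace_mul_comm (matOfCodes n L), trace_sub_trace_mul_projection hS,
      trace_mul_mul_conjTranspose, Complex.re_sum] at h1
    rw [Finset.sum_image fun j _ k _ hjk => hvinj hjk]
    have h3 : ∑ j, ∑ i, (((V - matOfCodes n L * V) i j).re ^ 2 +
        ((V - matOfCodes n L * V) i j).im ^ 2) ≤ 2 / E := by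
      have h4 : ∀ j, ∑ i, (((V - matOfCodes n L * V) i j).re ^ 2 +
          ((V - matOfCodes n L * V) i j).im ^ 2) =
          ‖WithLp.toLp 2 (matOfCodes n L *ᵥ (v j).ofLp) - v j‖ ^ 2 := by
        intro j
        rw [norm_sub_rev, EuclideanSpace.norm_sq_eq]
        refine Finset.sum_congr rfl fun i _ => ?_
        rw [← Complex.normSq_eq_norm_sq, Complex.normSq_apply]
        simp only [hVdef, Matrix.sub_apply, of_apply, mul_apply, PiLp.sub_apply, mulVec, dotProduct]
        ring
      have h5 : ∀ j, ‖WithLp.toLp 2 (matOfCodes n L *ᵥ (v j).ofLp) - v j‖ ^ 2 ≤ 2 / (K : ℝ) ^ 2 *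
          ‖WithLp.toLp 2 (matOfCodes n L *ᵥ (intVec n W j).ofLp) - intVec n W j‖ ^ 2 := by
        intro j
        have e : WithLp.toLp 2 (matOfCodes n L *ᵥ (v j).ofLp) - v j = ((‖intVec n W j‖⁻¹ : ℝ) : ℂ) •
            (WithLp.toLp 2 (matOfCodes n L *ᵥ (intVec n W j).ofLp) - intVec n W j) := by
          simp only [v]
          rw [WithLp.ofLp_smul, mulVec_smul, WithLp.toLp_smul, smul_sub]
        rw [e, norm_smul, Complex.norm_real, norm_inv, norm_norm, mul_pow, inv_pow]
        gcongr
        rw [inv_le_comm₀ (by have := hpos j; positivity) (by positivity), inv_div]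
        exact (hnorm j).le
      calc ∑ j, ∑ i, (((V - matOfCodes n L * V) i j).re ^ 2 +
            ((V - matOfCodes n L * V) i j).im ^ 2)
          ≤ ∑ j : Fin W.length, 2 / (K : ℝ) ^ 2 *
            ‖WithLp.toLp 2 (matOfCodes n L *ᵥ (intVec n W j).ofLp) - intVec n W j‖ ^ 2 :=
            Finset.sum_le_sum fun j _ => (h4 j).trans_le (h5 j)
        _ = 2 / (K : ℝ) ^ 2 * spanDefect n L W := by
            rw [spanDefect_eq, Finset.sum_range, Finset.mul_sum]
        _ ≤ 2 / (K : ℝ) ^ 2 * ((K : ℝ) ^ 2 / E) := by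
            gcongr
            rw [le_div_iff₀ hE', mul_comm]
            exact h.span.le
        _ = 2 / E := by field_simp
    have h6 : (4 : ℝ) / E = 2 * (2 / E) := by ring
    rw [h6]
    have h7 : ∑ j, (inner ℂ (WithLp.toLp 2 (V.col j) : EuclideanSpace ℂ (Fin (2 ^ n)))
        (Matrix.toEuclideanLin ρ (WithLp.toLp 2 (V.col j)))).re =
        ∑ j, (inner ℂ (v j) (Matrix.toEuclideanLin ρ (v j))).re := rfl
    linarith

end NearBasis

/-! ### Dyadic intervals -/

/-- The number with binary expansion `0.σ`, the left end of the dyadic interval of length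
`2 ^ (-|σ|)` formed by the numbers whose binary expansions extend `σ`. -/
noncomputable def binVal (σ : List Bool) : ℝ :=
  ∑ i ∈ Finset.range σ.length,
    ((if σ.getD i false = true then 1 else 0 : ℕ) : ℝ) * (2 : ℝ)⁻¹ ^ (i + 1)

theorem RComputable.binVal {α : Type} [Primcodable α] {σ : α → List Bool} (hσ : Computable σ) :
    RComputable fun a => binVal (σ a) := by
  unfold QRand.binVal
  have h : Computable fun x : α × ℕ => (if (σ x.1).getD x.2 false = true then 1 else 0 : ℕ) := by
    refine computable_ite ?_ (Computable.const 1) (Computable.const 0)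
    have : Computable fun x : α × ℕ => (σ x.1).getD x.2 false := by fun_prop
    exact this.of_eq fun x => by simp
  fun_prop

theorem binVal_nil : binVal [] = 0 := by simp [binVal]

theorem binVal_cons (b : Bool) (σ : List Bool) :
    binVal (b :: σ) = (((if b = true then 1 else 0 : ℕ) : ℝ) + binVal σ) / 2 := by
  rw [binVal, List.length_cons, Finset.sum_range_succ', binVal, add_div, Finset.sum_div, add_comm]
  congr 1
  · simp [div_eq_mul_inv]
  · refine Finset.sum_congr rfl fun i _ => ?_
    rw [List.getD_cons_succ, pow_succ _ (i + 1)]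
    ring

theorem binVal_bounds (σ : List Bool) : 0 ≤ binVal σ ∧ binVal σ + (2 : ℝ)⁻¹ ^ σ.length ≤ 1 := by
  induction σ with
  | nil => simp [binVal_nil]
  | cons b σ ih =>
    rw [binVal_cons, List.length_cons, pow_succ]
    have hb : (0 : ℝ) ≤ ((if b = true then 1 else 0 : ℕ) : ℝ) ∧
        ((if b = true then 1 else 0 : ℕ) : ℝ) ≤ 1 := by cases b <;> simp
    constructor <;> linarith

theorem binVal_append_bounds (σ π : List Bool) : binVal σ ≤ binVal (σ ++ π) ∧
    binVal (σ ++ π) + (2 : ℝ)⁻¹ ^ (σ ++ π).length ≤ binVal σ + (2 : ℝ)⁻¹ ^ σ.length := by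
  induction σ with
  | nil => simpa [binVal_nil] using binVal_bounds π
  | cons b σ ih =>
    rw [List.cons_append, binVal_cons, binVal_cons, List.length_cons, List.length_cons, pow_succ,
      pow_succ]
    constructor <;> linarith

theorem exists_binVal_eq (l k : ℕ) (hk : k < 2 ^ l) :
    ∃ σ : List Bool, σ.length = l ∧ binVal σ = k * (2 : ℝ)⁻¹ ^ l := by
  induction l generalizing k with
  | zero =>
    have : k = 0 := by simpa using hk
    exact ⟨[], rfl, by simp [binVal_nil, this]⟩
  | succ l ih =>
    have e : (2 : ℝ) ^ l * (2 : ℝ)⁻¹ ^ l = 1 := by rw [← mul_pow]; norm_num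
    rw [pow_succ] at hk
    by_cases h : k < 2 ^ l
    · obtain ⟨σ, h1, h2⟩ := ih k h
      refine ⟨false :: σ, by simp [h1], ?_⟩
      rw [binVal_cons, h2, pow_succ]
      simp; ring
    · obtain ⟨σ, h1, h2⟩ := ih (k - 2 ^ l) (by omega)
      refine ⟨true :: σ, by simp [h1], ?_⟩
      rw [binVal_cons, h2, pow_succ, Nat.cast_sub (not_lt.1 h)]
      push_cast
      rw [if_pos rfl]
      linear_combination (-1 / 2) * e

/-- Every interval in `[0, 1]` contains, in its interior, a dyadic interval of comparable length. -/
theorem exists_dyadic_between {a p : ℝ} (ha : 0 ≤ a) (hp : 0 < p) (hap : a + p ≤ 1) :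
    ∃ σ : List Bool, a < binVal σ ∧ binVal σ + (2 : ℝ)⁻¹ ^ σ.length < a + p ∧
      p < 16 * (2 : ℝ)⁻¹ ^ σ.length := by
  -- with `2 ^ (-l - 1) < p / 2` there is room for a whole dyadic interval after rounding up `a`
  obtain ⟨l, h1, h2⟩ := exists_nat_pow_near_of_lt_one (x := p / 2) (y := (2 : ℝ)⁻¹) (by linarith)
    (by linarith) (by norm_num) (by norm_num)
  have hpow : (0 : ℝ) < (2 : ℝ)⁻¹ ^ (l + 1) := by positivity
  have h3 : (2 : ℝ)⁻¹ ^ l = 2 * (2 : ℝ)⁻¹ ^ (l + 1) := by rw [pow_succ]; ring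
  have e : (2 : ℝ) ^ (l + 1) * (2 : ℝ)⁻¹ ^ (l + 1) = 1 := by rw [← mul_pow]; norm_num
  set k := ⌊a * 2 ^ (l + 1)⌋₊ + 1 with hk
  have h4 : a * 2 ^ (l + 1) < k := by rw [hk]; exact_mod_cast Nat.lt_floor_add_one _
  have h5 : (k : ℝ) ≤ a * 2 ^ (l + 1) + 1 := by
    rw [hk]; push_cast
    linarith [Nat.floor_le (show 0 ≤ a * 2 ^ (l + 1) by positivity)]
  have h6 : a < k * (2 : ℝ)⁻¹ ^ (l + 1) := by
    calc a = a * 2 ^ (l + 1) * (2 : ℝ)⁻¹ ^ (l + 1) := by rw [mul_assoc, e, mul_one]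
      _ < k * (2 : ℝ)⁻¹ ^ (l + 1) := by gcongr
  have h7 : k * (2 : ℝ)⁻¹ ^ (l + 1) ≤ a + (2 : ℝ)⁻¹ ^ (l + 1) := by
    calc k * (2 : ℝ)⁻¹ ^ (l + 1) ≤ (a * 2 ^ (l + 1) + 1) * (2 : ℝ)⁻¹ ^ (l + 1) := by gcongr
      _ = a + (2 : ℝ)⁻¹ ^ (l + 1) := by linear_combination a * e
  have h8 : k < 2 ^ (l + 1) := by
    have : (k : ℝ) * (2 : ℝ)⁻¹ ^ (l + 1) < 2 ^ (l + 1) * (2 : ℝ)⁻¹ ^ (l + 1) := by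
      rw [e]; linarith
    exact_mod_cast lt_of_mul_lt_mul_right this hpow.le
  obtain ⟨σ, hσ, hσk⟩ := exists_binVal_eq (l + 1) k h8
  exact ⟨σ, by rw [hσk]; exact h6, by rw [hσ, hσk]; linarith, by rw [hσ]; linarith⟩

/-! ### From tests to machines -/

/-- A computable sequence of pairwise incompatible strings with a computable total measure is the
domain of a computable measure machine with arbitrary computable outputs. -/
theorem exists_machine {t : ℕ → Option (List Bool)} {o : ℕ → ℕ} (ht : Computable t)
    (ho : Computable o)
    (hpre : ∀ m m' σ π, t m = some σ → t m' = some π → σ <+: π → m = m')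
    (hc : IsComputableReal (∑' m, (t m).elim 0 fun σ => (2 : ℝ)⁻¹ ^ σ.length)) :
    ∃ C : List Bool →. ℕ, IsComputableMeasureMachine C ∧ ∀ m σ, t m = some σ → o m ∈ C σ := by
  let C : List Bool →. ℕ := fun σ =>
    (Nat.rfind fun m => Part.some (decide (t m = some σ))).map o
  have hCp : Partrec C := by
    have h1 : Computable fun x : List Bool × ℕ => decide (t x.2 = some x.1) :=
      (PrimrecRel.decide Primrec.eq).to_comp.comp (ht.comp Computable.snd)
        (Computable.option_some.comp Computable.fst)
    exact (Partrec.rfind h1.to₂.partrec₂).map (ho.comp Computable.snd).to₂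
  have hmem : ∀ m σ, t m = some σ → o m ∈ C σ := by
    intro m σ hm
    refine (Part.mem_map_iff _).2 ⟨m, Nat.mem_rfind.2 ⟨by simp [hm], fun {m'} hm' => ?_⟩, rfl⟩
    have : t m' ≠ some σ := fun h => hm'.ne (hpre m' m σ σ h hm List.prefix_rfl)
    simp [this]
  have hdom : ∀ σ, σ ∈ C.Dom ↔ ∃ m, t m = some σ := by
    intro σ
    rw [PFun.mem_dom]
    constructor
    · rintro ⟨y, hy⟩
      obtain ⟨m, hm, -⟩ := (Part.mem_map_iff _).1 hy
      exact ⟨m, by simpa using (Nat.mem_rfind.1 hm).1⟩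
    · rintro ⟨m, hm⟩
      exact ⟨o m, hmem m σ hm⟩
  have hpf : PrefixFree C.Dom := by
    intro σ hσ π hπ hσπ
    obtain ⟨m, hm⟩ := (hdom σ).1 hσ
    obtain ⟨m', hm'⟩ := (hdom π).1 hπ
    have := hpre m m' σ π hm hm' hσπ
    rw [this, hm'] at hm
    exact (Option.some_injective _ hm).symm
  refine ⟨C, ⟨hCp, hpf, ?_⟩, hmem⟩
  rw [← (hasSum_cantorMeasure hpf hdom fun m m' σ h h' =>
    hpre m m' σ σ h h' List.prefix_rfl).tsum_eq]
  exact hc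

theorem IsCodeOf.spec {c : ArrayCode} {S : SpecialProjection} (h : IsCodeOf c S) :
    IsStarProjection (matOfCodes c.1 c.2) ∧
      ∀ ρ : QState, ρ.prob S = (ρ.seq c.1 * matOfCodes c.1 c.2).trace.re := by
  obtain ⟨n, L⟩ := c
  obtain ⟨h1, h2⟩ := h
  simp only at h1 h2
  subst h1
  rw [← h2]
  exact ⟨S.isStarProjection, fun ρ => rfl⟩

theorem IsCodeOf.tracialState_prob {c : ArrayCode} {S : SpecialProjection} (h : IsCodeOf c S) :
    tracialState.prob S = (traceOf c.1 c.2).re * (2 : ℝ)⁻¹ ^ c.1 := by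
  have h1 : tracialState.seq c.1 * matOfCodes c.1 c.2 =
      (((2 : ℝ)⁻¹ ^ c.1 : ℝ) : ℂ) • matOfCodes c.1 c.2 := by
    simp [tracialState]
  rw [h.spec.2, h1, Matrix.trace_smul, smul_eq_mul, Complex.re_ofReal_mul, traceOf_eq, mul_comm]

/-- A state that fails a quantum Schnorr test has small complexity for some computable measure
machine. The `m`-th projection of the test gets the subinterval of `[0, 1]` between consecutive
partial sums of the tracial probabilities, scaled down to a total of at most `1`. A string whose
dyadic interval lies inside of it describes a near basis of the projection. These strings are
incompatible, and the measure of their set is dominated by the sum of the test. -/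
theorem QState.FailsAt.exists_machine {ρ : QState} {S : ℕ → SpecialProjection}
    (hS : IsQuantumSchnorrTest S) {δ : ℝ} (hδ : 0 < δ) (hfail : ρ.FailsAt S δ) :
    ∃ C, IsComputableMeasureMachine C ∧ ∃ d : ℝ, ∀ N : ℕ, ∃ n ≥ N,
      QK C (δ / 4) (ρ.seq n) < (((n : ℝ) + d : ℝ) : EReal) := by
  obtain ⟨⟨⟨g, hg, hgS⟩, hsum⟩, hcomp⟩ := hS
  obtain ⟨E, hE⟩ := exists_nat_gt (8 / δ)
  have hE0 : (0 : ℝ) < E := lt_trans (by positivity) hE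
  have hE1 : 4 / (E : ℝ) < δ / 2 := by
    rw [div_lt_iff₀ hδ] at hE
    rw [div_lt_iff₀ hE0]
    linarith
  have hEpos : 0 < E := by exact_mod_cast hE0
  obtain ⟨c, hc⟩ := pow_unbounded_of_one_lt (∑' m, tracialState.prob (S m)) (one_lt_two (α := ℝ))
  have hc1 : (2 : ℝ) ^ c * (2 : ℝ)⁻¹ ^ c = 1 := by rw [← mul_pow]; norm_num
  -- the tracial probabilities of the test, scaled down to a total of at most `1`
  let p : ℕ → ℝ := fun m => (traceOf (g m).1 (g m).2).re * (2 : ℝ)⁻¹ ^ (g m).1 * (2 : ℝ)⁻¹ ^ c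
  have hpτ : ∀ m, p m = tracialState.prob (S m) * (2 : ℝ)⁻¹ ^ c := fun m => by
    rw [(hgS m).tracialState_prob]
  have hp : RComputable p := by
    have h1 : RComputable fun m => (2 : ℝ)⁻¹ ^ (g m).1 := by fun_prop
    have h2 : RComputable fun _ : ℕ => (2 : ℝ)⁻¹ ^ c := RComputable.inv_two_pow (Computable.const c)
    have h3 : RComputable fun m => (traceOf (g m).1 (g m).2).re := by fun_prop
    exact (h3.mul h1).mul h2
  have hps : Summable p := by
    rw [funext hpτ]
    exact hsum.mul_right _
  have hptsum : ∑' m, p m = (∑' m, tracialState.prob (S m)) * (2 : ℝ)⁻¹ ^ c := by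
    rw [funext hpτ, tsum_mul_right]
  have hpc : IsComputableReal (∑' m, p m) := by
    rw [hptsum, isComputableReal_iff]
    exact (isComputableReal_iff.1 hcomp).mul (RComputable.inv_two_pow (Computable.const c))
  have hrank : ∀ m W K, IsNearBasis E (g m).1 (g m).2 W K →
      tracialState.prob (S m) = W.length * (2 : ℝ)⁻¹ ^ (g m).1 := by
    intro m W K h
    rw [(hgS m).tracialState_prob, traceOf_eq, h.trace_eq (hgS m).spec.1, Complex.natCast_re]
  have hp0 : ∀ m, 0 ≤ p m := by
    intro m
    obtain ⟨W, K, h⟩ := exists_isNearBasis E (hgS m).spec.1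
    rw [hpτ, hrank m W K h]
    positivity
  let A : ℕ → ℝ := fun m => ∑ j ∈ Finset.range m, p j
  have hAmono : Monotone A := fun m m' h =>
    Finset.sum_le_sum_of_subset_of_nonneg (Finset.range_mono h) fun j _ _ => hp0 j
  have hA0 : ∀ m, 0 ≤ A m := fun m => Finset.sum_nonneg fun j _ => hp0 j
  have hA1 : ∀ m, A m ≤ 1 := fun m => by
    refine (hps.sum_le_tsum _ fun j _ => hp0 j).trans ?_
    rw [hptsum, ← hc1]
    gcongr
  have hAsucc : ∀ m, A (m + 1) = A m + p m := fun m => Finset.sum_range_succ _ _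
  have hAc : ∀ {α : Type} [Primcodable α] {f : α → ℕ}, Computable f →
      RComputable fun a => A (f a) :=
    fun hf => RComputable.sum_range hf (hp.comp Computable.snd)
  -- a near basis of each projection, and a string for it if the projection is not zero
  obtain ⟨w, hw, hwP⟩ : ∃ w : ℕ → List (List (ℤ × ℤ)) × ℕ × List Bool, Computable w ∧
      ∀ m, IsNearBasis E (g m).1 (g m).2 (w m).1 (w m).2.1 ∧ ((w m).1.length = 0 ∨
        (A m < binVal (w m).2.2 ∧ binVal (w m).2.2 + (2 : ℝ)⁻¹ ^ (w m).2.2.length < A (m + 1) ∧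
          p m < 16 * (2 : ℝ)⁻¹ ^ (w m).2.2.length)) := by
    have hsem : SemiDec fun x : ℕ × List (List (ℤ × ℤ)) × ℕ × List Bool =>
        IsNearBasis E (g x.1).1 (g x.1).2 x.2.1 x.2.2.1 ∧ (x.2.1.length = 0 ∨
        (A x.1 < binVal x.2.2.2 ∧ binVal x.2.2.2 + (2 : ℝ)⁻¹ ^ x.2.2.2.length < A (x.1 + 1) ∧
          p x.1 < 16 * (2 : ℝ)⁻¹ ^ x.2.2.2.length)) := by
      have hσ : Computable fun x : ℕ × List (List (ℤ × ℤ)) × ℕ × List Bool => x.2.2.2 := by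
        fun_prop
      have hbin := RComputable.binVal hσ
      have hlen : RComputable fun x : ℕ × List (List (ℤ × ℤ)) × ℕ × List Bool =>
          (2 : ℝ)⁻¹ ^ x.2.2.2.length := by fun_prop
      refine (SemiDec.isNearBasis E (by fun_prop) (by fun_prop) (by fun_prop) (by fun_prop)).and
        ((SemiDec.of_decide (computable_decide_nat_eq (by fun_prop) (Computable.const 0))).or
          ((SemiDec.lt (hAc Computable.fst) hbin).and
            ((SemiDec.lt (hbin.add hlen) (hAc (by fun_prop))).and
              (SemiDec.lt (hp.comp Computable.fst) ((RComputable.ofNat 16).mul hlen)))))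
    refine hsem.exists_choice fun m => ?_
    obtain ⟨W, K, h⟩ := exists_isNearBasis E (hgS m).spec.1
    by_cases hW : W.length = 0
    · exact ⟨(W, K, []), h, Or.inl hW⟩
    · have hppos : 0 < p m := by
        have : (0 : ℝ) < W.length := by exact_mod_cast Nat.pos_of_ne_zero hW
        rw [hpτ, hrank m W K h]
        positivity
      obtain ⟨σ, h1, h2, h3⟩ := exists_dyadic_between (hA0 m) hppos (by rw [← hAsucc]; exact hA1 _)
      exact ⟨(W, K, σ), h, Or.inr ⟨h1, by rw [hAsucc]; exact h2, h3⟩⟩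
  let t : ℕ → Option (List Bool) := fun m => if (w m).1.length = 0 then none else some (w m).2.2
  let o : ℕ → ℕ := fun m => Encodable.encode (((g m).1, unitCodes (g m).1 (w m).1) : ArrayCode)
  have ht : Computable t := computable_ite
    (computable_decide_nat_eq (by fun_prop) (Computable.const 0)) (Computable.const none)
    (Computable.option_some.comp (by fun_prop))
  have ho : Computable o := by
    have h1 : Computable fun m => unitCodes (g m).1 (w m).1 :=
      computable_unitCodes (by fun_prop) (by fun_prop)
    exact computable_encode ((Computable.fst.comp hg).pair h1)
  have htσ : ∀ m σ, t m = some σ → A m < binVal σ ∧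
      binVal σ + (2 : ℝ)⁻¹ ^ σ.length < A (m + 1) := by
    intro m σ hm
    have h0 : ¬(w m).1.length = 0 ∧ (w m).2.2 = σ := by simpa [t] using hm
    obtain ⟨h1, h2, -⟩ := (hwP m).2.resolve_left h0.1
    rw [← h0.2]
    exact ⟨h1, h2⟩
  obtain ⟨C, hC, hCo⟩ := QRand.exists_machine ht ho (by
      rintro m m' σ _ hm hm' ⟨π, rfl⟩
      obtain ⟨h1, h2⟩ := htσ m σ hm
      obtain ⟨h3, h4⟩ := htσ m' _ hm'
      obtain ⟨h5, h6⟩ := binVal_append_bounds σ π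
      have h7 : (0 : ℝ) < (2 : ℝ)⁻¹ ^ (σ ++ π).length := by positivity
      rcases lt_trichotomy m m' with h | h | h
      · linarith [hAmono (Nat.succ_le_of_lt h)]
      · exact h
      · linarith [hAmono (Nat.succ_le_of_lt h)]) (by
      refine isComputableReal_tsum_of_le hp (RComputable.elim_inv_two_pow ht) ?_ ?_ hps hpc
      · intro m
        cases t m with
        | none => exact le_rfl
        | some σ => simp only [Option.elim_some]; positivity
      · intro m
        cases hm : t m with
        | none => exact hp0 m
        | some σ =>
          have := htσ m σ hm
          rw [hAsucc] at this
          simp only [Option.elim_some]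
          linarith)
  refine ⟨C, hC, c + 4, fun N => ?_⟩
  -- a late enough projection of the test lives on many qubits, unless it is zero
  obtain ⟨m, hm, hmN⟩ := (Frequently.and_eventually hfail
    (hsum.tendsto_atTop_zero.eventually_lt_const
      (show (0 : ℝ) < (2 : ℝ)⁻¹ ^ N by positivity))).exists
  obtain ⟨hnb, hstr⟩ := hwP m
  obtain ⟨F, hFi, hFo, hFc, hFρ⟩ := hnb.exists_finset hEpos (hgS m).spec.1
  have h1 := hFρ (ρ.seq (g m).1) (ρ.posSemidef _) (ρ.trace_eq_one _)
  rw [← (hgS m).spec.2] at h1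
  have hne : (w m).1.length ≠ 0 := by
    intro h0
    rw [h0, Finset.card_eq_zero] at hFc
    rw [hFc, Finset.sum_empty] at h1
    linarith
  obtain ⟨-, -, h16⟩ := hstr.resolve_left hne
  have hr1 : (1 : ℝ) ≤ (w m).1.length := by exact_mod_cast Nat.one_le_iff_ne_zero.2 hne
  refine ⟨(g m).1, ?_, ?_⟩
  · rw [hrank m _ _ hnb] at hmN
    have h2 : (2 : ℝ)⁻¹ ^ (g m).1 < (2 : ℝ)⁻¹ ^ N := by
      refine lt_of_le_of_lt ?_ hmN
      exact le_mul_of_one_le_left (by positivity) hr1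
    exact ((pow_lt_pow_iff_right_of_lt_one₀ (by norm_num) (by norm_num)).1 h2).le
  · refine lt_of_le_of_lt (sInf_le ⟨(w m).2.2, F, ⟨o m, hCo m _ (if_neg hne), hFi⟩, hFo,
      by linarith, rfl⟩) (EReal.coe_lt_coe_iff.2 ?_)
    have hr0 : (0 : ℝ) < (w m).1.length := by linarith
    rw [hpτ, hrank m _ _ hnb] at h16
    have h3 : ((w m).1.length : ℝ) * 2 ^ (w m).2.2.length < 2 ^ ((g m).1 + c + 4) := by
      rw [inv_pow, inv_pow, inv_pow, ← div_eq_mul_inv, ← div_eq_mul_inv, ← div_eq_mul_inv, div_div,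
        div_lt_div_iff₀ (by positivity) (by positivity)] at h16
      rw [pow_add, pow_add]
      linarith
    have h4 := Real.logb_lt_logb one_lt_two (by positivity) h3
    rw [Real.logb_mul hr0.ne' (by positivity), Real.logb_pow, Real.logb_pow,
      Real.logb_self_eq_one one_lt_two] at h4
    push_cast at h4
    rw [hFc]
    linarith

end QRand

theorem mainTheorem2 (ρ : QRand.QState) :
    ρ.IsQuantumSchnorrRandom ↔
      ∀ C : List Bool →. ℕ, QRand.IsComputableMeasureMachine C →
        ∀ ε : ℝ, 0 < ε → ∀ d : ℝ,
          ∀ᶠ n : ℕ in atTop, (((n : ℝ) + d : ℝ) : EReal) < QRand.QK C ε (ρ.seq n) := by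
  refine ⟨fun hρ C hC ε hε d => hρ.eventually_lt_QK hC hε d, fun h S hS δ hδ hfail => ?_⟩
  obtain ⟨C, hC, d, hd⟩ := hfail.exists_machine hS hδ
  obtain ⟨N, hN⟩ := eventually_atTop.1 (h C hC (δ / 4) (by positivity) d)
  obtain ⟨n, hn, hlt⟩ := hd N
  exact lt_asymm hlt (hN n hn)
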